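/- Let $\nu_t$, $0\le t<1$, be a measure-valued solution of Smoluchowski's coagulation equation with kernel $K(x,y)=xy$ on $E=(0,\infty)$, normalized by $\int_E x^2\,\nu_0(dx)=1$, so that the gelation time is $1$. Here each $\nu_t$ is a positive Radon measure on $E$; $t\mapsto\nu_t(B)$ is measurable for every compact $B\subset E$; $\int_0^t\big(\int_E x^2\,\nu_\tau(dx)\big)^2d\tau<\infty$ for $t\in(0,1)$; and for all $t\in[0,1)$ $$\int_E f\,d\nu_t=\int_E f\,d\nu_0+\int_0^t\frac12\int_E\int_E\big[f(x+y)-f(x)-f(y)\big]\,xy\;\nu_\tau(dx)\,\nu_\tau(dy)\,d\tau$$ (with all integrals meaningful) for every $f\in C^2(E)$ such that $f,f',f''$ have finite limits at $0$ and $\infty$, $f(0)=f'(0)=0$, and $|f'(x)|+|f''(x)|\le Ce^{-\alpha x}$ for some $C$ and some $\alpha>0$. Put $$V(t,x)=\int_{(0,x]}y^2\,\nu_t(dy)\Big/\int_E y^2\,\nu_t(dy).$$ A positive function $L$ on $(0,\infty)$ is slowly varying at infinity if $L(cx)/L(x)\to1$ as $x\to\infty$ for every $c>0$. For $\rho\in(0,1]$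 let $\beta=\rho/(1+\rho)$ and $$M_\rho(x)=\sum_{k=1}^\infty\frac{(-1)^{k-1}x^{k\beta}}{k!}\,\Gamma(1+k-k\beta)\,\frac{\sin \pi k\beta}{\pi k\beta},\qquad x\ge0 .$$ 1. Suppose there are a function $\lambda(t)\to\infty$ as $t\uparrow1$ and a probability distribution function $V_*$ on $[0,\infty)$ that is nontrivial, i.e. $V_*(x)<1$ for some $x>0$, such that $\lim_{t\uparrow1}V(t,\lambda(t)x)=V_*(x)$ at all points $x\ge0$ of continuity of $V_*$. Then there exist $\rho\in(0,1]$ and a function $L$ slowly varying at infinity such that $$\int_{(0,x]}y^3\,\nu_0(dy)\sim x^{1-\rho}L(x)\qquad\text{as }x\to\infty.\tag{$*$}$$ 2. Conversely, suppose that $(*)$ holds for some $\rho\in(0,1]$ and some $L$ slowly varying at infinity. Then there is a strictly increasing $\lambda:[0,1)\to\mathbb R$, positive on $(0,1)$, with $\lambda(t)\to\infty$ as $t\uparrow1$ and $$\lim_{t\uparrow1}V(t,\lambda(t)x)=M_\rho(x)\qquad\text{for all }x\ge0 .$$ Moreover $M_\rho$ is the second-moment distribution function of a scaling solution: there is a solution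 $\sigma_t$, $0\le t<1$, in the above sense, with $\int_E x^2\,\sigma_0(dx)=1$, whose second-moment distribution function at time $t$ is $x\mapsto M_\rho\big((1-t)^{1/\beta}x\big)$. -/

import Mathlib

open MeasureTheory ProbabilityTheory Filter Set
open scoped Topology ENNReal Asymptotics

namespace Smoluchowski

/-- Positive Radon measures on `E = (0, ∞)`, represented as Borel measures on `ℝ` that do not
charge `(-∞, 0]` and are finite on compact subsets of `(0, ∞)`. An integral over `E` with respect
to such a measure is the integral over `ℝ`. -/
structure IsRadonPos (μ : Measure ℝ) : Prop where
  null_nonpos : μ (Iic 0) = 0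
  finite_compact : ∀ B : Set ℝ, IsCompact B → B ⊆ Ioi 0 → μ B < ∞

/-- The second moment `∫ x² μ(dx) ∈ [0, ∞]`. -/
noncomputable def secondMoment (μ : Measure ℝ) : ℝ≥0∞ :=
  ∫⁻ x, ENNReal.ofReal (x ^ 2) ∂μ

/-- The test functions of class `ℰ_k`: `f` is `C^k` on `(0, ∞)`, the derivatives
`f, f', …, f^(k)` have finite limits at `0` and at `∞`, those of order `1, …, k` decay
exponentially, and those of order `< k` vanish at `0`. Only the values of `f` on `(0, ∞)` matter;
the value at `0` is understood as the limit. -/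
structure IsTestFunction (k : ℕ) (f : ℝ → ℝ) : Prop where
  contDiffOn : ContDiffOn ℝ k f (Ioi 0)
  limit_zero : ∀ j ≤ k, ∃ l : ℝ, Tendsto (iteratedDeriv j f) (𝓝[>] 0) (𝓝 l)
  limit_infty : ∀ j ≤ k, ∃ l : ℝ, Tendsto (iteratedDeriv j f) atTop (𝓝 l)
  decay : ∃ C α : ℝ, 0 < α ∧ ∀ x : ℝ, 0 < x →
    ∑ j ∈ Finset.Icc 1 k, |iteratedDeriv j f x| ≤ C * Real.exp (-α * x)
  vanish_zero : ∀ j < k, Tendsto (iteratedDeriv j f) (𝓝[>] 0) (𝓝 0)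

/-- The coagulation functional for the kernel `K(x,y) = x y`:
`⟨f, L(μ)⟩ = ½ ∫∫ [f(x+y) - f(x) - f(y)] x y μ(dy) μ(dx)`. -/
noncomputable def coagulation (f : ℝ → ℝ) (μ : Measure ℝ) : ℝ :=
  (1 / 2) * ∫ x, ∫ y, (f (x + y) - f x - f y) * (x * y) ∂μ ∂μ

/-- `t ↦ ν t` is a (weak, measure valued) solution on `[0, T)` of Smoluchowski's coagulation
equation with kernel `K(x,y) = x y`. The integrability clauses in `weak` say that the terms of
the integrated equation are meaningful. Only the restriction of `ν` to `[0, T)` matters. -/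
structure IsSolution (T : ℝ) (ν : ℝ → Measure ℝ) : Prop where
  radon : ∀ t ∈ Ico 0 T, IsRadonPos (ν t)
  initial_moment : secondMoment (ν 0) < ∞
  measurable : ∀ B : Set ℝ, IsCompact B → B ⊆ Ioi 0 →
    Measurable fun t : Ico (0 : ℝ) T => ν t B
  moment_sq : ∀ t ∈ Ioo 0 T, ∫⁻ τ in Ioc 0 t, secondMoment (ν τ) ^ 2 < ∞
  weak : ∀ f : ℝ → ℝ, IsTestFunction 2 f → ∀ t ∈ Ico 0 T,
    Integrable f (ν t) ∧
    IntervalIntegrable (fun τ => coagulation f (ν τ)) volume 0 t ∧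
    ∫ x, f x ∂(ν t) = ∫ x, f x ∂(ν 0) + ∫ τ in (0 : ℝ)..t, coagulation f (ν τ)

/-- The second-moment distribution function `V(x) = ∫_(0,x] y² μ(dy) / ∫_E y² μ(dy)`. -/
noncomputable def secondMomentDistribution (μ : Measure ℝ) (x : ℝ) : ℝ :=
  (∫ y in Ioc 0 x, y ^ 2 ∂μ) / ∫ y, y ^ 2 ∂μ

/-- Slow variation at infinity of a positive function on `(0, ∞)`. -/
def IsSlowlyVarying (L : ℝ → ℝ) : Prop :=
  (∀ x : ℝ, 0 < x → 0 < L x) ∧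
    ∀ t : ℝ, 0 < t → Tendsto (fun x => L (t * x) / L x) atTop (𝓝 1)

/-- The exponent `β = ρ / (1 + ρ)`. -/
noncomputable def beta (ρ : ℝ) : ℝ := ρ / (1 + ρ)

/-- `M_ρ(x) = ∑_{k ≥ 1} (-1)^(k-1) x^(kβ) / k! · Γ(1 + k - kβ) · sin(π k β) / (π k β)`;
the summation index below is `n = k - 1`. -/
noncomputable def scalingDistribution (ρ x : ℝ) : ℝ :=
  ∑' n : ℕ, (-1 : ℝ) ^ n * x ^ (((n : ℝ) + 1) * beta ρ) / ((n + 1).factorial : ℝ)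
    * Real.Gamma (1 + ((n : ℝ) + 1) - ((n : ℝ) + 1) * beta ρ)
    * (Real.sin (Real.pi * ((n : ℝ) + 1) * beta ρ) / (Real.pi * ((n : ℝ) + 1) * beta ρ))

/-- `F` is the second-moment distribution function of a scaling (self-similar) solution with
second moment `1` at time `0` and length scale `(1 - t)^(-1/β)`: there is a solution `σ` on
`[0, 1)` whose second-moment distribution function at time `t` is `x ↦ F ((1 - t)^(1/β) x)`. -/
def IsScalingProfile (β : ℝ) (F : ℝ → ℝ) : Prop :=
  ∃ σ : ℝ → Measure ℝ, IsSolution 1 σ ∧ secondMoment (σ 0) = 1 ∧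
    ∀ t ∈ Ico (0 : ℝ) 1, ∀ x : ℝ, 0 ≤ x →
      secondMomentDistribution (σ t) x = F ((1 - t) ^ (1 / β) * x)

end Smoluchowski

/-! Let m_t = x² ν_t(dx) and φ_t(s) = ∫ x (1 - e^{-sx}) ν_t(dx), which is the primitive `bern` of
the Laplace transform `lap` of m_t. For the kernel xy the coagulation equation becomes the inviscid
Burgers equation ∂_t φ = φ ∂_s φ (`IsSolution.burgers`), so φ is constant along straight
characteristics: φ_t(s - t φ_0(s)) = φ_0(s) (`IsSolution.bern_characteristic`). Since φ_0(s) ≤ s by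
the normalization, characteristics stay in s > 0 for t < 1, and the second moment at time t is 1/(1
- t). The behaviour as t ↑ 1 is therefore encoded in φ_0 near 0, through e(s) = s - φ_0(s) and R =
e/φ_0 (`ratio`).

The second derivative of e is the Laplace transform of y³ ν_0(dy) (`lapDeriv`). By Karamata's
Abelian and Tauberian theorems (`regVaryingZero_lapDeriv`, `tendsto_firstMom_div`), l'Hôpital's rule
and the monotone density theorem, condition (*) amounts to regular variation of e at 0 with index 1
+ ρ.

Necessity. Suppose the rescaled laws converge to P, and let Φ = `bern P`. If S(t,w) is the starting
point of the characteristic that reaches w/λ(t) at time t, then (1-t) λ φ_0(S) → Φ(w) and λ e(S) → w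
- Φ(w). Dividing, R(S(t,w))/(1-t) → (w - Φ(w))/Φ(w), while S(t,w)/S(t,w') → Φ(w)/Φ(w'). A
monotonicity argument (`exists_tendsto_ratio`) turns this into the existence of lim R(cs)/R(s) for
each c in (0,1), inversion covers c > 1, and Cauchy's functional equation makes the limit a power of
c.

Sufficiency. Choose S(t) with R(S(t)) = 1 - t and λ(t) = 1/e(S(t)). Following the characteristic
from S(t) y, regular variation gives the limiting transform in parametric form, `lap P (y +
y^(1+ρ))` = 1/(1 + (1+ρ) y^ρ). Equivalently Φ is the inverse of y ↦ y + y^(1+ρ). Lagrange inversion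
and termwise integration show that the series M_ρ has the same Laplace transform for large
arguments, and uniqueness identifies M_ρ with the distribution function of P.

Scaling solution. Rescaling P in time gives measures that satisfy the weak equation for e^{-sx} - 1
+ sx by a direct computation in the parameter y. Second derivatives of test functions are uniform
limits of polynomials in e^{-x} without constant term, and both sides of the weak equation are
continuous in the corresponding quadratic bounds (`SatisfiesWeak.of_approx`), so the equation holds
for all test functions. -/

namespace Smoluchowski

/-! ### Laplace transforms of finite measures on [0, ∞) and their primitives -/

/-- The Laplace transform of a measure. -/
noncomputable def lap (m : Measure ℝ) (s : ℝ) : ℝ := ∫ x, Real.exp (-(s * x)) ∂m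

/-- The primitive of the Laplace transform that vanishes at `0`. -/
noncomputable def bern (m : Measure ℝ) (s : ℝ) : ℝ := ∫ u in (0 : ℝ)..s, lap m u

/-- Minus the derivative of the Laplace transform. -/
noncomputable def lapDeriv (m : Measure ℝ) (s : ℝ) : ℝ := ∫ x, x * Real.exp (-(s * x)) ∂m

lemma mul_exp_neg_le {a s x : ℝ} (ha : 0 < a) (hs : a ≤ s) (hx : 0 ≤ x) :
    x * Real.exp (-(s * x)) ≤ 1 / a := by
  have h1 : a * x + 1 ≤ Real.exp (a * x) := Real.add_one_le_exp _
  have h2 : Real.exp (-(s * x)) ≤ Real.exp (-(a * x)) :=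
    Real.exp_le_exp.2 (by nlinarith)
  have h3 : Real.exp (-(a * x)) * Real.exp (a * x) = 1 := by
    rw [← Real.exp_add]; simp
  have h4 := Real.exp_pos (-(a * x))
  rw [le_div_iff₀ ha]
  nlinarith [mul_le_mul_of_nonneg_left h2 hx]

lemma abs_exp_sub_exp_le {a s t x : ℝ} (ha : 0 < a) (hs : a ≤ s) (ht : a ≤ t) (hx : 0 ≤ x) :
    |Real.exp (-(s * x)) - Real.exp (-(t * x))| ≤ 1 / a * |s - t| := by
  have := (convex_Ici a).norm_image_sub_le_of_norm_hasDerivWithin_le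
    (f := fun s => Real.exp (-(s * x))) (f' := fun s => Real.exp (-(s * x)) * (-x)) (C := 1 / a)
    (x := t) (y := s) (fun u _ => by
      have : HasDerivAt (fun s => Real.exp (-(s * x))) (Real.exp (-(u * x)) * (-x)) u := by
        have h := ((hasDerivAt_id u).mul_const x).neg.exp
        simpa using h
      exact this.hasDerivWithinAt) (fun u hu => by
      have := mul_exp_neg_le ha hu hx
      rw [norm_mul, norm_neg, Real.norm_of_nonneg hx, Real.norm_of_nonneg (Real.exp_pos _).le,
        mul_comm]
      exact this) ht hs
  simpa [Real.norm_eq_abs] using this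

section
variable {m : Measure ℝ} [IsFiniteMeasure m]

omit [IsFiniteMeasure m] in
lemma ae_nonneg_of_null (hm : m (Iio 0) = 0) : ∀ᵐ x ∂m, 0 ≤ x := by
  rw [ae_iff]; simpa [Iio] using hm

lemma integrable_exp_neg (hm : m (Iio 0) = 0) {s : ℝ} (hs : 0 ≤ s) :
    Integrable (fun x => Real.exp (-(s * x))) m := by
  refine Integrable.mono' (integrable_const (1 : ℝ)) (by fun_prop) ?_
  filter_upwards [ae_nonneg_of_null hm] with x hx
  rw [Real.norm_of_nonneg (Real.exp_pos _).le]
  exact Real.exp_le_one_iff.2 (by nlinarith)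

lemma integrable_mul_exp_neg (hm : m (Iio 0) = 0) {s : ℝ} (hs : 0 < s) :
    Integrable (fun x => x * Real.exp (-(s * x))) m := by
  refine Integrable.mono' (integrable_const (1 / s)) (by fun_prop) ?_
  filter_upwards [ae_nonneg_of_null hm] with x hx
  rw [Real.norm_of_nonneg (by positivity)]
  exact mul_exp_neg_le hs le_rfl hx

omit [IsFiniteMeasure m] in
lemma lap_nonneg (s : ℝ) : 0 ≤ lap m s := integral_nonneg fun _ => (Real.exp_pos _).le

omit [IsFiniteMeasure m] in
lemma lap_zero : lap m 0 = m.real univ := by simp [lap]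

lemma lap_anti (hm : m (Iio 0) = 0) : AntitoneOn (lap m) (Ici 0) := by
  intro s hs t ht hst
  refine integral_mono_ae (integrable_exp_neg hm ht) (integrable_exp_neg hm hs) ?_
  filter_upwards [ae_nonneg_of_null hm] with x hx
  exact Real.exp_le_exp.2 (by nlinarith)

lemma lap_le (hm : m (Iio 0) = 0) {s : ℝ} (hs : 0 ≤ s) : lap m s ≤ m.real univ := by
  rw [← lap_zero]; exact lap_anti hm self_mem_Ici hs hs

lemma lap_pos (hm : m (Iio 0) = 0) (h0 : m ≠ 0) {s : ℝ} (hs : 0 ≤ s) : 0 < lap m s := by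
  refine (integral_pos_iff_support_of_nonneg (fun x => (Real.exp_pos _).le)
    (integrable_exp_neg hm hs)).2 ?_
  have : Function.support (fun x => Real.exp (-(s * x))) = univ := by
    ext x; simp [Real.exp_ne_zero]
  rw [this]; simpa [pos_iff_ne_zero] using h0

lemma continuousOn_lap (hm : m (Iio 0) = 0) : ContinuousOn (lap m) (Ici 0) := by
  intro s hs
  refine tendsto_integral_filter_of_dominated_convergence (fun _ => 1) ?_ ?_
    (integrable_const _) ?_
  · exact Eventually.of_forall fun _ => by fun_prop
  · filter_upwards [self_mem_nhdsWithin] with u hu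
    filter_upwards [ae_nonneg_of_null hm] with x hx
    rw [Real.norm_of_nonneg (Real.exp_pos _).le]
    have : (0 : ℝ) ≤ u := hu
    exact Real.exp_le_one_iff.2 (by nlinarith)
  · refine Eventually.of_forall fun x => ?_
    have : Continuous fun u : ℝ => Real.exp (-(u * x)) := by fun_prop
    exact this.continuousAt.tendsto.mono_left nhdsWithin_le_nhds

/-- No moment of m is assumed, so the Lipschitz constant must blow up as a → 0. This suffices for
the characteristics, which stay away from 0 on compact time intervals. -/
lemma abs_lap_sub_le (hm : m (Iio 0) = 0) {a s t : ℝ} (ha : 0 < a) (hs : a ≤ s) (ht : a ≤ t) :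
    |lap m s - lap m t| ≤ m.real univ / a * |s - t| := by
  have hs0 := integrable_exp_neg hm (ha.le.trans hs)
  have ht0 := integrable_exp_neg hm (ha.le.trans ht)
  rw [lap, lap, ← integral_sub hs0 ht0]
  have := norm_integral_le_of_norm_le_const (μ := m) (C := 1 / a * |s - t|)
    (f := fun x => Real.exp (-(s * x)) - Real.exp (-(t * x))) (by
      filter_upwards [ae_nonneg_of_null hm] with x hx
      exact abs_exp_sub_exp_le ha hs ht hx)
  refine this.trans (le_of_eq ?_)
  ring

lemma hasDerivAt_lap (hm : m (Iio 0) = 0) {s : ℝ} (hs : 0 < s) :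
    HasDerivAt (lap m) (-lapDeriv m s) s := by
  have := (hasDerivAt_integral_of_dominated_loc_of_deriv_le (μ := m) (x₀ := s)
    (s := Ioi (s / 2)) (F := fun s x => Real.exp (-(s * x)))
    (F' := fun s x => -(x * Real.exp (-(s * x)))) (bound := fun _ => 1 / (s / 2))
    (Ioi_mem_nhds (by linarith)) (Eventually.of_forall fun _ => by fun_prop)
    (integrable_exp_neg hm hs.le) (by fun_prop) ?_ (integrable_const _) ?_).2
  · rw [integral_neg] at this; exact this
  · filter_upwards [ae_nonneg_of_null hm] with x hx u hu
    rw [norm_neg, Real.norm_of_nonneg (by positivity)]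
    exact mul_exp_neg_le (by linarith) (le_of_lt hu) hx
  · refine Eventually.of_forall fun x u _ => ?_
    have h := ((hasDerivAt_id u).mul_const x).neg.exp
    convert! h using 1
    simp; ring

lemma lapDeriv_pos (hm : m (Iio 0) = 0) (h0 : m (Ioi 0) ≠ 0) {s : ℝ} (hs : 0 < s) :
    0 < lapDeriv m s := by
  refine (integral_pos_iff_support_of_nonneg_ae ?_ (integrable_mul_exp_neg hm hs)).2 ?_
  · filter_upwards [ae_nonneg_of_null hm] with x hx
    simp only [Pi.zero_apply]; positivity
  · refine (pos_iff_ne_zero.2 h0).trans_le (measure_mono fun x hx => ?_)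
    simp [Real.exp_ne_zero, (ne_of_gt hx : x ≠ 0)]

lemma lapDeriv_anti (hm : m (Iio 0) = 0) : AntitoneOn (lapDeriv m) (Ioi 0) := by
  intro s hs t ht hst
  refine integral_mono_ae (integrable_mul_exp_neg hm ht) (integrable_mul_exp_neg hm hs) ?_
  filter_upwards [ae_nonneg_of_null hm] with x hx
  exact mul_le_mul_of_nonneg_left (Real.exp_le_exp.2 (by nlinarith)) hx

lemma lap_strictAnti (hm : m (Iio 0) = 0) (h0 : m (Ioi 0) ≠ 0) :
    StrictAntiOn (lap m) (Ici 0) := by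
  refine strictAntiOn_of_deriv_neg (convex_Ici 0) (continuousOn_lap hm) fun s hs => ?_
  rw [interior_Ici] at hs
  rw [(hasDerivAt_lap hm hs).deriv]
  simpa using lapDeriv_pos hm h0 hs

lemma intervalIntegrable_lap (hm : m (Iio 0) = 0) {a b : ℝ} (ha : 0 ≤ a) (hb : 0 ≤ b) :
    IntervalIntegrable (lap m) volume a b := by
  refine ((continuousOn_lap hm).mono ?_).intervalIntegrable
  intro x hx
  exact (le_min ha hb).trans hx.1

omit [IsFiniteMeasure m] in
@[simp] lemma bern_zero : bern m 0 = 0 := by simp [bern]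

lemma bern_sub (hm : m (Iio 0) = 0) {a b : ℝ} (ha : 0 ≤ a) (hb : 0 ≤ b) :
    bern m b - bern m a = ∫ u in a..b, lap m u :=
  intervalIntegral.integral_interval_sub_left (intervalIntegrable_lap hm le_rfl hb)
    (intervalIntegrable_lap hm le_rfl ha)

lemma hasDerivAt_bern (hm : m (Iio 0) = 0) {s : ℝ} (hs : 0 < s) :
    HasDerivAt (bern m) (lap m s) s := by
  refine intervalIntegral.integral_hasDerivAt_right (intervalIntegrable_lap hm le_rfl hs.le) ?_
    ((continuousOn_lap hm).continuousAt (Ici_mem_nhds hs))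
  exact ((continuousOn_lap hm).mono Ioi_subset_Ici_self).stronglyMeasurableAtFilter isOpen_Ioi s hs

lemma continuousOn_bern (hm : m (Iio 0) = 0) : ContinuousOn (bern m) (Ici 0) := by
  intro s hs
  have h := intervalIntegral.continuousOn_primitive_interval (μ := volume) (f := lap m) (a := 0)
    (b := s + 1) (by
      rw [uIcc_of_le (by have : (0 : ℝ) ≤ s := hs; linarith)]
      exact ((continuousOn_lap hm).mono Icc_subset_Ici_self).integrableOn_Icc)
  rw [uIcc_of_le (by have : (0 : ℝ) ≤ s := hs; linarith)] at h
  have h1 := h s ⟨hs, by linarith⟩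
  refine h1.mono_of_mem_nhdsWithin ?_
  rw [← Ici_inter_Iic]
  exact inter_mem self_mem_nhdsWithin (mem_nhdsWithin_of_mem_nhds (Iic_mem_nhds (by linarith)))

lemma bern_le (hm : m (Iio 0) = 0) {s : ℝ} (hs : 0 ≤ s) : bern m s ≤ m.real univ * s := by
  have := intervalIntegral.integral_mono_on hs (intervalIntegrable_lap hm le_rfl hs)
    (intervalIntegrable_const (c := m.real univ)) (fun x hx => lap_le hm hx.1)
  simp only [intervalIntegral.integral_const, sub_zero, smul_eq_mul] at this
  rw [bern]; linarith

lemma mul_lap_le_bern (hm : m (Iio 0) = 0) {s : ℝ} (hs : 0 ≤ s) : s * lap m s ≤ bern m s := by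
  have := intervalIntegral.integral_mono_on hs (intervalIntegrable_const (c := lap m s))
    (intervalIntegrable_lap hm le_rfl hs) (fun x hx => lap_anti hm hx.1 hs hx.2)
  simpa [bern] using this

lemma bern_pos (hm : m (Iio 0) = 0) (h0 : m ≠ 0) {s : ℝ} (hs : 0 < s) : 0 < bern m s :=
  (mul_pos hs (lap_pos hm h0 hs.le)).trans_le (mul_lap_le_bern hm hs.le)

lemma bern_nonneg (hm : m (Iio 0) = 0) {s : ℝ} (hs : 0 ≤ s) : 0 ≤ bern m s :=
  (mul_nonneg hs (lap_nonneg _)).trans (mul_lap_le_bern hm hs)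

lemma bern_mono (hm : m (Iio 0) = 0) : MonotoneOn (bern m) (Ici 0) := by
  refine monotoneOn_of_deriv_nonneg (convex_Ici 0) (continuousOn_bern hm) ?_ fun s hs => ?_
  · intro s hs
    rw [interior_Ici] at hs
    exact (hasDerivAt_bern hm hs).differentiableAt.differentiableWithinAt
  · rw [interior_Ici] at hs
    rw [(hasDerivAt_bern hm hs).deriv]
    exact lap_nonneg _

lemma bern_strictMono (hm : m (Iio 0) = 0) (h0 : m ≠ 0) : StrictMonoOn (bern m) (Ici 0) := by
  refine strictMonoOn_of_deriv_pos (convex_Ici 0) (continuousOn_bern hm) fun s hs => ?_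
  rw [interior_Ici] at hs
  rw [(hasDerivAt_bern hm hs).deriv]
  exact lap_pos hm h0 hs.le

omit [IsFiniteMeasure m] in
lemma lap_map_mul (c s : ℝ) : lap (m.map (c * ·)) s = lap m (c * s) := by
  rw [lap, integral_map (by fun_prop) (by fun_prop), lap]
  congr with x; congr 1; ring

omit [IsFiniteMeasure m] in
lemma bern_map_mul {c : ℝ} (hc : c ≠ 0) (s : ℝ) :
    bern (m.map (c * ·)) s = c⁻¹ * bern m (c * s) := by
  simp only [bern, lap_map_mul]
  rw [intervalIntegral.integral_comp_mul_left _ hc]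
  simp

end

/-! ### Regular variation at zero and the monotone density theorem -/

/-- Regular variation at `0+` with index `a`. -/
def RegVaryingZero (f : ℝ → ℝ) (a : ℝ) : Prop :=
  ∀ c : ℝ, 0 < c → Tendsto (fun s => f (c * s) / f s) (𝓝[>] 0) (𝓝 (c ^ a))

/-- Derivatives of convex functions converge when the functions do. -/
lemma tendsto_deriv_of_monotone {ι : Type*} {l : Filter ι} {F F' : ι → ℝ → ℝ} {G : ℝ → ℝ}
    {y d : ℝ} (hy : 0 < y)
    (hF : ∀ᶠ i in l, ∀ x, 0 < x → HasDerivAt (F i) (F' i x) x)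
    (hmono : ∀ᶠ i in l, MonotoneOn (F' i) (Ioi 0))
    (hlim : ∀ x, 0 < x → Tendsto (fun i => F i x) l (𝓝 (G x)))
    (hG : HasDerivAt G d y) : Tendsto (fun i => F' i y) l (𝓝 d) := by
  have hslope := hasDerivAt_iff_tendsto_slope.1 hG
  -- By convexity the derivative at y lies between secant slopes to the left and to the right of y.
  -- Those slopes converge to secant slopes of G, which are close to d when x is close to y.
  have key : ∀ i, (∀ x, 0 < x → HasDerivAt (F i) (F' i x) x) → MonotoneOn (F' i) (Ioi 0) →
      (∀ x, y < x → F' i y * (x - y) ≤ F i x - F i y) ∧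
      (∀ x, 0 < x → x < y → F i y - F i x ≤ F' i y * (y - x)) := by
    intro i h1 h2
    refine ⟨fun x hx => ?_, fun x hx0 hx => ?_⟩
    · obtain ⟨z, hz, hz'⟩ := exists_hasDerivAt_eq_slope (F i) (F' i) hx
        (fun u hu => (h1 u (hy.trans_le hu.1)).continuousAt.continuousWithinAt)
        (fun u hu => h1 u (hy.trans hu.1))
      rw [eq_div_iff (by linarith)] at hz'
      rw [← hz']
      exact mul_le_mul_of_nonneg_right (h2 hy (hy.trans hz.1) hz.1.le) (by linarith)
    · obtain ⟨z, hz, hz'⟩ := exists_hasDerivAt_eq_slope (F i) (F' i) hx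
        (fun u hu => (h1 u (hx0.trans_le hu.1)).continuousAt.continuousWithinAt)
        (fun u hu => h1 u (hx0.trans hu.1))
      rw [eq_div_iff (by linarith)] at hz'
      rw [← hz']
      exact mul_le_mul_of_nonneg_right (h2 (hx0.trans hz.1) hy hz.2.le) (by linarith)
  refine tendsto_order.2 ⟨fun a ha => ?_, fun a ha => ?_⟩
  · have h1 : ∀ᶠ x in 𝓝[<] y, a < slope G y x :=
      (hslope.mono_left (nhdsWithin_mono y fun x hx => ne_of_lt hx)).eventually (lt_mem_nhds ha)
    have h2 : ∀ᶠ x in 𝓝[<] y, 0 < x := mem_nhdsWithin_of_mem_nhds (Ioi_mem_nhds hy)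
    obtain ⟨x, hx1, hx2, hx3⟩ := (h1.and (h2.and self_mem_nhdsWithin)).exists
    have hx3 : x < y := hx3
    have h3 : Tendsto (fun i => (F i x - F i y) / (x - y)) l (𝓝 ((G x - G y) / (x - y))) :=
      ((hlim x hx2).sub (hlim y hy)).div_const _
    rw [slope_def_field] at hx1
    filter_upwards [h3.eventually (lt_mem_nhds hx1), hF, hmono] with i hi h1 h2
    refine hi.trans_le ?_
    rw [div_le_iff_of_neg (by linarith)]
    nlinarith [(key i h1 h2).2 x hx2 hx3]
  · have h1 : ∀ᶠ x in 𝓝[>] y, slope G y x < a :=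
      (hslope.mono_left (nhdsWithin_mono y fun x hx => ne_of_gt hx)).eventually (gt_mem_nhds ha)
    obtain ⟨x, hx1, hx3⟩ := (h1.and self_mem_nhdsWithin).exists
    have hx3 : y < x := hx3
    have h3 : Tendsto (fun i => (F i x - F i y) / (x - y)) l (𝓝 ((G x - G y) / (x - y))) :=
      ((hlim x (hy.trans hx3)).sub (hlim y hy)).div_const _
    rw [slope_def_field] at hx1
    filter_upwards [h3.eventually (gt_mem_nhds hx1), hF, hmono] with i hi h1 h2
    refine lt_of_le_of_lt ?_ hi
    rw [le_div_iff₀ (by linarith)]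
    exact (key i h1 h2).1 x hx3

/-- The rescaled functions y ↦ f(sy)/f(s) are convex or concave and converge pointwise to y^a, so
their derivatives converge as well. No second derivative of f is needed. -/
lemma RegVaryingZero.tendsto_deriv_of_monotone {f f' : ℝ → ℝ} {a : ℝ} (hf : RegVaryingZero f a)
    (hpos : ∀ s, 0 < s → 0 < f s) (hd : ∀ s, 0 < s → HasDerivAt f (f' s) s)
    (hmono : MonotoneOn f' (Ioi 0) ∨ AntitoneOn f' (Ioi 0)) {y : ℝ} (hy : 0 < y) :
    Tendsto (fun s => s * f' (s * y) / f s) (𝓝[>] 0) (𝓝 (a * y ^ (a - 1))) := by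
  have hG : HasDerivAt (fun y : ℝ => y ^ a) (a * y ^ (a - 1)) y :=
    Real.hasDerivAt_rpow_const (Or.inl hy.ne')
  have hderiv : ∀ s, 0 < s → ∀ x, 0 < x →
      HasDerivAt (fun y => f (s * y) / f s) (s * f' (s * x) / f s) x := fun s hs x hx => by
    have h := (hd (s * x) (by positivity)).comp x ((hasDerivAt_id x).const_mul s)
    have h' := h.div_const (f s)
    convert! h' using 1
    simp; ring
  have hlim : ∀ x, 0 < x → Tendsto (fun s => f (s * x) / f s) (𝓝[>] 0) (𝓝 (x ^ a)) := by
    intro x hx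
    simpa only [mul_comm] using hf x hx
  rcases hmono with hmono | hmono
  · refine Smoluchowski.tendsto_deriv_of_monotone (F := fun s y => f (s * y) / f s)
      (F' := fun s y => s * f' (s * y) / f s) hy ?_ ?_ hlim hG
    · filter_upwards [self_mem_nhdsWithin] with s hs using hderiv s hs
    · filter_upwards [self_mem_nhdsWithin] with s (hs : 0 < s) x (hx : 0 < x) z (hz : 0 < z) hxz
      have := hmono (mul_pos hs hx) (mul_pos hs hz) (mul_le_mul_of_nonneg_left hxz hs.le)
      have := hpos s hs
      dsimp only; gcongr
  · have := Smoluchowski.tendsto_deriv_of_monotone (F := fun s y => -(f (s * y) / f s))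
      (F' := fun s y => -(s * f' (s * y) / f s)) (l := 𝓝[>] 0) hy ?_ ?_
      (fun x hx => (hlim x hx).neg) hG.neg
    · simpa using this.neg
    · filter_upwards [self_mem_nhdsWithin] with s hs x hx using (hderiv s hs x hx).neg
    · filter_upwards [self_mem_nhdsWithin] with s (hs : 0 < s) x (hx : 0 < x) z (hz : 0 < z) hxz
      have := hmono (mul_pos hs hx) (mul_pos hs hz) (mul_le_mul_of_nonneg_left hxz hs.le)
      have := hpos s hs
      dsimp only; gcongr

/-- Divide the limits at y = c and y = 1; the condition a ≠ 0 keeps the second one away from zero.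
-/
lemma RegVaryingZero.deriv {f f' : ℝ → ℝ} {a : ℝ} (hf : RegVaryingZero f a) (ha : a ≠ 0)
    (hpos : ∀ s, 0 < s → 0 < f s) (hd : ∀ s, 0 < s → HasDerivAt f (f' s) s)
    (hmono : MonotoneOn f' (Ioi 0) ∨ AntitoneOn f' (Ioi 0)) :
    RegVaryingZero f' (a - 1) := by
  intro c hc
  have h1 := hf.tendsto_deriv_of_monotone hpos hd hmono hc
  have h2 := hf.tendsto_deriv_of_monotone hpos hd hmono one_pos
  have h3 := h1.div h2 (by simpa using ha)
  have : a * c ^ (a - 1) / (a * 1 ^ (a - 1)) = c ^ (a - 1) := by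
    rw [Real.one_rpow]; field_simp
  rw [this] at h3
  refine h3.congr' ?_
  filter_upwards [self_mem_nhdsWithin] with s (hs : 0 < s)
  have := (hpos s hs).ne'
  simp only [Pi.div_apply, mul_one, mul_comm s c]
  rw [div_div_div_cancel_right₀ this, mul_div_mul_left _ _ hs.ne']

/-- A primitive of a regularly varying function is regularly varying. -/
lemma RegVaryingZero.primitive {f f' : ℝ → ℝ} {a : ℝ} (hf : RegVaryingZero f' a)
    (hpos : ∀ s, 0 < s → 0 < f' s) (hd : ∀ s, 0 < s → HasDerivAt f (f' s) s)
    (h0 : Tendsto f (𝓝[>] 0) (𝓝 0)) : RegVaryingZero f (a + 1) := by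
  intro c hc
  have hev : ∀ᶠ s : ℝ in 𝓝[>] 0, 0 < s := self_mem_nhdsWithin
  have hc0 : Tendsto (fun s : ℝ => c * s) (𝓝[>] 0) (𝓝[>] 0) := by
    refine tendsto_nhdsWithin_iff.2 ⟨?_, hev.mono fun s hs => mul_pos hc hs⟩
    have : Tendsto (fun s : ℝ => c * s) (𝓝 0) (𝓝 (c * 0)) := (continuous_const_mul c).tendsto 0
    rw [mul_zero] at this
    exact this.mono_left nhdsWithin_le_nhds
  -- L'Hôpital for f(cs)/f(s): the quotient of derivatives is c f'(cs)/f'(s), with limit c · c^a.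
  refine HasDerivAt.lhopital_zero_nhdsGT (f' := fun s => c * f' (c * s)) (g' := f')
    (hev.mono fun s hs => ?_) (hev.mono hd) (hev.mono fun s hs => (hpos s hs).ne')
    (h0.comp hc0) h0 ?_
  · have h := (hd (c * s) (by positivity)).comp s ((hasDerivAt_id s).const_mul c)
    convert! h using 1
    simp; ring
  · have := (hf c hc).const_mul c
    rw [Real.rpow_add_one hc.ne', mul_comm]
    refine this.congr fun s => by ring


/-! ### The continuity theorem for Laplace transforms -/

open unitInterval in
/-- Convergence of moments on the unit interval implies convergence of all integrals of
continuous functions. -/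
lemma tendsto_integral_of_tendsto_moments {ι : Type*} {l : Filter ι} {Q : ι → Measure I}
    [∀ i, IsProbabilityMeasure (Q i)] {Q₀ : Measure I} [IsProbabilityMeasure Q₀]
    (h : ∀ n : ℕ, Tendsto (fun i => ∫ u, (u : ℝ) ^ n ∂(Q i)) l (𝓝 (∫ u, (u : ℝ) ^ n ∂Q₀)))
    (f : C(I, ℝ)) : Tendsto (fun i => ∫ u, f u ∂(Q i)) l (𝓝 (∫ u, f u ∂Q₀)) := by
  have hint : ∀ (g : C(I, ℝ)) (S : Measure I) [IsProbabilityMeasure S], Integrable (fun u => g u) S := by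
    intro g S _
    exact (BoundedContinuousFunction.mkOfCompact g).integrable S
  have hpoly : ∀ p : Polynomial ℝ, Tendsto (fun i => ∫ u, p.eval (u : ℝ) ∂(Q i)) l
      (𝓝 (∫ u, p.eval (u : ℝ) ∂Q₀)) := by
    intro p
    have hp : ∀ (S : Measure I) [IsProbabilityMeasure S], ∫ u, p.eval (u : ℝ) ∂(S)
        = ∑ n ∈ p.support, p.coeff n * ∫ u, (u : ℝ) ^ n ∂(S) := by
      intro S _
      simp only [Polynomial.eval_eq_sum, Polynomial.sum]
      rw [integral_finsetSum]
      · simp only [integral_const_mul]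
      · intro n _
        exact hint ⟨fun u : I => p.coeff n * (u : ℝ) ^ n, by fun_prop⟩ S
    simp only [hp]
    exact tendsto_finsetSum _ fun n _ => (h n).const_mul _
  rw [Metric.tendsto_nhds]
  intro ε hε
  -- Weierstrass: replacing f by p costs ε/3 under every probability measure, and the polynomial
  -- integrals are within ε/3 eventually.
  obtain ⟨p, hp⟩ := exists_polynomial_near_continuousMap 0 1 f (ε / 3) (by positivity)
  have hclose : ∀ (S : Measure I) [IsProbabilityMeasure S],
      |∫ u, f u ∂(S) - ∫ u, p.eval (u : ℝ) ∂(S)| ≤ ε / 3 := by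
    intro S _
    have hsub : ∫ u, (f u - p.eval (u : ℝ)) ∂(S) = ∫ u, f u ∂(S) - ∫ u, p.eval (u : ℝ) ∂(S) :=
      integral_sub (hint f S) (hint (p.toContinuousMapOn I) S)
    rw [← hsub]
    have := norm_integral_le_of_norm_le_const (μ := S) (C := ε / 3)
      (f := fun u => f u - p.eval (u : ℝ)) (Eventually.of_forall fun u => by
        have := (ContinuousMap.norm_coe_le_norm (p.toContinuousMapOn I - f) u).trans hp.le
        rw [norm_sub_rev]
        exact this)
    simpa using this
  filter_upwards [Metric.tendsto_nhds.1 (hpoly p) (ε / 3) (by positivity)] with i hi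
  rw [Real.dist_eq] at hi ⊢
  have h1 := hclose (Q i)
  have h2 := hclose Q₀
  rw [abs_le] at h1 h2
  rw [abs_lt] at hi ⊢
  constructor <;> linarith [h1.1, h1.2, h2.1, h2.2, hi.1, hi.2]

open unitInterval in
/-- The map `x ↦ exp (-x)` from `[0, ∞)` to the unit interval. -/
noncomputable def expNeg (x : ℝ) : I :=
  ⟨Real.exp (-max x 0), (Real.exp_pos _).le, Real.exp_le_one_iff.2 (by simp)⟩

lemma continuous_expNeg : Continuous expNeg := by
  unfold expNeg; fun_prop

lemma integral_rpow_map_expNeg {m : Measure ℝ} (hm : m (Iio 0) = 0) {w : ℝ} (hw : 0 ≤ w) :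
    ∫ u, (u : ℝ) ^ w ∂(m.map expNeg) = lap m w := by
  rw [integral_map continuous_expNeg.measurable.aemeasurable, lap]
  · refine integral_congr_ae ?_
    filter_upwards [ae_nonneg_of_null hm] with x hx
    simp only [expNeg, max_eq_left hx]
    rw [← Real.exp_mul]; congr 1; ring
  · exact Continuous.aestronglyMeasurable
      (continuous_subtype_val.rpow_const fun _ => Or.inr hw)

open unitInterval in
/-- The continuity theorem for Laplace transforms of probability measures on `[0, ∞)`. -/
theorem exists_limit_of_tendsto_lap {ι : Type*} {l : Filter ι} [l.NeBot] {U : ι → Measure ℝ}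
    [∀ i, IsProbabilityMeasure (U i)] (hU : ∀ i, U i (Iio 0) = 0) {g : ℝ → ℝ}
    (hg : ∀ w, 0 < w → Tendsto (fun i => lap (U i) w) l (𝓝 (g w)))
    (hg0 : Tendsto g (𝓝[>] 0) (𝓝 1)) :
    ∃ P : Measure ℝ, IsProbabilityMeasure P ∧ P (Iio 0) = 0 ∧ (∀ w, 0 < w → lap P w = g w) ∧
      ∀ a, 0 ≤ a → P {a} = 0 →
        Tendsto (fun i => (U i).real (Iic a)) l (𝓝 (P.real (Iic a))) := by
  have hprob : ∀ i, IsProbabilityMeasure ((U i).map expNeg) := fun i =>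
    Measure.isProbabilityMeasure_map continuous_expNeg.measurable.aemeasurable
  let Q : ι → ProbabilityMeasure I := fun i => ⟨(U i).map expNeg, hprob i⟩
  -- Under x ↦ e^{-x} the measures live on a compact space, so a limit exists along an ultrafilter.
  -- Its positive real moments are the values of g, and moments determine the limit, which upgrades
  -- the convergence to all of l.
  obtain ⟨Q₀, -, hQ₀⟩ := isCompact_univ.ultrafilter_le_nhds ((Ultrafilter.of l).map Q)
    (by simp)
  have hQ₀ : Tendsto Q (Ultrafilter.of l) (𝓝 Q₀) := hQ₀
  have hcont : ∀ f : C(I, ℝ), Tendsto (fun i => ∫ u, f u ∂((U i).map expNeg))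
      (Ultrafilter.of l) (𝓝 (∫ u, f u ∂(Q₀ : Measure I))) := fun f =>
    ProbabilityMeasure.tendsto_iff_forall_integral_tendsto.1 hQ₀
      (BoundedContinuousFunction.mkOfCompact f)
  have hmom : ∀ w, 0 < w → ∫ u, (u : ℝ) ^ w ∂(Q₀ : Measure I) = g w := by
    intro w hw
    have h1 := hcont ⟨fun u => (u : ℝ) ^ w, continuous_subtype_val.rpow_const
      fun _ => Or.inr hw.le⟩
    simp only [ContinuousMap.coe_mk] at h1
    refine tendsto_nhds_unique h1 (((hg w hw).mono_left (Ultrafilter.of_le l)).congr fun i => ?_)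
    exact (integral_rpow_map_expNeg (hU i) hw.le).symm
  have hlim : Tendsto Q l (𝓝 Q₀) := by
    refine ProbabilityMeasure.tendsto_iff_forall_integral_tendsto.2 fun f => ?_
    refine tendsto_integral_of_tendsto_moments (Q := fun i => (U i).map expNeg)
      (Q₀ := (Q₀ : Measure I)) (fun n => ?_) f.toContinuousMap
    rcases Nat.eq_zero_or_pos n with rfl | hn
    · simp
    · have hn' : (0 : ℝ) < n := by exact_mod_cast hn
      have h1 := hmom n hn'
      have h2 : ∀ i, ∫ u, (u : ℝ) ^ n ∂((U i).map expNeg) = lap (U i) n := fun i => by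
        rw [← integral_rpow_map_expNeg (hU i) hn'.le]; simp
      simp only [Real.rpow_natCast] at h1
      simp only [h2, h1]
      exact hg n hn'
  -- The point 0 of the unit interval stands for x = ∞. As the exponent tends to 0, u^w tends to the
  -- indicator of u ≠ 0, so g(0+) = 1 says that no mass escapes.
  have hzero : (Q₀ : Measure I) {0} = 0 := by
    have h1 : Tendsto (fun n : ℕ => ∫ u, (u : ℝ) ^ (1 / ((n : ℝ) + 1)) ∂(Q₀ : Measure I)) atTop
        (𝓝 (∫ u, ({0}ᶜ : Set I).indicator (fun _ => (1 : ℝ)) u ∂(Q₀ : Measure I))) := by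
      refine tendsto_integral_of_dominated_convergence (fun _ => 1) (fun n => ?_)
        (integrable_const _) (fun n => Eventually.of_forall fun u => ?_)
        (Eventually.of_forall fun u => ?_)
      · exact Continuous.aestronglyMeasurable
          (continuous_subtype_val.rpow_const fun _ => Or.inr (by positivity))
      · rw [Real.norm_of_nonneg (Real.rpow_nonneg u.2.1 _)]
        exact Real.rpow_le_one u.2.1 u.2.2 (by positivity)
      · by_cases hu : u = 0
        · subst hu
          simp only [mem_compl_iff, mem_singleton_iff, not_true, not_false_eq_true,
            indicator_of_notMem]
          refine tendsto_const_nhds.congr fun n => ?_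
          rw [Set.Icc.coe_zero, Real.zero_rpow (by positivity)]
        · rw [indicator_of_mem (by simpa using hu)]
          have hu' : (u : ℝ) ≠ 0 := fun h => hu (Subtype.ext h)
          have h2 : Tendsto (fun n : ℕ => 1 / ((n : ℝ) + 1)) atTop (𝓝 0) :=
            tendsto_one_div_add_atTop_nhds_zero_nat
          have h3 := (Real.continuous_const_rpow hu').tendsto 0
          rw [Real.rpow_zero] at h3
          exact h3.comp h2
    have h2 : Tendsto (fun n : ℕ => ∫ u, (u : ℝ) ^ (1 / ((n : ℝ) + 1)) ∂(Q₀ : Measure I)) atTop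
        (𝓝 1) := by
      have h3 : Tendsto (fun n : ℕ => 1 / ((n : ℝ) + 1)) atTop (𝓝[>] 0) :=
        tendsto_nhdsWithin_iff.2 ⟨tendsto_one_div_add_atTop_nhds_zero_nat,
          Eventually.of_forall fun n => by simp only [mem_Ioi]; positivity⟩
      refine (hg0.comp h3).congr fun n => ?_
      rw [Function.comp_apply, hmom _ (by positivity)]
    have h3 := tendsto_nhds_unique h1 h2
    rw [integral_indicator (measurableSet_singleton _).compl] at h3
    simp only [integral_const, smul_eq_mul, mul_one, measureReal_restrict_apply_univ] at h3
    have h4 := probReal_add_probReal_compl (μ := (Q₀ : Measure I)) (measurableSet_singleton (0 : I))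
    rw [h3] at h4
    exact (measureReal_eq_zero_iff (by finiteness)).1 (by linarith)
  have hae : ∀ᵐ u : I ∂(Q₀ : Measure I), (0 : ℝ) < u := by
    rw [ae_iff]
    refine measure_mono_null (fun u hu => ?_) hzero
    have h1 : ¬ (0 : ℝ) < u := hu
    exact Subtype.ext (le_antisymm (not_lt.1 h1) u.2.1)
  -- Inverse of x ↦ e^{-x}. At u = 0 the logarithm takes the default value 0, which is harmless
  -- because {0} is null for Q₀.
  let L : I → ℝ := fun u => -Real.log u
  have hL : Measurable L := by fun_prop
  refine ⟨(Q₀ : Measure I).map L, Measure.isProbabilityMeasure_map hL.aemeasurable, ?_, ?_, ?_⟩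
  · rw [Measure.map_apply hL measurableSet_Iio]
    have h1 : L ⁻¹' Iio 0 = ∅ := by
      ext u
      simpa [L] using Real.log_nonpos u.2.1 u.2.2
    rw [h1, measure_empty]
  · intro w hw
    rw [lap, integral_map hL.aemeasurable (by fun_prop), ← hmom w hw]
    refine integral_congr_ae (hae.mono fun u hu => ?_)
    simp only [L, mul_neg, neg_neg]
    rw [mul_comm, Real.exp_mul, Real.exp_log hu]
  · intro a ha hPa
    set b : I := expNeg a with hb
    have hbv : (b : ℝ) = Real.exp (-a) := by simp [hb, expNeg, max_eq_left ha]
    have h1 : ∀ i, (U i).real (Iic a) = ((U i).map expNeg).real (Ici b) := by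
      intro i
      rw [measureReal_def, measureReal_def, Measure.map_apply continuous_expNeg.measurable
        measurableSet_Ici]
      congr 2
      ext x
      rw [mem_preimage, mem_Ici, ← Subtype.coe_le_coe, hbv]
      simp [expNeg, ha]
    have hPa' : (Q₀ : Measure I) {b} = 0 := by
      rw [Measure.map_apply hL (measurableSet_singleton a)] at hPa
      refine measure_mono_null (fun u hu => ?_) hPa
      rw [mem_singleton_iff] at hu
      simp [L, hu, hbv]
    have h2 : ((Q₀ : Measure I).map L).real (Iic a) = (Q₀ : Measure I).real (Ici b) := by
      rw [measureReal_def, measureReal_def, Measure.map_apply hL measurableSet_Iic]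
      congr 1
      refine measure_congr ?_
      filter_upwards [hae] with u hu
      refine propext ?_
      change -Real.log u ≤ a ↔ b ≤ u
      rw [← Subtype.coe_le_coe, hbv, ← Real.le_log_iff_exp_le hu]
      constructor <;> intro h <;> linarith
    rw [h2]
    simp only [h1]
    have := ProbabilityMeasure.tendsto_measure_of_null_frontier_of_tendsto' hlim
      (E := Ici b) (measure_mono_null (frontier_Ici_subset b) hPa')
    exact (ENNReal.tendsto_toReal (measure_ne_top _ _)).comp this


/-! ### Karamata's Abelian and Tauberian theorems for the truncated first moment -/

/-- The truncated first moment `∫_{(-∞, y]} x m(dx)`. -/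
noncomputable def firstMom (m : Measure ℝ) (y : ℝ) : ℝ := ∫ x in Iic y, x ∂m

lemma setIntegral_ite_le {x : ℝ} (hx : 0 ≤ x) (k : ℝ → ℝ) :
    ∫ y in Ioi 0, (if x ≤ y then k y else 0) = ∫ y in Ioi x, k y := by
  have h1 : (fun y => if x ≤ y then k y else 0) = (Ici x).indicator k := by
    ext y; simp [indicator_apply]
  rw [h1, setIntegral_indicator measurableSet_Ici]
  refine setIntegral_congr_set ?_
  have h2 : (Ioi 0 ∩ Ici x : Set ℝ) =ᵐ[volume] (Ioi 0 ∩ Ioi x : Set ℝ) :=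
    (ae_eq_refl _).inter Ioi_ae_eq_Ici.symm
  refine h2.trans ?_
  rw [Ioi_inter_Ioi, max_eq_right hx]
  exact ae_eq_refl _

section
variable {m : Measure ℝ} [IsFiniteMeasure m]

/-- Fubini on the region 0 ≤ x ≤ y, playing the role of integration by parts. The majorant b(y) k(y)
does not involve x, so it is integrable for the product because m is finite. -/
lemma integral_mul_setIntegral_Ioi (hm : m (Iio 0) = 0) {a b k : ℝ → ℝ}
    (ha : Measurable a) (hk : Measurable k)
    (hab : ∀ x y, 0 ≤ x → x ≤ y → |a x| ≤ b y)
    (hint : IntegrableOn (fun y => b y * k y) (Ioi 0)) :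
    ∫ x, a x * (∫ y in Ioi x, k y) ∂m = ∫ y in Ioi 0, k y * ∫ x in Iic y, a x ∂m := by
  have h1 : ∫ x, a x * (∫ y in Ioi x, k y) ∂m =
      ∫ x, (∫ y in Ioi 0, (if x ≤ y then a x * k y else 0)) ∂m := by
    refine integral_congr_ae ((ae_nonneg_of_null hm).mono fun x hx => ?_)
    dsimp only
    rw [← setIntegral_ite_le hx, ← integral_const_mul]
    simp only [mul_ite, mul_zero]
  rw [h1, integral_integral_swap]
  · refine integral_congr_ae (Eventually.of_forall fun y => ?_)
    dsimp only
    have h2 : (fun x => if x ≤ y then a x * k y else 0) =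
        (Iic y).indicator (fun x => a x * k y) := by
      ext x; simp [indicator_apply]
    rw [h2, integral_indicator measurableSet_Iic, integral_mul_const, mul_comm]
  · have h3 : Integrable (fun z : ℝ × ℝ => b z.2 * k z.2) (m.prod (volume.restrict (Ioi 0))) :=
      Integrable.comp_snd hint m
    refine Integrable.mono h3 ?_ ?_
    · refine Measurable.aestronglyMeasurable ?_
      refine Measurable.ite (measurableSet_le measurable_fst measurable_snd) ?_ measurable_const
      exact (ha.comp measurable_fst).mul (hk.comp measurable_snd)
    · have h4 : ∀ᵐ z ∂(m.prod (volume.restrict (Ioi (0 : ℝ)))), 0 ≤ z.1 :=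
        Measure.quasiMeasurePreserving_fst.ae (ae_nonneg_of_null hm)
      filter_upwards [h4] with z hz
      simp only [Function.uncurry]
      split_ifs with h
      · rw [norm_mul, norm_mul]
        refine mul_le_mul_of_nonneg_right ?_ (norm_nonneg _)
        have := hab z.1 z.2 hz h
        rw [Real.norm_eq_abs, Real.norm_eq_abs]
        exact this.trans (le_abs_self _)
      · rw [norm_zero]; positivity

omit [IsFiniteMeasure m] in
lemma integral_Ioi_mul_exp_neg {s : ℝ} (hs : 0 < s) (x : ℝ) :
    ∫ y in Ioi x, s * Real.exp (-(s * y)) = Real.exp (-(s * x)) := by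
  have := integral_exp_mul_Ioi (a := -s) (by linarith) x
  rw [integral_const_mul]
  simp only [neg_mul] at this
  rw [this]; field_simp

lemma integrableOn_pow_mul_exp (n : ℕ) {s : ℝ} (hs : 0 < s) :
    IntegrableOn (fun y : ℝ => y ^ n * Real.exp (-(s * y))) (Ioi 0) := by
  have := integrableOn_rpow_mul_exp_neg_mul_rpow (p := 1) (s := n) (b := s)
    (by have : (0 : ℝ) ≤ n := n.cast_nonneg
        linarith) one_pos hs
  simpa using this

/-- The Laplace transform in terms of the distribution function. -/
lemma lap_eq_integral (hm : m (Iio 0) = 0) {s : ℝ} (hs : 0 < s) :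
    lap m s = ∫ y in Ioi 0, s * Real.exp (-(s * y)) * m.real (Iic y) := by
  have := integral_mul_setIntegral_Ioi hm (a := fun _ => 1) (b := fun _ => 1)
    (k := fun y => s * Real.exp (-(s * y))) measurable_const (by fun_prop)
    (fun _ _ _ _ => by simp) (by
      have := (integrableOn_pow_mul_exp 0 hs).const_mul s
      simpa [IntegrableOn] using this)
  simpa [integral_Ioi_mul_exp_neg hs, lap] using this

lemma lapDeriv_eq_integral (hm : m (Iio 0) = 0) {s : ℝ} (hs : 0 < s) :
    lapDeriv m s = ∫ y in Ioi 0, s * Real.exp (-(s * y)) * firstMom m y := by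
  have := integral_mul_setIntegral_Ioi hm (a := fun x => x) (b := fun y => y)
    (k := fun y => s * Real.exp (-(s * y))) measurable_id (by fun_prop)
    (fun x y h1 h2 => by rwa [abs_of_nonneg h1]) (by
      have := (integrableOn_pow_mul_exp 1 hs).const_mul s
      refine this.congr (Eventually.of_forall fun y => ?_)
      dsimp only; ring)
  simpa [integral_Ioi_mul_exp_neg hs, lapDeriv, firstMom] using this

/-- Expresses a truncated exponential moment through the distribution function alone, so that
pointwise convergence of distribution functions passes to it by dominated convergence. -/
lemma integral_Iic_exp (hm : m (Iio 0) = 0) (a : ℝ) :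
    ∫ x in Iic a, Real.exp x ∂m =
      Real.exp a * m.real (Iic a) - ∫ y in Ioc 0 a, Real.exp y * m.real (Iic y) := by
  have h1 := integral_mul_setIntegral_Ioi hm (a := fun _ => 1) (b := fun _ => 1)
    (k := (Iic a).indicator Real.exp) measurable_const
    (Real.measurable_exp.indicator measurableSet_Iic)
    (fun _ _ _ _ => by simp) (by
      simp only [one_mul]
      rw [integrableOn_indicator_iff measurableSet_Iic]
      rw [Iic_inter_Ioi]
      exact (Real.continuous_exp.integrableOn_Icc (a := 0) (b := a)).mono_set Ioc_subset_Icc_self)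
  have h2 : ∀ x, ∫ y in Ioi x, (Iic a).indicator Real.exp y
      = (Iic a).indicator (fun x => Real.exp a - Real.exp x) x := by
    intro x
    rw [setIntegral_indicator measurableSet_Iic, Ioi_inter_Iic]
    by_cases hx : x ≤ a
    · rw [indicator_of_mem (show x ∈ Iic a from hx), ← intervalIntegral.integral_of_le hx]
      simp
    · rw [indicator_of_notMem (show x ∉ Iic a from hx), Ioc_eq_empty (fun h => hx h.le)]
      simp
  have h3 : ∫ y in Ioi 0, (Iic a).indicator Real.exp y * ∫ x in Iic y, 1 ∂m =
      ∫ y in Ioc 0 a, Real.exp y * m.real (Iic y) := by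
    rw [← Ioi_inter_Iic, ← setIntegral_indicator measurableSet_Iic]
    refine integral_congr_ae (Eventually.of_forall fun y => ?_)
    dsimp only
    by_cases hy : y ∈ Iic a
    · rw [indicator_of_mem hy, indicator_of_mem hy]; simp
    · rw [indicator_of_notMem hy, indicator_of_notMem hy]; simp
  rw [h3] at h1
  simp only [one_mul, h2] at h1
  rw [integral_indicator measurableSet_Iic, integral_sub (integrable_const _)] at h1
  · simp only [integral_const, smul_eq_mul, measureReal_restrict_apply_univ] at h1
    linarith
  · refine Integrable.mono' (integrable_const (Real.exp a)) (by fun_prop) ?_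
    refine ae_restrict_of_forall_mem measurableSet_Iic fun x hx => ?_
    rw [Real.norm_of_nonneg (Real.exp_pos _).le]
    exact Real.exp_le_exp.2 hx

lemma integrableOn_id_Iic (hm : m (Iio 0) = 0) (y : ℝ) : IntegrableOn (fun x => x) (Iic y) m := by
  refine Integrable.mono' (integrable_const |y|) (by fun_prop) ?_
  filter_upwards [ae_restrict_mem measurableSet_Iic, ae_restrict_of_ae (ae_nonneg_of_null hm)]
    with x hx h0
  rw [Real.norm_of_nonneg h0]
  exact (show x ≤ y from hx).trans (le_abs_self _)

lemma firstMom_mono (hm : m (Iio 0) = 0) : Monotone (firstMom m) := by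
  intro x y hxy
  refine setIntegral_mono_set (integrableOn_id_Iic hm y) ?_ ?_
  · exact ae_restrict_of_ae (ae_nonneg_of_null hm)
  · exact Eventually.of_forall (Iic_subset_Iic.2 hxy)

omit [IsFiniteMeasure m] in
lemma firstMom_nonneg (hm : m (Iio 0) = 0) (y : ℝ) : 0 ≤ firstMom m y :=
  setIntegral_nonneg_of_ae (ae_nonneg_of_null hm)

/-- The Abelian theorem. -/
theorem regVaryingZero_lapDeriv (hm : m (Iio 0) = 0) {b : ℝ} (hb0 : 0 ≤ b) (hb : b < 2)
    (hH : ∀ c : ℝ, 0 < c →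
      Tendsto (fun x => firstMom m (c * x) / firstMom m x) atTop (𝓝 (c ^ b))) :
    RegVaryingZero (lapDeriv m) (-b) := by
  set H := firstMom m with hHdef
  have hmono := firstMom_mono hm
  -- Division by zero gives 0, so a quotient close to 2^b > 0 forces a nonzero denominator.
  have hpos : ∀ᶠ x in atTop, 0 < H x := by
    have h1 : (0 : ℝ) < 2 ^ b := by positivity
    filter_upwards [(hH 2 two_pos).eventually (lt_mem_nhds h1)] with x hx
    rcases (firstMom_nonneg hm x).lt_or_eq with h | h
    · exact h
    · rw [hHdef, ← h] at hx; simp at hx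
  -- Here b < 2 enters: the doubling constant 4 = 2² leads to a quadratic Potter bound.
  have hdouble : ∀ᶠ x in atTop, H (2 * x) ≤ 4 * H x := by
    have h1 : (2 : ℝ) ^ b < 4 := by
      calc (2 : ℝ) ^ b < 2 ^ (2 : ℝ) := Real.rpow_lt_rpow_of_exponent_lt one_lt_two hb
        _ = 4 := by norm_num
    filter_upwards [(hH 2 two_pos).eventually (gt_mem_nhds h1), hpos] with x hx h0
    rw [div_lt_iff₀ h0] at hx
    exact hx.le
  obtain ⟨x₀, hx₀⟩ := eventually_atTop.1 (hpos.and (hdouble.and (eventually_ge_atTop 1)))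
  have hpow : ∀ n : ℕ, ∀ x, x₀ ≤ x → H (2 ^ n * x) ≤ 4 ^ n * H x := by
    intro n x hx
    induction n with
    | zero => simp
    | succ n ih =>
      have h1 : x₀ ≤ 2 ^ n * x := by
        have := (hx₀ x hx).2.2
        nlinarith [one_le_pow₀ (one_le_two : (1 : ℝ) ≤ 2) (n := n)]
      calc H (2 ^ (n + 1) * x) = H (2 * (2 ^ n * x)) := by ring_nf
        _ ≤ 4 * H (2 ^ n * x) := (hx₀ _ h1).2.1
        _ ≤ 4 * (4 ^ n * H x) := by gcongr
        _ = _ := by ring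
  -- For u ≤ 1 monotonicity suffices. For 2^n ≤ u < 2^(n+1) iterate the doubling bound n + 1 times.
  -- The result is integrable against e^{-u} and serves as the dominating function.
  have hpotter : ∀ x, x₀ ≤ x → ∀ u, 0 < u → H (u * x) / H x ≤ 1 + 4 * u ^ 2 := by
    intro x hx u hu
    have hx1 := (hx₀ x hx).2.2
    have hHx := (hx₀ x hx).1
    rw [div_le_iff₀ hHx]
    rcases le_or_gt u 1 with h | h
    · have : H (u * x) ≤ H x := hmono (by nlinarith)
      nlinarith [mul_nonneg (sq_nonneg u) hHx.le]
    · obtain ⟨n, hn1, hn2⟩ := exists_nat_pow_near h.le one_lt_two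
      have h1 : H (u * x) ≤ H (2 ^ (n + 1) * x) := hmono (by nlinarith)
      have h2 := hpow (n + 1) x hx
      have h3 : (4 : ℝ) ^ (n + 1) ≤ 4 * u ^ 2 := by
        have : (4 : ℝ) ^ (n + 1) = 4 * (2 ^ n) ^ 2 := by
          rw [← pow_mul, mul_comm n 2, pow_mul]; norm_num; ring
        rw [this]; gcongr
      nlinarith [mul_le_mul_of_nonneg_right h3 hHx.le]
  set K := ∫ u in Ioi (0 : ℝ), Real.exp (-u) * u ^ b with hK
  have hKpos : 0 < K := by
    have := Real.Gamma_pos_of_pos (s := b + 1) (by linarith)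
    rw [Real.Gamma_eq_integral (by linarith)] at this
    simpa using this
  have hrep : ∀ x, 0 < x → lapDeriv m (1 / x) / H x
      = ∫ u in Ioi (0 : ℝ), Real.exp (-u) * (H (u * x) / H x) := by
    intro x hx
    rw [lapDeriv_eq_integral hm (by positivity)]
    have h1 := integral_comp_mul_right_Ioi
      (fun y => 1 / x * Real.exp (-(1 / x * y)) * firstMom m y) 0 hx
    rw [zero_mul, smul_eq_mul, eq_inv_mul_iff_mul_eq₀ hx.ne', ← integral_const_mul] at h1
    rw [← h1, ← integral_div]
    refine integral_congr_ae (Eventually.of_forall fun u => ?_)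
    dsimp only
    rw [show 1 / x * (u * x) = u by field_simp]
    field_simp
    rw [hHdef, mul_comm]
  -- The Laplace transform at 1/x is asymptotic to K H(x), where K = Γ(1 + b) > 0; regular variation
  -- then transfers from H.
  have hlim : Tendsto (fun x => lapDeriv m (1 / x) / H x) atTop (𝓝 K) := by
    have h1 : Tendsto (fun x => ∫ u in Ioi (0 : ℝ), Real.exp (-u) * (H (u * x) / H x)) atTop
        (𝓝 K) := by
      refine tendsto_integral_filter_of_dominated_convergence
        (fun u => Real.exp (-u) * (1 + 4 * u ^ 2)) ?_ ?_ ?_ ?_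
      · refine Eventually.of_forall fun x => Measurable.aestronglyMeasurable ?_
        have : Measurable H := hmono.measurable
        fun_prop
      · filter_upwards [eventually_ge_atTop x₀] with x hx
        refine ae_restrict_of_forall_mem measurableSet_Ioi fun u hu => ?_
        rw [Real.norm_of_nonneg (mul_nonneg (Real.exp_pos _).le
          (div_nonneg (firstMom_nonneg hm _) (firstMom_nonneg hm _)))]
        exact mul_le_mul_of_nonneg_left (hpotter x hx u hu) (Real.exp_pos _).le
      · have h0 := integrableOn_pow_mul_exp 0 one_pos
        have h2 := (integrableOn_pow_mul_exp 2 one_pos).const_mul 4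
        refine (h0.add h2).congr (Eventually.of_forall fun u => ?_)
        simp; ring
      · refine ae_restrict_of_forall_mem measurableSet_Ioi fun u hu => ?_
        exact (hH u hu).const_mul _
    refine h1.congr' ?_
    filter_upwards [eventually_gt_atTop 0] with x hx using (hrep x hx).symm
  have hlim0 : Tendsto (fun s => lapDeriv m s / H s⁻¹) (𝓝[>] 0) (𝓝 K) := by
    refine (hlim.comp tendsto_inv_nhdsGT_zero).congr fun s => ?_
    simp
  intro c hc
  have hc0 : Tendsto (fun s : ℝ => c * s) (𝓝[>] 0) (𝓝[>] 0) := by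
    refine tendsto_nhdsWithin_iff.2 ⟨?_, ?_⟩
    · have : Tendsto (fun s : ℝ => c * s) (𝓝 0) (𝓝 (c * 0)) := (continuous_const_mul c).tendsto 0
      rw [mul_zero] at this
      exact this.mono_left nhdsWithin_le_nhds
    · filter_upwards [self_mem_nhdsWithin] with s hs using mul_pos hc hs
  have h1 := hlim0.comp hc0
  have h2 := (hH c⁻¹ (inv_pos.2 hc)).comp tendsto_inv_nhdsGT_zero
  have h3 := (h1.mul h2).div hlim0 hKpos.ne'
  have h4 : K * c⁻¹ ^ b / K = c ^ (-b) := by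
    rw [mul_div_assoc, mul_div_cancel₀ _ hKpos.ne', Real.inv_rpow hc.le, Real.rpow_neg hc.le]
  rw [h4] at h3
  refine h3.congr' ?_
  have hposinv := tendsto_inv_nhdsGT_zero.eventually hpos
  filter_upwards [hposinv, (hc0.eventually hposinv)] with s hs1 hs2
  simp only [Pi.div_apply, Function.comp_apply]
  have hs1 := hs1.ne'
  have hs2 := hs2.ne'
  rw [mul_inv] at hs2 ⊢
  generalize H (c⁻¹ * s⁻¹) = p at *
  generalize H s⁻¹ = q at *
  field_simp

end

/-- All sufficiently large levels carry positive mass below them, and only countably many points are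
atoms. -/
lemma exists_nonatom (P : Measure ℝ) [IsProbabilityMeasure P] :
    ∃ a : ℝ, 0 < a ∧ P {a} = 0 ∧ 0 < P.real (Iic a) := by
  have h1 : Tendsto (fun a : ℝ => P.real (Iic a)) atTop (𝓝 1) := by
    have := tendsto_cdf_atTop P
    exact this.congr fun a => cdf_eq_real P a
  obtain ⟨N, hN⟩ := ((h1.eventually (lt_mem_nhds one_pos)).and
    (eventually_gt_atTop (0 : ℝ))).exists_forall_of_atTop
  have hcount : Set.Countable {a : ℝ | 0 < P {a}} :=
    Measure.countable_meas_level_set_pos (μ := P) (g := fun x : ℝ => x) measurable_id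
  obtain ⟨a, ha1, ha2⟩ := (hcount.dense_compl ℝ).exists_mem_open isOpen_Ioi
    ⟨N + 1, show N < N + 1 by linarith⟩
  refine ⟨a, (hN a (le_of_lt ha2)).2, ?_, (hN a (le_of_lt ha2)).1⟩
  simpa using ha1

/-- The exponentially tilted and rescaled first-moment measure. -/
noncomputable def tilt (m : Measure ℝ) (s : ℝ) : Measure ℝ :=
  (m.withDensity fun x => ENNReal.ofReal (x * Real.exp (-(s * x)) / lapDeriv m s)).map (s * ·)

section
variable {m : Measure ℝ} [IsFiniteMeasure m]

omit [IsFiniteMeasure m] in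
lemma integral_tilt (hm : m (Iio 0) = 0) (s : ℝ) (f : ℝ → ℝ)
    (hf : Measurable f) :
    ∫ x, f x ∂(tilt m s) = (∫ x, x * Real.exp (-(s * x)) * f (s * x) ∂m) / lapDeriv m s := by
  rw [tilt, integral_map (by fun_prop) hf.aestronglyMeasurable,
    integral_withDensity_eq_integral_toReal_smul (by fun_prop) (by simp), ← integral_div]
  refine integral_congr_ae ((ae_nonneg_of_null hm).mono fun x hx => ?_)
  dsimp only
  rw [ENNReal.toReal_ofReal, smul_eq_mul]
  · ring
  · have : 0 ≤ lapDeriv m s := integral_nonneg_of_ae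
      ((ae_nonneg_of_null hm).mono fun x hx => by simp only [Pi.zero_apply]; positivity)
    positivity

lemma isProbabilityMeasure_tilt (hm : m (Iio 0) = 0) (h0 : m (Ioi 0) ≠ 0) {s : ℝ} (hs : 0 < s) :
    IsProbabilityMeasure (tilt m s) := by
  have hpos := lapDeriv_pos hm h0 hs
  have : IsProbabilityMeasure (m.withDensity fun x =>
      ENNReal.ofReal (x * Real.exp (-(s * x)) / lapDeriv m s)) := by
    refine ⟨?_⟩
    rw [withDensity_apply _ MeasurableSet.univ, setLIntegral_univ,
      ← ofReal_integral_eq_lintegral_ofReal ((integrable_mul_exp_neg hm hs).div_const _)]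
    · rw [integral_div]
      change ENNReal.ofReal (lapDeriv m s / lapDeriv m s) = 1
      rw [div_self hpos.ne']; simp
    · filter_upwards [ae_nonneg_of_null hm] with x hx
      simp only [Pi.zero_apply]; positivity
  exact Measure.isProbabilityMeasure_map (by fun_prop)

omit [IsFiniteMeasure m] in
lemma tilt_Iio (hm : m (Iio 0) = 0) {s : ℝ} (hs : 0 < s) : tilt m s (Iio 0) = 0 := by
  rw [tilt, Measure.map_apply (by fun_prop) measurableSet_Iio]
  have : (s * ·) ⁻¹' Iio 0 = Iio (0 : ℝ) := by
    ext x; simp only [mem_preimage, mem_Iio]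
    constructor
    · intro h; by_contra h'; nlinarith [mul_nonneg hs.le (not_lt.1 h')]
    · intro h; nlinarith
  rw [this]
  exact withDensity_absolutelyContinuous _ _ hm

/-- The Tauberian theorem. -/
theorem tendsto_firstMom_div (hm : m (Iio 0) = 0) (h0 : m (Ioi 0) ≠ 0) {b : ℝ}
    (hreg : RegVaryingZero (lapDeriv m) (-b)) {c : ℝ} (hc : 0 < c) :
    Tendsto (fun x => firstMom m (c * x) / firstMom m x) atTop (𝓝 (c ^ b)) := by
  classical
  let U : ℝ → Measure ℝ := fun s => if 0 < s then tilt m s else Measure.dirac 0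
  have hUprob : ∀ s, IsProbabilityMeasure (U s) := by
    intro s
    by_cases hs : 0 < s
    · simp only [U, if_pos hs]; exact isProbabilityMeasure_tilt hm h0 hs
    · simp only [U, if_neg hs]; infer_instance
  have hU0 : ∀ s, U s (Iio 0) = 0 := by
    intro s
    by_cases hs : 0 < s
    · simp only [U, if_pos hs]; exact tilt_Iio hm hs
    · simp only [U, if_neg hs]; simp
  have hUpos : ∀ s, 0 < s → U s = tilt m s := fun s hs => if_pos hs
  -- The tilt makes the first-moment measure a probability, whose transform at w is `lapDeriv m
  -- ((1+w)s) / lapDeriv m s`. By regular variation this tends to (1+w)^(-b), so the continuity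
  -- theorem applies.
  obtain ⟨P, hP, hP0, -, hPlim⟩ := exists_limit_of_tendsto_lap (l := 𝓝[>] (0 : ℝ)) (U := U) hU0
    (g := fun w => (1 + w) ^ (-b)) (fun w hw => by
      have h1 := hreg (1 + w) (by linarith)
      refine h1.congr' ?_
      filter_upwards [self_mem_nhdsWithin] with s hs
      rw [hUpos s hs, lap, integral_tilt hm s _ (by fun_prop)]
      congr 1
      rw [lapDeriv]
      refine integral_congr_ae (Eventually.of_forall fun x => ?_)
      dsimp only
      rw [show -((1 + w) * s * x) = -(s * x) + -(w * (s * x)) by ring, Real.exp_add]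
      ring) (by
      have h2 : ContinuousAt (fun w : ℝ => (1 + w) ^ (-b)) 0 :=
        ContinuousAt.rpow_const (by fun_prop) (Or.inl (by norm_num))
      have h3 := h2.tendsto
      simp only [add_zero, Real.one_rpow] at h3
      exact h3.mono_left nhdsWithin_le_nhds)
  obtain ⟨a, ha, hPa, hPpos⟩ := exists_nonatom P
  have hcount : Set.Countable {a : ℝ | 0 < P {a}} :=
    Measure.countable_meas_level_set_pos (μ := P) (g := fun x : ℝ => x) measurable_id
  set K := ∫ x in Iic a, Real.exp x ∂P with hK
  have hintP : IntegrableOn Real.exp (Iic a) P := by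
    refine Integrable.mono' (integrable_const (Real.exp a)) (by fun_prop) ?_
    refine ae_restrict_of_forall_mem measurableSet_Iic fun x hx => ?_
    rw [Real.norm_of_nonneg (Real.exp_pos _).le]
    exact Real.exp_le_exp.2 hx
  have hKpos : 0 < K := by
    refine hPpos.trans_le ?_
    have h1 : P.real (Iic a) = ∫ x in Iic a, (1 : ℝ) ∂P := by simp
    rw [h1]
    refine integral_mono_ae (integrable_const _) hintP ?_
    filter_upwards [ae_restrict_of_ae (ae_nonneg_of_null hP0)] with x hx
    exact Real.one_le_exp hx
  have hlimU : Tendsto (fun s => ∫ x in Iic a, Real.exp x ∂(U s)) (𝓝[>] 0) (𝓝 K) := by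
    rw [hK, integral_Iic_exp hP0 a]
    simp only [fun s => integral_Iic_exp (hU0 s) a]
    refine ((hPlim a ha.le hPa).const_mul _).sub ?_
    refine tendsto_integral_filter_of_dominated_convergence (fun _ => Real.exp a) ?_ ?_
      (integrable_const _) ?_
    · refine Eventually.of_forall fun s => Measurable.aestronglyMeasurable ?_
      refine Real.measurable_exp.mul (Monotone.measurable fun x y hxy => ?_)
      exact measureReal_mono (Iic_subset_Iic.2 hxy)
    · refine Eventually.of_forall fun s => ?_
      refine ae_restrict_of_forall_mem measurableSet_Ioc fun y hy => ?_
      rw [Real.norm_of_nonneg (by positivity)]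
      calc Real.exp y * (U s).real (Iic y) ≤ Real.exp a * 1 := by
            gcongr
            · exact hy.2
            · exact measureReal_le_one
        _ = _ := mul_one _
    · have h2 : ∀ᵐ y : ℝ, P {y} = 0 := by
        have := hcount.ae_notMem (volume : Measure ℝ)
        filter_upwards [this] with y hy
        simpa using hy
      filter_upwards [ae_restrict_of_ae h2, ae_restrict_mem measurableSet_Ioc] with y hy hy'
      exact (hPlim y hy'.1.le hy).const_mul _
  -- Integrating e^x over [0, a] undoes the tilt. Hence `firstMom m (a/s)` is asymptotic to K times
  -- `lapDeriv m s`. Only 0 < K is needed, not the explicit form of the limit law.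
  have hrep : ∀ s, 0 < s → ∫ x in Iic a, Real.exp x ∂(U s) =
      firstMom m (a / s) / lapDeriv m s := by
    intro s hs
    rw [hUpos s hs, ← integral_indicator measurableSet_Iic,
      integral_tilt hm s _ (Real.measurable_exp.indicator measurableSet_Iic), firstMom,
      ← integral_indicator measurableSet_Iic]
    congr 1
    refine integral_congr_ae (Eventually.of_forall fun x => ?_)
    dsimp only
    by_cases hx : s * x ≤ a
    · rw [indicator_of_mem (show s * x ∈ Iic a from hx), indicator_of_mem
        (show x ∈ Iic (a / s) by rw [mem_Iic, le_div_iff₀ hs]; linarith), mul_assoc,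
        ← Real.exp_add]
      simp
    · rw [indicator_of_notMem (show s * x ∉ Iic a from hx), indicator_of_notMem
        (show x ∉ Iic (a / s) by rw [mem_Iic, le_div_iff₀ hs]; linarith), mul_zero]
  have hmain : Tendsto (fun s => firstMom m (a / s) / lapDeriv m s) (𝓝[>] 0) (𝓝 K) := by
    refine hlimU.congr' ?_
    filter_upwards [self_mem_nhdsWithin] with s hs using hrep s hs
  have hc0 : Tendsto (fun s : ℝ => c⁻¹ * s) (𝓝[>] 0) (𝓝[>] 0) := by
    refine tendsto_nhdsWithin_iff.2 ⟨?_, ?_⟩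
    · have : Tendsto (fun s : ℝ => c⁻¹ * s) (𝓝 0) (𝓝 (c⁻¹ * 0)) :=
        (continuous_const_mul c⁻¹).tendsto 0
      rw [mul_zero] at this
      exact this.mono_left nhdsWithin_le_nhds
    · filter_upwards [self_mem_nhdsWithin] with s hs using mul_pos (inv_pos.2 hc) hs
  have h1 := hmain.comp hc0
  have h2 := hreg c⁻¹ (inv_pos.2 hc)
  have h3 := (h1.mul h2).div hmain hKpos.ne'
  have h4 : K * c⁻¹ ^ (-b) / K = c ^ b := by
    rw [mul_div_assoc, mul_div_cancel₀ _ hKpos.ne', Real.inv_rpow hc.le, Real.rpow_neg hc.le,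
      inv_inv]
  rw [h4] at h3
  have h5 : Tendsto (fun x : ℝ => a / x) atTop (𝓝[>] 0) := by
    refine tendsto_nhdsWithin_iff.2 ⟨tendsto_const_nhds.div_atTop tendsto_id, ?_⟩
    filter_upwards [eventually_gt_atTop 0] with x hx using div_pos ha hx
  refine (h3.comp h5).congr' ?_
  filter_upwards [eventually_gt_atTop 0] with x hx
  simp only [Pi.div_apply, Function.comp_apply]
  have e1 : a / (c⁻¹ * (a / x)) = c * x := by field_simp
  have e2 : a / (a / x) = x := by field_simp
  have p1 := (lapDeriv_pos hm h0 (show 0 < a / x by positivity)).ne'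
  have p2 := (lapDeriv_pos hm h0 (show 0 < c⁻¹ * (a / x) by positivity)).ne'
  rw [e1, e2]
  generalize lapDeriv m (c⁻¹ * (a / x)) = p at *
  field_simp

end

/-! ### The method of characteristics -/

lemma taylor_of_lipschitz_deriv {f f' : ℝ → ℝ} {a C s s' : ℝ} (hC : 0 ≤ C)
    (hd : ∀ u, a ≤ u → HasDerivAt f (f' u) u)
    (hL : ∀ u v, a ≤ u → a ≤ v → |f' u - f' v| ≤ C * |u - v|) (hs : a ≤ s) (hs' : a ≤ s') :
    |f s' - f s - f' s * (s' - s)| ≤ C * (s' - s) ^ 2 := by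
  have := (convex_uIcc s s').norm_image_sub_le_of_norm_hasDerivWithin_le
    (f := fun u => f u - f' s * u) (f' := fun u => f' u - f' s) (C := C * |s' - s|)
    (x := s) (y := s') (fun u hu => by
      have hu' : a ≤ u := (le_min hs hs').trans hu.1
      have h := (hd u hu').sub ((hasDerivAt_id u).const_mul (f' s))
      simp only [mul_one] at h
      exact h.hasDerivWithinAt) (fun u hu => by
      have hu' : a ≤ u := (le_min hs hs').trans hu.1
      refine (hL u s hu' hs).trans ?_
      exact mul_le_mul_of_nonneg_left (abs_sub_left_of_mem_uIcc hu) hC)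
    left_mem_uIcc right_mem_uIcc
  rw [Real.norm_eq_abs, Real.norm_eq_abs, mul_assoc, ← sq, sq_abs] at this
  convert! this using 2
  ring

/-- The method of characteristics for `∂ₜ A = A ∂ₛ A` in integrated form. -/
theorem eq_of_characteristic {A B : ℝ → ℝ → ℝ} {T K : ℝ} (hT : 0 ≤ T) (hK : 0 ≤ K)
    (hd : ∀ t ∈ Icc 0 T, ∀ s, 0 < s → HasDerivAt (A t) (B t s) s)
    (hL : ∀ t ∈ Icc 0 T, ∀ a s s', 0 < a → a ≤ s → a ≤ s' → |B t s - B t s'| ≤ K / a * |s - s'|)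
    (hB : ∀ t ∈ Icc 0 T, ∀ s, 0 < s → |B t s| ≤ K)
    (hI : ∀ s, 0 < s → IntervalIntegrable (fun τ => A τ s * B τ s) volume 0 T)
    (hA : ∀ t ∈ Icc 0 T, ∀ s, 0 < s → A t s = A 0 s + ∫ τ in (0 : ℝ)..t, A τ s * B τ s)
    {s₀ q : ℝ} (hs₀ : 0 < s₀ - T * q) (hq : 0 ≤ q) (hq0 : A 0 s₀ = q) :
    A T (s₀ - T * q) = q := by
  set a := s₀ - T * q with ha
  have hAcont : ∀ s, 0 < s → ContinuousOn (fun t => A t s) (Icc 0 T) := by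
    intro s hs
    have h1 : ContinuousOn (fun t => A 0 s + ∫ τ in (0 : ℝ)..t, A τ s * B τ s) (Icc 0 T) := by
      refine continuousOn_const.add ?_
      have h2 := intervalIntegral.continuousOn_primitive_interval (μ := volume)
        (f := fun τ => A τ s * B τ s) (a := 0) (b := T) (by
          rw [uIcc_of_le hT, integrableOn_Icc_iff_integrableOn_Ioc]
          exact (intervalIntegrable_iff_integrableOn_Ioc_of_le hT).1 (hI s hs))
      rwa [uIcc_of_le hT] at h2
    exact h1.congr fun t ht => hA t ht s hs
  have htaylor : ∀ t ∈ Icc 0 T, ∀ b s s', 0 < b → b ≤ s → b ≤ s' →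
      |A t s' - A t s - B t s * (s' - s)| ≤ K / b * (s' - s) ^ 2 := fun t ht b s s' hb hs hs' =>
    taylor_of_lipschitz_deriv (by positivity) (fun u hu => hd t ht u (hb.trans_le hu))
      (fun u v hu hv => hL t ht b u v hb hu hv) hs hs'
  -- No regularity of B in t is assumed. The difference quotients of A in s are continuous in t and
  -- converge to B uniformly in t, by the Taylor estimate.
  have hBcont : ∀ s, 0 < s → ContinuousOn (fun t => B t s) (Icc 0 T) := by
    intro s hs
    have hu : TendstoUniformlyOn (fun (h : ℝ) t => (A t (s + h) - A t s) / h) (fun t => B t s)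
        (𝓝[>] 0) (Icc 0 T) := by
      rw [Metric.tendstoUniformlyOn_iff]
      intro ε hε
      have h1 : ∀ᶠ h : ℝ in 𝓝[>] 0, K / s * h < ε := by
        have : Tendsto (fun h : ℝ => K / s * h) (𝓝[>] 0) (𝓝 (K / s * 0)) :=
          ((continuous_const_mul (K / s)).tendsto 0).mono_left nhdsWithin_le_nhds
        rw [mul_zero] at this
        exact this.eventually (gt_mem_nhds hε)
      filter_upwards [h1, self_mem_nhdsWithin] with h hh (hpos : 0 < h) t ht
      have h2 := htaylor t ht s s (s + h) hs le_rfl (by linarith)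
      rw [Real.dist_eq, abs_sub_comm]
      have h3 : (A t (s + h) - A t s) / h - B t s
          = (A t (s + h) - A t s - B t s * (s + h - s)) / h := by field_simp; ring
      rw [h3, abs_div, abs_of_pos hpos, div_lt_iff₀ hpos]
      refine h2.trans_lt ?_
      nlinarith
    refine hu.continuousOn (Eventually.frequently ?_)
    filter_upwards [self_mem_nhdsWithin] with h (hpos : 0 < h)
    exact ((hAcont (s + h) (by linarith)).sub (hAcont s hs)).div_const _
  have hAd : ∀ s, 0 < s → ∀ t ∈ Icc 0 T,
      HasDerivWithinAt (fun t => A t s) (A t s * B t s) (Icc 0 T) t := by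
    intro s hs t ht
    -- Clamping to [0, T] extends the integrand to a continuous function on ℝ, so that the
    -- fundamental theorem of calculus applies at the endpoints too.
    set c : ℝ → ℝ := fun τ => max 0 (min τ T) with hc
    have hcmem : ∀ τ, c τ ∈ Icc 0 T := fun τ => ⟨le_max_left _ _, max_le hT (min_le_right _ _)⟩
    have hceq : ∀ τ ∈ Icc 0 T, c τ = τ := fun τ hτ => by
      simp [hc, min_eq_left hτ.2, max_eq_right hτ.1]
    have hGc : Continuous fun τ => A (c τ) s * B (c τ) s :=
      ((hAcont s hs).mul (hBcont s hs)).comp_continuous (by fun_prop) hcmem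
    have h1 : HasDerivAt (fun t => A 0 s + ∫ τ in (0 : ℝ)..t, A (c τ) s * B (c τ) s)
        (A (c t) s * B (c t) s) t :=
      (intervalIntegral.integral_hasDerivAt_right (hGc.intervalIntegrable _ _)
        (hGc.stronglyMeasurableAtFilter _ _) hGc.continuousAt).const_add _
    rw [hceq t ht] at h1
    have h2 : ∀ t ∈ Icc 0 T, A t s = A 0 s + ∫ τ in (0 : ℝ)..t, A (c τ) s * B (c τ) s := by
      intro t ht
      rw [hA t ht s hs]
      congr 1
      refine intervalIntegral.integral_congr fun τ hτ => ?_
      rw [uIcc_of_le ht.1] at hτ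
      rw [hceq τ ⟨hτ.1, hτ.2.trans ht.2⟩]
    exact h1.hasDerivWithinAt.congr h2 (h2 t ht)
  set γ : ℝ → ℝ := fun t => s₀ - t * q with hγ
  have hγa : ∀ t ∈ Icc 0 T, a ≤ γ t := fun t ht => by
    simp only [ha, hγ]; nlinarith [ht.2]
  -- Along γ, with slope -q, the time derivative A B and the transport term -q B add up to (A - q)
  -- B. So A - q solves a linear equation with bounded coefficient and zero initial value;
  -- Gronwall's inequality makes it vanish.
  have hg : ∀ t ∈ Icc 0 T, HasDerivWithinAt (fun t => A t (γ t) - q)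
      ((A t (γ t) - q) * B t (γ t)) (Icc 0 T) t := by
    intro t ht
    have hpos : 0 < γ t := hs₀.trans_le (hγa t ht)
    have h1 := hAd (γ t) hpos t ht
    -- Chain rule without joint differentiability: the Taylor remainder is quadratic uniformly in
    -- t', and B is continuous in t'.
    have h2 : HasDerivWithinAt (fun t' => A t' (γ t') - A t' (γ t)) (-(q * B t (γ t)))
        (Icc 0 T) t := by
      rw [hasDerivWithinAt_iff_tendsto_slope]
      have hB1 : Tendsto (fun t' => -(q * B t' (γ t))) (𝓝[Icc 0 T \ {t}] t)
          (𝓝 (-(q * B t (γ t)))) :=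
        (((hBcont (γ t) hpos t ht).tendsto.mono_left
          (nhdsWithin_mono t sdiff_subset)).const_mul q).neg
      have h0 : Tendsto (fun t' => slope (fun t' => A t' (γ t') - A t' (γ t)) t t' -
          -(q * B t' (γ t))) (𝓝[Icc 0 T \ {t}] t) (𝓝 0) := by
        refine squeeze_zero_norm' (a := fun t' => K / a * q ^ 2 * |t' - t|) ?_ ?_
        · filter_upwards [self_mem_nhdsWithin] with t' ht'
          have hne : t' - t ≠ 0 := sub_ne_zero.2 ht'.2
          have h3 := htaylor t' ht'.1 a (γ t) (γ t') hs₀ (hγa t ht) (hγa t' ht'.1)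
          rw [slope_def_field]
          have h4 : (A t' (γ t') - A t' (γ t) - (A t (γ t) - A t (γ t))) / (t' - t)
              - -(q * B t' (γ t))
              = (A t' (γ t') - A t' (γ t) - B t' (γ t) * (γ t' - γ t)) / (t' - t) := by
            simp only [hγ]; field_simp; ring
          rw [h4, norm_div, Real.norm_eq_abs, Real.norm_eq_abs, div_le_iff₀ (abs_pos.2 hne)]
          refine h3.trans (le_of_eq ?_)
          have h5 : |t' - t| * |t' - t| = (t' - t) ^ 2 := by rw [← sq, sq_abs]
          rw [mul_assoc _ |t' - t|, h5]; simp only [hγ]; ring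
        · have : Tendsto (fun t' => K / a * q ^ 2 * |t' - t|) (𝓝 t)
              (𝓝 (K / a * q ^ 2 * |t - t|)) := by
            have : Continuous fun t' => K / a * q ^ 2 * |t' - t| := by fun_prop
            exact this.tendsto t
          simp only [sub_self, abs_zero, mul_zero] at this
          exact this.mono_left nhdsWithin_le_nhds
      have := h0.add hB1
      simpa using this
    have h3 := (h1.add h2).sub_const q
    convert! h3 using 1
    · ext t'; simp
    · ring
  have hzero := eq_zero_of_abs_deriv_le_mul_abs_self_of_eq_zero_right (a := 0) (b := T)
    (f := fun t => A t (γ t) - q) (f' := fun t => (A t (γ t) - q) * B t (γ t)) (K := K)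
    (fun t ht => (hg t ht).continuousWithinAt)
    (fun t ht => (hg t (Ico_subset_Icc_self ht)).mono_of_mem_nhdsWithin
      (Icc_mem_nhdsGE_of_mem ht)) (by simp [hγ, hq0]) (fun t ht => by
      rw [norm_mul, mul_comm]
      refine mul_le_mul_of_nonneg_right ?_ (norm_nonneg _)
      exact hB t (Ico_subset_Icc_self ht) _ (hs₀.trans_le (hγa t (Ico_subset_Icc_self ht))))
    T ⟨hT, le_rfl⟩
  exact sub_eq_zero.1 hzero

/-! ### The second-moment measure and its Laplace exponent -/

/-- The second-moment measure `x² μ(dx)`. -/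
noncomputable def sm (μ : Measure ℝ) : Measure ℝ :=
  μ.withDensity fun x => ENNReal.ofReal (x ^ 2)

lemma sm_univ (μ : Measure ℝ) : sm μ univ = secondMoment μ := by
  rw [sm, withDensity_apply _ MeasurableSet.univ, setLIntegral_univ, secondMoment]

lemma isFiniteMeasure_sm {μ : Measure ℝ} (h : secondMoment μ < ∞) : IsFiniteMeasure (sm μ) :=
  ⟨by rwa [sm_univ]⟩

lemma sm_Iic {μ : Measure ℝ} (h : μ (Iic 0) = 0) : sm μ (Iic 0) = 0 :=
  withDensity_absolutelyContinuous _ _ h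

lemma sm_Iio {μ : Measure ℝ} (h : μ (Iic 0) = 0) : sm μ (Iio 0) = 0 :=
  measure_mono_null Iio_subset_Iic_self (sm_Iic h)

lemma integral_sm (μ : Measure ℝ) (f : ℝ → ℝ) : ∫ x, f x ∂(sm μ) = ∫ x, x ^ 2 * f x ∂μ := by
  rw [sm, integral_withDensity_eq_integral_toReal_smul (by fun_prop) (by simp)]
  refine integral_congr_ae (Eventually.of_forall fun x => ?_)
  dsimp only
  rw [ENNReal.toReal_ofReal (sq_nonneg x), smul_eq_mul]

lemma integrable_sq {μ : Measure ℝ} (h : secondMoment μ < ∞) : Integrable (fun x => x ^ 2) μ := by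
  refine ⟨by fun_prop, ?_⟩
  rw [hasFiniteIntegral_iff_ofReal (Eventually.of_forall fun x => sq_nonneg x)]
  exact h

lemma ae_pos_of_null {μ : Measure ℝ} (h : μ (Iic 0) = 0) : ∀ᵐ x ∂μ, 0 < x := by
  rw [ae_iff]; simpa [Iic] using h

lemma one_sub_exp_nonneg {s x : ℝ} (hs : 0 ≤ s) (hx : 0 ≤ x) : 0 ≤ 1 - Real.exp (-(s * x)) := by
  have : Real.exp (-(s * x)) ≤ 1 := Real.exp_le_one_iff.2 (by nlinarith)
  linarith

lemma one_sub_exp_le (s x : ℝ) : 1 - Real.exp (-(s * x)) ≤ s * x := by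
  linarith [Real.add_one_le_exp (-(s * x))]

lemma integrable_mul_one_sub_exp {μ : Measure ℝ} (h0 : μ (Iic 0) = 0) (h : secondMoment μ < ∞)
    {s : ℝ} (hs : 0 ≤ s) : Integrable (fun x => x * (1 - Real.exp (-(s * x)))) μ := by
  refine Integrable.mono' ((integrable_sq h).const_mul s) (by fun_prop) ?_
  filter_upwards [ae_pos_of_null h0] with x hx
  have h1 := one_sub_exp_nonneg hs hx.le
  rw [Real.norm_of_nonneg (by positivity)]
  nlinarith [one_sub_exp_le s x]

/-- Fubini with ∫_0^s e^{-ux} du = (1 - e^{-sx})/x, which cancels one of the two factors x. The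
integrand is at most s x², so the first moment may be infinite. -/
lemma bern_sm {μ : Measure ℝ} (h0 : μ (Iic 0) = 0) (h : secondMoment μ < ∞)
    {s : ℝ} (hs : 0 ≤ s) : bern (sm μ) s = ∫ x, x * (1 - Real.exp (-(s * x))) ∂μ := by
  have hfin := isFiniteMeasure_sm h
  have hpos : ∀ᵐ x ∂(sm μ), 0 < x := ae_pos_of_null (sm_Iic h0)
  rw [bern, intervalIntegral.integral_of_le hs]
  simp only [lap]
  rw [integral_integral_swap]
  · rw [integral_sm]
    refine integral_congr_ae ((ae_pos_of_null h0).mono fun x hx => ?_)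
    dsimp only
    rw [← intervalIntegral.integral_of_le hs]
    have h1 : ∫ u in (0 : ℝ)..s, Real.exp (-(u * x)) = (1 - Real.exp (-(s * x))) / x := by
      have h2 := intervalIntegral.integral_eq_sub_of_hasDerivAt (a := 0) (b := s)
        (f := fun u => -Real.exp (-(u * x)) / x) (f' := fun u => Real.exp (-(u * x)))
        (fun u _ => by
          have h := ((((hasDerivAt_id u).mul_const x).neg.exp).neg).div_const x
          convert! h using 1
          simp; field_simp) (Continuous.intervalIntegrable (by fun_prop) _ _)
      rw [h2]; simp; ring
    rw [h1]; field_simp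
  · refine Integrable.mono' (integrable_const (1 : ℝ)) ?_ ?_
    · exact Continuous.aestronglyMeasurable (by simp only [Function.uncurry_def]; fun_prop)
    · have h3 : ∀ᵐ z ∂((volume.restrict (Ioc 0 s)).prod (sm μ)), 0 < z.2 :=
        Measure.quasiMeasurePreserving_snd.ae hpos
      have h4 : ∀ᵐ z ∂((volume.restrict (Ioc 0 s)).prod (sm μ)), z.1 ∈ Ioc 0 s :=
        Measure.quasiMeasurePreserving_fst.ae (ae_restrict_mem measurableSet_Ioc)
      filter_upwards [h3, h4] with z hz hz'
      simp only [Function.uncurry]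
      rw [Real.norm_of_nonneg (Real.exp_pos _).le]
      exact Real.exp_le_one_iff.2 (by nlinarith [hz'.1])


/-! ### Moment bounds and the Burgers equation for a solution -/

/-- The test function `(1 - e^{-hx}) (1 - e^{-sx})`. -/
noncomputable def prodExp (h s x : ℝ) : ℝ :=
  (1 - Real.exp (-(h * x))) * (1 - Real.exp (-(s * x)))

lemma hasDerivAt_exp_neg_mul (k x : ℝ) :
    HasDerivAt (fun x => Real.exp (-(k * x))) (-k * Real.exp (-(k * x))) x := by
  have h := ((hasDerivAt_id x).const_mul k).neg.exp
  convert! h using 1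
  simp; ring

lemma prodExp_eq (h s : ℝ) : prodExp h s = fun x =>
    1 - Real.exp (-(h * x)) - Real.exp (-(s * x)) + Real.exp (-((h + s) * x)) := by
  ext x
  have : Real.exp (-((h + s) * x)) = Real.exp (-(h * x)) * Real.exp (-(s * x)) := by
    rw [← Real.exp_add]; congr 1; ring
  rw [prodExp, this]; ring

lemma deriv_prodExp (h s : ℝ) : deriv (prodExp h s) = fun x =>
    h * Real.exp (-(h * x)) + s * Real.exp (-(s * x)) -
      (h + s) * Real.exp (-((h + s) * x)) := by
  ext x
  rw [prodExp_eq]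
  have := ((((hasDerivAt_const x (1 : ℝ)).sub (hasDerivAt_exp_neg_mul h x)).sub
    (hasDerivAt_exp_neg_mul s x)).add (hasDerivAt_exp_neg_mul (h + s) x)).deriv
  refine this.trans ?_
  ring

lemma deriv_deriv_prodExp (h s : ℝ) : deriv (deriv (prodExp h s)) = fun x =>
    -(h ^ 2 * Real.exp (-(h * x))) - s ^ 2 * Real.exp (-(s * x)) +
      (h + s) ^ 2 * Real.exp (-((h + s) * x)) := by
  ext x
  rw [deriv_prodExp]
  have := ((((hasDerivAt_exp_neg_mul h x).const_mul h).add
    ((hasDerivAt_exp_neg_mul s x).const_mul s)).sub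
    ((hasDerivAt_exp_neg_mul (h + s) x).const_mul (h + s))).deriv
  refine this.trans ?_
  ring

lemma tendsto_exp_neg_mul_atTop {k : ℝ} (hk : 0 < k) :
    Tendsto (fun x => Real.exp (-(k * x))) atTop (𝓝 0) :=
  Real.tendsto_exp_neg_atTop_nhds_zero.comp (tendsto_id.const_mul_atTop hk)

/-- The function x (1 - e^{-sx}) is unbounded and hence not admissible. Its approximations by
`prodExp h s / h` vanish to second order at 0 and are bounded. -/
lemma isTestFunction_prodExp {h s : ℝ} (hh : 0 < h) (hs : 0 < s) :
    IsTestFunction 2 (prodExp h s) := by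
  have hE0 : iteratedDeriv 0 (prodExp h s) = prodExp h s := iteratedDeriv_zero
  have hE1 : iteratedDeriv 1 (prodExp h s) = deriv (prodExp h s) := iteratedDeriv_one
  have hE2 : iteratedDeriv 2 (prodExp h s) = deriv (deriv (prodExp h s)) := by
    rw [iteratedDeriv_succ, iteratedDeriv_one]
  have hc0 : Continuous (prodExp h s) := by rw [prodExp_eq]; fun_prop
  have hc1 : Continuous (deriv (prodExp h s)) := by rw [deriv_prodExp]; fun_prop
  have hc2 : Continuous (deriv (deriv (prodExp h s))) := by rw [deriv_deriv_prodExp]; fun_prop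
  have eh := tendsto_exp_neg_mul_atTop hh
  have es := tendsto_exp_neg_mul_atTop hs
  have ehs := tendsto_exp_neg_mul_atTop (add_pos hh hs)
  have hz : ∀ {f : ℝ → ℝ}, Continuous f → Tendsto f (𝓝[>] 0) (𝓝 (f 0)) := fun hf =>
    (hf.tendsto 0).mono_left nhdsWithin_le_nhds
  refine ⟨?_, ?_, ?_, ?_, ?_⟩
  · rw [prodExp_eq]; exact ContDiff.contDiffOn (by fun_prop)
  · intro j hj
    interval_cases j
    · rw [hE0]; exact ⟨_, hz hc0⟩
    · rw [hE1]; exact ⟨_, hz hc1⟩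
    · rw [hE2]; exact ⟨_, hz hc2⟩
  · intro j hj
    interval_cases j
    · rw [hE0, prodExp_eq]
      exact ⟨_, ((tendsto_const_nhds.sub eh).sub es).add ehs⟩
    · rw [hE1, deriv_prodExp]
      exact ⟨_, ((eh.const_mul h).add (es.const_mul s)).sub (ehs.const_mul (h + s))⟩
    · rw [hE2, deriv_deriv_prodExp]
      exact ⟨_, ((eh.const_mul (h ^ 2)).neg.sub (es.const_mul (s ^ 2))).add
        (ehs.const_mul ((h + s) ^ 2))⟩
  · refine ⟨h + s + (h + s) + (h ^ 2 + s ^ 2 + (h + s) ^ 2), min h s, lt_min hh hs,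
      fun x hx => ?_⟩
    have b1 : Real.exp (-(h * x)) ≤ Real.exp (-min h s * x) :=
      Real.exp_le_exp.2 (by nlinarith [min_le_left h s])
    have b2 : Real.exp (-(s * x)) ≤ Real.exp (-min h s * x) :=
      Real.exp_le_exp.2 (by nlinarith [min_le_right h s])
    have b3 : Real.exp (-((h + s) * x)) ≤ Real.exp (-min h s * x) :=
      Real.exp_le_exp.2 (by nlinarith [min_le_right h s, mul_pos hh hx])
    have p1 := Real.exp_pos (-(h * x))
    have p2 := Real.exp_pos (-(s * x))
    have p3 := Real.exp_pos (-((h + s) * x))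
    have : Finset.Icc 1 2 = {1, 2} := by decide
    rw [this, Finset.sum_pair (by norm_num), hE1, hE2, deriv_deriv_prodExp, deriv_prodExp]
    dsimp only
    set E := Real.exp (-min h s * x)
    have e1 : |h * Real.exp (-(h * x)) + s * Real.exp (-(s * x)) -
      (h + s) * Real.exp (-((h + s) * x))| ≤ (h + s + (h + s)) * E := by
      rw [abs_le]
      constructor <;> nlinarith [mul_le_mul_of_nonneg_left b1 hh.le,
        mul_le_mul_of_nonneg_left b2 hs.le, mul_le_mul_of_nonneg_left b3 (add_pos hh hs).le,
        mul_pos hh p1, mul_pos hs p2, mul_pos (add_pos hh hs) p3]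
    have e2 : |-(h ^ 2 * Real.exp (-(h * x))) - s ^ 2 * Real.exp (-(s * x)) +
      (h + s) ^ 2 * Real.exp (-((h + s) * x))| ≤ (h ^ 2 + s ^ 2 + (h + s) ^ 2) * E := by
      have q1 := mul_le_mul_of_nonneg_left b1 (sq_nonneg h)
      have q2 := mul_le_mul_of_nonneg_left b2 (sq_nonneg s)
      have q3 := mul_le_mul_of_nonneg_left b3 (sq_nonneg (h + s))
      have r1 := mul_nonneg (sq_nonneg h) p1.le
      have r2 := mul_nonneg (sq_nonneg s) p2.le
      have r3 := mul_nonneg (sq_nonneg (h + s)) p3.le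
      rw [abs_le]
      constructor <;> linarith
    linarith
  · intro j hj
    interval_cases j
    · rw [hE0]; have := hz hc0; rwa [show prodExp h s 0 = 0 by simp [prodExp]] at this
    · rw [hE1]; have := hz hc1
      rwa [show deriv (prodExp h s) 0 = 0 by rw [deriv_prodExp]; simp] at this

/-- Since e^{-k(x+y)} - e^{-kx} - e^{-ky} + 1 = (1 - e^{-kx})(1 - e^{-ky}), each of the three
exponentials contributes a product, and its double integral is a square. -/
lemma coagulation_prodExp {μ : Measure ℝ} (h0 : μ (Iic 0) = 0) (hμ : secondMoment μ < ∞)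
    {h s : ℝ} (hh : 0 ≤ h) (hs : 0 ≤ s) :
    coagulation (prodExp h s) μ =
      1 / 2 * (bern (sm μ) (h + s) ^ 2 - bern (sm μ) h ^ 2 - bern (sm μ) s ^ 2) := by
  set a : ℝ → ℝ → ℝ := fun k x => x * (1 - Real.exp (-(k * x))) with ha
  have hint : ∀ k, 0 ≤ k → Integrable (a k) μ := fun k hk => integrable_mul_one_sub_exp h0 hμ hk
  have hval : ∀ k, 0 ≤ k → ∫ x, a k x ∂μ = bern (sm μ) k := fun k hk => (bern_sm h0 hμ hk).symm
  have hpt : ∀ x y, (prodExp h s (x + y) - prodExp h s x - prodExp h s y) * (x * y) =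
      a (h + s) x * a (h + s) y - a h x * a h y - a s x * a s y := by
    intro x y
    have e : ∀ k, Real.exp (-(k * (x + y))) = Real.exp (-(k * x)) * Real.exp (-(k * y)) := by
      intro k; rw [← Real.exp_add]; congr 1; ring
    simp only [prodExp_eq, ha, e]
    ring
  have hhs := add_nonneg hh hs
  have hinner : ∀ x, ∫ y, (prodExp h s (x + y) - prodExp h s x - prodExp h s y) * (x * y) ∂μ =
      a (h + s) x * bern (sm μ) (h + s) - a h x * bern (sm μ) h - a s x * bern (sm μ) s := by
    intro x
    simp only [hpt]
    rw [integral_sub, integral_sub, integral_const_mul, integral_const_mul, integral_const_mul,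
      hval _ hhs, hval _ hh, hval _ hs]
    · exact (hint _ hhs).const_mul _
    · exact (hint _ hh).const_mul _
    · exact ((hint _ hhs).const_mul _).sub ((hint _ hh).const_mul _)
    · exact (hint _ hs).const_mul _
  rw [coagulation]
  simp only [hinner]
  rw [integral_sub, integral_sub, integral_mul_const, integral_mul_const, integral_mul_const,
      hval _ hhs, hval _ hh, hval _ hs]
  · ring
  · exact (hint _ hhs).mul_const _
  · exact (hint _ hh).mul_const _
  · exact ((hint _ hhs).mul_const _).sub ((hint _ hh).mul_const _)
  · exact (hint _ hs).mul_const _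

lemma bern_sub_le {m : Measure ℝ} [IsFiniteMeasure m] (hm : m (Iio 0) = 0) {a b : ℝ} (ha : 0 ≤ a)
    (hab : a ≤ b) : bern m b - bern m a ≤ m.real univ * (b - a) := by
  have hb := ha.trans hab
  rw [bern_sub hm ha hb]
  have := intervalIntegral.integral_mono_on hab (intervalIntegrable_lap hm ha hb)
    (intervalIntegrable_const (c := m.real univ)) (fun x hx => lap_le hm (ha.trans hx.1))
  simp only [intervalIntegral.integral_const, smul_eq_mul] at this
  linarith

lemma tendsto_one_sub_exp_div (x : ℝ) :
    Tendsto (fun h : ℝ => (1 - Real.exp (-(h * x))) / h) (𝓝[>] 0) (𝓝 x) := by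
  have h1 : HasDerivAt (fun h : ℝ => 1 - Real.exp (-(h * x))) x 0 := by
    have h := (((hasDerivAt_id (0 : ℝ)).mul_const x).neg.exp).const_sub 1
    convert! h using 1
    simp
  have h2 := h1.tendsto_slope.mono_left (nhdsWithin_mono 0 (fun y hy => ne_of_gt hy))
  refine h2.congr fun h => ?_
  rw [slope_def_field]; simp

variable {ν : ℝ → Measure ℝ}

/-- Recovers the second moment, possibly infinite, from admissible test functions: Fatou from below,
and (1 - e^{-hx})/h ≤ x from above. -/
lemma tendsto_lintegral_prodExp {μ : Measure ℝ} (h0 : μ (Iic 0) = 0) :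
    Tendsto (fun h : ℝ => ∫⁻ x, ENNReal.ofReal (prodExp h h x / h ^ 2) ∂μ) (𝓝[>] 0)
      (𝓝 (secondMoment μ)) := by
  refine tendsto_of_le_liminf_of_limsup_le ?_ ?_
  · have h1 : secondMoment μ = ∫⁻ x, liminf (fun h : ℝ => ENNReal.ofReal (prodExp h h x / h ^ 2))
        (𝓝[>] 0) ∂μ := by
      refine lintegral_congr fun x => ?_
      refine (Tendsto.liminf_eq ?_).symm
      refine ENNReal.tendsto_ofReal ?_
      refine ((tendsto_one_sub_exp_div x).pow 2).congr fun h => ?_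
      rw [prodExp, div_pow, sq (1 - _)]
    rw [h1]
    refine lintegral_liminf_le' fun h => ?_
    have : Measurable (prodExp h h) := by unfold prodExp; fun_prop
    fun_prop
  · have h1 : ∀ᶠ h : ℝ in 𝓝[>] 0,
        ∫⁻ x, ENNReal.ofReal (prodExp h h x / h ^ 2) ∂μ ≤ secondMoment μ := by
      filter_upwards [self_mem_nhdsWithin] with h (hh : 0 < h)
      refine lintegral_mono_ae ((ae_pos_of_null h0).mono fun x hx => ENNReal.ofReal_le_ofReal ?_)
      have := one_sub_exp_nonneg hh.le hx.le
      rw [div_le_iff₀ (by positivity), prodExp]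
      nlinarith [one_sub_exp_le h x]
    exact (limsup_le_limsup h1).trans (by simp)

lemma IsSolution.lintegral_prodExp (hν : IsSolution 1 ν) {h t : ℝ} (hh : 0 < h)
    (ht : t ∈ Ico (0 : ℝ) 1) : ∫⁻ x, ENNReal.ofReal (prodExp h h x / h ^ 2) ∂(ν t) =
      ENNReal.ofReal ((∫ x, prodExp h h x ∂(ν t)) / h ^ 2) := by
  rw [← integral_div, ofReal_integral_eq_lintegral_ofReal]
  · exact ((hν.weak _ (isTestFunction_prodExp hh hh) t ht).1).div_const _
  · refine Eventually.of_forall fun x => ?_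
    simp only [Pi.zero_apply, prodExp]
    exact div_nonneg (mul_self_nonneg _) (sq_nonneg _)

lemma IsSolution.aemeasurable_secondMoment (hν : IsSolution 1 ν) {t : ℝ} (ht : t ∈ Ico (0 : ℝ) 1) :
    AEMeasurable (fun τ => secondMoment (ν τ)) (volume.restrict (Ioc 0 t)) := by
  -- The second moment is a limit of functions continuous in τ. Measurability is required for every
  -- real index h, so h is replaced by a number that is positive for h ≠ 0 and equals h for h > 0.
  refine aemeasurable_of_tendsto_metrizable_ae (𝓝[>] (0 : ℝ))
    (f := fun (h : ℝ) τ => ENNReal.ofReal ((∫ x, prodExp (max h 1 ⊓ |h|) (max h 1 ⊓ |h|) x ∂(ν τ))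
      / h ^ 2)) ?_ ?_
  · intro h
    by_cases hh : h = 0
    · simp only [hh]; simp
    set k := max h 1 ⊓ |h|
    have hk : 0 < k := lt_min (by positivity) (abs_pos.2 hh)
    have hw := hν.weak _ (isTestFunction_prodExp hk hk)
    have hc : ContinuousOn (fun τ => ∫ x, prodExp k k x ∂(ν 0) +
        ∫ τ in (0 : ℝ)..τ, coagulation (prodExp k k) (ν τ)) (Icc 0 t) := by
      refine continuousOn_const.add ?_
      have h2 := intervalIntegral.continuousOn_primitive_interval (μ := volume)
        (f := fun τ => coagulation (prodExp k k) (ν τ)) (a := 0) (b := t) (by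
          rw [uIcc_of_le ht.1, integrableOn_Icc_iff_integrableOn_Ioc]
          exact (intervalIntegrable_iff_integrableOn_Ioc_of_le ht.1).1 (hw t ht).2.1)
      rwa [uIcc_of_le ht.1] at h2
    have hc' : ContinuousOn (fun τ => ∫ x, prodExp k k x ∂(ν τ)) (Icc 0 t) :=
      hc.congr fun τ hτ => (hw τ ⟨hτ.1, hτ.2.trans_lt ht.2⟩).2.2
    have hm := (hc'.mono Ioc_subset_Icc_self).aemeasurable (μ := volume) measurableSet_Ioc
    exact (hm.div_const _).ennreal_ofReal
  · refine ae_restrict_of_forall_mem measurableSet_Ioc fun τ hτ => ?_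
    have hτ' : τ ∈ Ico (0 : ℝ) 1 := ⟨hτ.1.le, hτ.2.trans_lt ht.2⟩
    refine (tendsto_lintegral_prodExp (hν.radon τ hτ').null_nonpos).congr' ?_
    filter_upwards [self_mem_nhdsWithin] with h (hh : 0 < h)
    rw [hν.lintegral_prodExp hh hτ', abs_of_pos hh, min_eq_right (le_max_left h 1)]

/-- Square integrability in time upgrades to a bound at every time. Test with `prodExp h h / h²` and
let h → 0; as φ(k) ≤ Mk, with M the second moment, the term ½(φ(2h)² - 2φ(h)²)/h² is at most 2M² in
absolute value. -/
lemma IsSolution.secondMoment_le (hν : IsSolution 1 ν) {t : ℝ} (ht : t ∈ Ico (0 : ℝ) 1) :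
    secondMoment (ν t) ≤
      secondMoment (ν 0) + 2 * ∫⁻ τ in Ioc 0 t, secondMoment (ν τ) ^ 2 := by
  rcases ht.1.eq_or_lt with rfl | ht0
  · exact le_self_add
  have h00 : (0 : ℝ) ∈ Ico (0 : ℝ) 1 := ⟨le_rfl, one_pos⟩
  refine le_of_tendsto (tendsto_lintegral_prodExp (hν.radon t ht).null_nonpos) ?_
  filter_upwards [self_mem_nhdsWithin] with h (hh : 0 < h)
  obtain ⟨-, hint, hw⟩ := hν.weak _ (isTestFunction_prodExp hh hh) t ht
  rw [hν.lintegral_prodExp hh ht, hw, add_div]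
  refine ENNReal.ofReal_add_le.trans (add_le_add ?_ ?_)
  · rw [← hν.lintegral_prodExp hh h00]
    refine lintegral_mono_ae ((ae_pos_of_null (hν.radon 0 h00).null_nonpos).mono
      fun x hx => ENNReal.ofReal_le_ofReal ?_)
    have := one_sub_exp_nonneg hh.le hx.le
    rw [div_le_iff₀ (by positivity), prodExp]
    nlinarith [one_sub_exp_le h x]
  · rw [← intervalIntegral.integral_div, intervalIntegral.integral_of_le ht.1]
    calc ENNReal.ofReal (∫ τ in Ioc 0 t, coagulation (prodExp h h) (ν τ) / h ^ 2)
        ≤ ‖∫ τ in Ioc 0 t, coagulation (prodExp h h) (ν τ) / h ^ 2‖ₑ := Real.ofReal_le_enorm _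
      _ ≤ ∫⁻ τ in Ioc 0 t, ‖coagulation (prodExp h h) (ν τ) / h ^ 2‖ₑ :=
        enorm_integral_le_lintegral_enorm _
      _ ≤ ∫⁻ τ in Ioc 0 t, 2 * secondMoment (ν τ) ^ 2 := by
        have hfin : ∀ᵐ τ ∂(volume.restrict (Ioc 0 t)), secondMoment (ν τ) ^ 2 < ∞ :=
          ae_lt_top' ((hν.aemeasurable_secondMoment ht).pow_const 2)
            (hν.moment_sq t ⟨ht0, ht.2⟩).ne
        refine lintegral_mono_ae ?_
        filter_upwards [hfin, ae_restrict_mem measurableSet_Ioc] with τ hτ hτ'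
        have hτ1 : secondMoment (ν τ) < ∞ := by
          by_contra hc
          rw [not_lt, top_le_iff] at hc
          simp [hc] at hτ
        have h0 := (hν.radon τ ⟨hτ'.1.le, hτ'.2.trans_lt ht.2⟩).null_nonpos
        have := isFiniteMeasure_sm hτ1
        rw [coagulation_prodExp h0 hτ1 hh.le hh.le]
        have b1 := bern_le (sm_Iio h0) hh.le
        have b2 := bern_le (sm_Iio h0) (add_pos hh hh).le
        have c1 := bern_nonneg (sm_Iio h0) hh.le
        have c2 := bern_nonneg (sm_Iio h0) (add_pos hh hh).le
        have hM : secondMoment (ν τ) = ENNReal.ofReal ((sm (ν τ)).real univ) := by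
          rw [measureReal_def, sm_univ, ENNReal.ofReal_toReal hτ1.ne]
        set M := (sm (ν τ)).real univ
        have hM0 : 0 ≤ M := measureReal_nonneg
        rw [hM, Real.enorm_eq_ofReal_abs, ← ENNReal.ofReal_pow hM0,
          show (2 : ℝ≥0∞) = ENNReal.ofReal 2 by simp, ← ENNReal.ofReal_mul (by norm_num)]
        refine ENNReal.ofReal_le_ofReal ?_
        rw [abs_div, abs_of_pos (show 0 < h ^ 2 by positivity), div_le_iff₀ (by positivity), abs_le]
        have d1 := pow_le_pow_left₀ c1 b1 2
        have d2 := pow_le_pow_left₀ c2 b2 2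
        constructor <;> nlinarith [sq_nonneg (bern (sm (ν τ)) (h + h)),
          sq_nonneg (bern (sm (ν τ)) h), mul_nonneg (sq_nonneg M) (sq_nonneg h)]
      _ = _ := lintegral_const_mul' _ _ (by simp)

lemma IsSolution.exists_bound (hν : IsSolution 1 ν) {T : ℝ} (hT : T ∈ Ico (0 : ℝ) 1) :
    ∃ K : ℝ, 0 ≤ K ∧ ∀ t ∈ Icc 0 T, secondMoment (ν t) ≤ ENNReal.ofReal K := by
  set C := secondMoment (ν 0) + 2 * ∫⁻ τ in Ioc 0 T, secondMoment (ν τ) ^ 2 with hC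
  have hfin : C < ∞ := by
    refine ENNReal.add_lt_top.2 ⟨hν.initial_moment, ENNReal.mul_lt_top (by simp) ?_⟩
    rcases hT.1.eq_or_lt with rfl | hT0
    · simp
    · exact hν.moment_sq T ⟨hT0, hT.2⟩
  refine ⟨C.toReal, ENNReal.toReal_nonneg, fun t ht => ?_⟩
  rw [ENNReal.ofReal_toReal hfin.ne]
  refine (hν.secondMoment_le ⟨ht.1, ht.2.trans_lt hT.2⟩).trans ?_
  rw [hC]
  gcongr
  exact ht.2

lemma IsSolution.secondMoment_lt_top (hν : IsSolution 1 ν) {t : ℝ} (ht : t ∈ Ico (0 : ℝ) 1) :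
    secondMoment (ν t) < ∞ := by
  obtain ⟨K, -, hK⟩ := hν.exists_bound ht
  exact (hK t ⟨ht.1, le_rfl⟩).trans_lt ENNReal.ofReal_lt_top

/-- The Laplace exponents of a solution satisfy the integrated inviscid Burgers equation. -/
theorem IsSolution.burgers (hν : IsSolution 1 ν) {T s : ℝ} (hT : T ∈ Ico (0 : ℝ) 1) (hs : 0 < s) :
    IntervalIntegrable (fun τ => bern (sm (ν τ)) s * lap (sm (ν τ)) s) volume 0 T ∧
    bern (sm (ν T)) s = bern (sm (ν 0)) s +
      ∫ τ in (0 : ℝ)..T, bern (sm (ν τ)) s * lap (sm (ν τ)) s := by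
  obtain ⟨K, hK0, hK⟩ := hν.exists_bound hT
  have hmem : ∀ t ∈ Icc 0 T, t ∈ Ico (0 : ℝ) 1 := fun t ht => ⟨ht.1, ht.2.trans_lt hT.2⟩
  have hnull : ∀ t ∈ Icc 0 T, ν t (Iic 0) = 0 := fun t ht => (hν.radon t (hmem t ht)).null_nonpos
  have hlt : ∀ t ∈ Icc 0 T, secondMoment (ν t) < ∞ := fun t ht =>
    hν.secondMoment_lt_top (hmem t ht)
  have hmass : ∀ t ∈ Icc 0 T, (sm (ν t)).real univ ≤ K := fun t ht => by
    rw [measureReal_def, sm_univ]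
    exact ENNReal.toReal_le_of_le_ofReal hK0 (hK t ht)
  have hL : ∀ t ∈ Icc 0 T, Tendsto (fun h : ℝ => ∫ x, prodExp h s x / h ∂(ν t)) (𝓝[>] 0)
      (𝓝 (bern (sm (ν t)) s)) := by
    intro t ht
    rw [bern_sm (hnull t ht) (hlt t ht) hs.le]
    refine tendsto_integral_filter_of_dominated_convergence
      (fun x => x * (1 - Real.exp (-(s * x)))) ?_ ?_
      (integrable_mul_one_sub_exp (hnull t ht) (hlt t ht) hs.le) ?_
    · refine Eventually.of_forall fun h => Measurable.aestronglyMeasurable ?_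
      unfold prodExp; fun_prop
    · filter_upwards [self_mem_nhdsWithin] with h (hh : 0 < h)
      filter_upwards [ae_pos_of_null (hnull t ht)] with x hx
      have h1 := one_sub_exp_nonneg hh.le hx.le
      have h2 := one_sub_exp_nonneg hs.le hx.le
      rw [prodExp, Real.norm_of_nonneg (div_nonneg (mul_nonneg h1 h2) hh.le), div_le_iff₀ hh]
      nlinarith [mul_le_mul_of_nonneg_right (one_sub_exp_le h x) h2]
    · refine Eventually.of_forall fun x => ?_
      refine ((tendsto_one_sub_exp_div x).mul_const _).congr fun h => ?_
      rw [prodExp]; ring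
  have h0T : (0 : ℝ) ∈ Icc 0 T := ⟨le_rfl, hT.1⟩
  have hTT : T ∈ Icc 0 T := ⟨hT.1, le_rfl⟩
  set D : ℝ → ℝ → ℝ := fun h τ => coagulation (prodExp h s) (ν τ) / h with hD
  have hDint : ∀ h, 0 < h → IntervalIntegrable (D h) volume 0 T := fun h hh =>
    (hν.weak _ (isTestFunction_prodExp hh hs) T hT).2.1.div_const h
  -- Factoring φ(h+s)² - φ(s)² exhibits one increment of size at most Kh, which absorbs the division
  -- by h; φ(h)² is even of order h².
  have hDbound : ∀ h, 0 < h → h ≤ 1 → ∀ τ ∈ Icc 0 T, ‖D h τ‖ ≤ K ^ 2 * (s + 1) := by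
    intro h hh hh1 τ hτ
    have := isFiniteMeasure_sm (hlt τ hτ)
    have hm := sm_Iio (hnull τ hτ)
    have hmK := hmass τ hτ
    simp only [hD]
    rw [coagulation_prodExp (hnull τ hτ) (hlt τ hτ) hh.le hs.le, norm_div,
      Real.norm_of_nonneg hh.le, div_le_iff₀ hh, Real.norm_eq_abs]
    have hb1 := bern_sub_le hm hs.le (show s ≤ h + s by linarith)
    have hb2 := bern_mono hm (show s ∈ Ici 0 from hs.le) (show h + s ∈ Ici 0 from by
      simp only [mem_Ici]; linarith) (show s ≤ h + s by linarith)
    have hb3 := bern_le hm hh.le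
    have hb4 := bern_nonneg hm hh.le
    have hb5 := bern_le hm hs.le
    have hb6 := bern_nonneg hm hs.le
    set M := (sm (ν τ)).real univ
    set p := bern (sm (ν τ)) (h + s)
    set q := bern (sm (ν τ)) h
    set r := bern (sm (ν τ)) s
    have c1 : p - r ≤ K * h := hb1.trans (by nlinarith)
    have c2 : q ≤ K * h := hb3.trans (by nlinarith)
    have c3 : r ≤ K * s := hb5.trans (by nlinarith)
    have c4 : (p - r) * (p + r) ≤ K * h * (K * h + 2 * (K * s)) :=
      mul_le_mul c1 (by linarith) (by linarith) (by positivity)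
    have c5 : q ^ 2 ≤ (K * h) ^ 2 := pow_le_pow_left₀ hb4 c2 2
    have c6 : 0 ≤ (p - r) * (p + r) := mul_nonneg (by linarith) (by linarith)
    have c7 : (K * h) ^ 2 ≤ K ^ 2 * h := by
      have := mul_nonneg (sq_nonneg K) hh.le
      nlinarith
    have c8 : 0 ≤ K ^ 2 * h * s := by positivity
    have e1 : K * h * (K * h + 2 * (K * s)) = (K * h) ^ 2 + 2 * (K ^ 2 * h * s) := by ring
    have e2 : K ^ 2 * (s + 1) * h = K ^ 2 * h * s + K ^ 2 * h := by ring
    have e3 : p ^ 2 - q ^ 2 - r ^ 2 = (p - r) * (p + r) - q ^ 2 := by ring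
    rw [e3, e2, abs_le]
    constructor <;> nlinarith [sq_nonneg q]
  -- Half the difference quotient of φ² tends to φ φ', while φ(h)²/h tends to 0.
  have hDlim : ∀ τ ∈ Icc 0 T, Tendsto (fun h => D h τ) (𝓝[>] 0)
      (𝓝 (bern (sm (ν τ)) s * lap (sm (ν τ)) s)) := by
    intro τ hτ
    have := isFiniteMeasure_sm (hlt τ hτ)
    have hm := sm_Iio (hnull τ hτ)
    have h1 : Tendsto (fun h => (bern (sm (ν τ)) (s + h) ^ 2 - bern (sm (ν τ)) s ^ 2) / h)
        (𝓝[>] 0) (𝓝 (2 * bern (sm (ν τ)) s * lap (sm (ν τ)) s)) := by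
      have h2 := (hasDerivAt_bern hm hs).pow 2
      have h3 := (hasDerivAt_iff_tendsto_slope_zero.1 h2).mono_left
        (nhdsWithin_mono 0 (fun y (hy : 0 < y) => ne_of_gt hy))
      simp only [Nat.cast_ofNat, Nat.add_one_sub_one, pow_one, Pi.pow_apply] at h3
      refine h3.congr fun h => ?_
      rw [smul_eq_mul]; ring
    have h2 : Tendsto (fun h => bern (sm (ν τ)) h ^ 2 / h) (𝓝[>] 0) (𝓝 0) := by
      refine squeeze_zero' (g := fun h => (sm (ν τ)).real univ ^ 2 * h) ?_ ?_ ?_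
      · filter_upwards [self_mem_nhdsWithin] with h (hh : 0 < h)
        positivity
      · filter_upwards [self_mem_nhdsWithin] with h (hh : 0 < h)
        rw [div_le_iff₀ hh]
        have := pow_le_pow_left₀ (bern_nonneg hm hh.le) (bern_le hm hh.le) 2
        nlinarith
      · have : Tendsto (fun h : ℝ => (sm (ν τ)).real univ ^ 2 * h) (𝓝 0)
            (𝓝 ((sm (ν τ)).real univ ^ 2 * 0)) := (continuous_const_mul _).tendsto 0
        rw [mul_zero] at this
        exact this.mono_left nhdsWithin_le_nhds
    have h3 := (h1.sub h2).const_mul (1 / 2)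
    have e : 1 / 2 * (2 * bern (sm (ν τ)) s * lap (sm (ν τ)) s - 0) =
        bern (sm (ν τ)) s * lap (sm (ν τ)) s := by ring
    rw [e] at h3
    refine h3.congr' ?_
    filter_upwards [self_mem_nhdsWithin] with h (hh : 0 < h)
    simp only [hD]
    rw [coagulation_prodExp (hnull τ hτ) (hlt τ hτ) hh.le hs.le, add_comm s h]
    ring
  have hone : ∀ᶠ h : ℝ in 𝓝[>] 0, 0 < h ∧ h ≤ 1 := by
    filter_upwards [self_mem_nhdsWithin, mem_nhdsWithin_of_mem_nhds (Iic_mem_nhds one_pos)]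
      with h h1 h2 using ⟨h1, h2⟩
  have huI : ∀ τ, τ ∈ uIoc 0 T → τ ∈ Icc 0 T := fun τ hτ => by
    rw [uIoc_of_le hT.1] at hτ; exact Ioc_subset_Icc_self hτ
  have hmeas : ∀ᶠ h : ℝ in 𝓝[>] 0, AEStronglyMeasurable (D h) (volume.restrict (uIoc 0 T)) := by
    filter_upwards [hone] with h hh
    exact (hDint h hh.1).def'.aestronglyMeasurable
  have hR : Tendsto (fun h => ∫ τ in (0 : ℝ)..T, D h τ) (𝓝[>] 0)
      (𝓝 (∫ τ in (0 : ℝ)..T, bern (sm (ν τ)) s * lap (sm (ν τ)) s)) := by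
    refine intervalIntegral.tendsto_integral_filter_of_dominated_convergence
      (fun _ => K ^ 2 * (s + 1)) hmeas ?_ intervalIntegrable_const ?_
    · filter_upwards [hone] with h hh
      exact Eventually.of_forall fun τ hτ => hDbound h hh.1 hh.2 τ (huI τ hτ)
    · exact Eventually.of_forall fun τ hτ => hDlim τ (huI τ hτ)
  refine ⟨?_, ?_⟩
  · rw [intervalIntegrable_iff]
    refine Integrable.mono' (g := fun _ => K ^ 2 * (s + 1))
      (intervalIntegrable_const (a := 0) (b := T)).def' ?_ ?_
    -- Measurability of the limit along a sequence; it is shifted by N since the approximants are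
    -- known to be measurable only for small h.
    · obtain ⟨u, hu⟩ := exists_seq_tendsto (𝓝[>] (0 : ℝ))
      obtain ⟨N, hN⟩ := eventually_atTop.1 (hu.eventually hmeas)
      refine aestronglyMeasurable_of_tendsto_ae atTop (f := fun n => D (u (n + N)))
        (fun n => hN _ (Nat.le_add_left _ _)) ?_
      exact ae_restrict_of_forall_mem measurableSet_uIoc fun τ hτ =>
        (hDlim τ (huI τ hτ)).comp (hu.comp (tendsto_add_atTop_nat N))
    · refine ae_restrict_of_forall_mem measurableSet_uIoc fun τ hτ => ?_
      refine le_of_tendsto (hDlim τ (huI τ hτ)).norm ?_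
      filter_upwards [hone] with h hh using hDbound h hh.1 hh.2 τ (huI τ hτ)
  · refine tendsto_nhds_unique (hL T hTT) (((hL 0 h0T).add hR).congr' ?_)
    filter_upwards [self_mem_nhdsWithin] with h (hh : 0 < h)
    rw [integral_div, integral_div, (hν.weak _ (isTestFunction_prodExp hh hs) T hT).2.2,
      add_div, intervalIntegral.integral_div]

/-- The solution formula along characteristics. -/
theorem IsSolution.bern_characteristic (hν : IsSolution 1 ν) (hnorm : secondMoment (ν 0) = 1)
    {t s : ℝ} (ht : t ∈ Ico (0 : ℝ) 1) (hs : 0 < s) :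
    0 < s - t * bern (sm (ν 0)) s ∧
      bern (sm (ν t)) (s - t * bern (sm (ν 0)) s) = bern (sm (ν 0)) s := by
  obtain ⟨K, hK0, hK⟩ := hν.exists_bound ht
  have hmem : ∀ τ ∈ Icc 0 t, τ ∈ Ico (0 : ℝ) 1 := fun τ hτ => ⟨hτ.1, hτ.2.trans_lt ht.2⟩
  have hnull : ∀ τ ∈ Icc 0 t, sm (ν τ) (Iio 0) = 0 := fun τ hτ =>
    sm_Iio (hν.radon τ (hmem τ hτ)).null_nonpos
  have hfin : ∀ τ ∈ Icc 0 t, IsFiniteMeasure (sm (ν τ)) := fun τ hτ =>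
    isFiniteMeasure_sm (hν.secondMoment_lt_top (hmem τ hτ))
  have hmass : ∀ τ ∈ Icc 0 t, (sm (ν τ)).real univ ≤ K := fun τ hτ => by
    rw [measureReal_def, sm_univ]
    exact ENNReal.toReal_le_of_le_ofReal hK0 (hK τ hτ)
  have h0t : (0 : ℝ) ∈ Icc 0 t := ⟨le_rfl, ht.1⟩
  have := hfin 0 h0t
  have hq0 := bern_nonneg (hnull 0 h0t) hs.le
  -- The normalization of the second moment keeps the characteristic from s positive for all t < 1;
  -- this is where the gelation time 1 enters.
  have hq1 : bern (sm (ν 0)) s ≤ s := by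
    have := bern_le (hnull 0 h0t) hs.le
    rwa [measureReal_def, sm_univ, hnorm, ENNReal.toReal_one, one_mul] at this
  have hpos : 0 < s - t * bern (sm (ν 0)) s := by nlinarith [ht.1, ht.2]
  refine ⟨hpos, eq_of_characteristic (A := fun t s => bern (sm (ν t)) s)
    (B := fun t s => lap (sm (ν t)) s) ht.1 hK0 ?_ ?_ ?_ ?_ ?_ hpos hq0 rfl⟩
  · intro τ hτ u hu
    have := hfin τ hτ
    exact hasDerivAt_bern (hnull τ hτ) hu
  · intro τ hτ a u v ha hu hv
    have := hfin τ hτ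
    refine (abs_lap_sub_le (hnull τ hτ) ha hu hv).trans ?_
    have := hmass τ hτ
    gcongr
  · intro τ hτ u hu
    have := hfin τ hτ
    rw [abs_of_nonneg (lap_nonneg _)]
    exact (lap_le (hnull τ hτ) hu.le).trans (hmass τ hτ)
  · intro u hu
    exact (hν.burgers ht hu).1
  · intro τ hτ u hu
    exact (hν.burgers (hmem τ hτ) hu).2

/-- The derivative of the solution formula. -/
theorem IsSolution.lap_characteristic (hν : IsSolution 1 ν) (hnorm : secondMoment (ν 0) = 1)
    {t s : ℝ} (ht : t ∈ Ico (0 : ℝ) 1) (hs : 0 < s) :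
    lap (sm (ν t)) (s - t * bern (sm (ν 0)) s) * (1 - t * lap (sm (ν 0)) s) =
      lap (sm (ν 0)) s := by
  have h00 : (0 : ℝ) ∈ Ico (0 : ℝ) 1 := ⟨le_rfl, one_pos⟩
  have f0 := isFiniteMeasure_sm (hν.secondMoment_lt_top h00)
  have ft := isFiniteMeasure_sm (hν.secondMoment_lt_top ht)
  have n0 := sm_Iio (hν.radon 0 h00).null_nonpos
  have nt := sm_Iio (hν.radon t ht).null_nonpos
  have hd1 := hasDerivAt_bern n0 hs
  have hd2 := (hasDerivAt_bern nt (hν.bern_characteristic hnorm ht hs).1).comp s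
    ((hasDerivAt_id s).sub (hd1.const_mul t))
  refine hd2.unique (hd1.congr_of_eventuallyEq ?_)
  filter_upwards [Ioi_mem_nhds hs] with u hu
  exact (hν.bern_characteristic hnorm ht hu).2

/-- Let s → 0 in `lap_characteristic`: both transforms tend to the total masses, which leaves M (1 -
t) = 1. -/
theorem IsSolution.sm_real_univ (hν : IsSolution 1 ν) (hnorm : secondMoment (ν 0) = 1)
    {t : ℝ} (ht : t ∈ Ico (0 : ℝ) 1) : (sm (ν t)).real univ = (1 - t)⁻¹ := by
  have h00 : (0 : ℝ) ∈ Ico (0 : ℝ) 1 := ⟨le_rfl, one_pos⟩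
  have f0 := isFiniteMeasure_sm (hν.secondMoment_lt_top h00)
  have ft := isFiniteMeasure_sm (hν.secondMoment_lt_top ht)
  have n0 := sm_Iio (hν.radon 0 h00).null_nonpos
  have nt := sm_Iio (hν.radon t ht).null_nonpos
  have hmass : (sm (ν 0)).real univ = 1 := by
    rw [measureReal_def, sm_univ, hnorm, ENNReal.toReal_one]
  have l0 : Tendsto (lap (sm (ν 0))) (𝓝[>] 0) (𝓝 1) := by
    have := (continuousOn_lap n0 0 self_mem_Ici).tendsto.mono_left
      (nhdsWithin_mono 0 Ioi_subset_Ici_self)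
    rwa [lap_zero, hmass] at this
  have hz : Tendsto (fun s => s - t * bern (sm (ν 0)) s) (𝓝[>] 0) (𝓝[≥] 0) := by
    refine tendsto_nhdsWithin_iff.2 ⟨?_, ?_⟩
    · have h1 := (continuousOn_bern n0 0 self_mem_Ici).tendsto.mono_left
        (nhdsWithin_mono 0 Ioi_subset_Ici_self)
      have h2 : Tendsto (fun s : ℝ => s) (𝓝[>] 0) (𝓝 0) := nhdsWithin_le_nhds
      simpa using h2.sub (h1.const_mul t)
    · filter_upwards [self_mem_nhdsWithin] with s hs
      exact (hν.bern_characteristic hnorm ht hs).1.le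
  have lt : Tendsto (fun s => lap (sm (ν t)) (s - t * bern (sm (ν 0)) s)) (𝓝[>] 0)
      (𝓝 ((sm (ν t)).real univ)) := by
    have := (continuousOn_lap nt 0 self_mem_Ici).tendsto.comp hz
    rwa [lap_zero] at this
  have h1 := lt.mul ((l0.const_mul t).const_sub 1)
  have h2 : (sm (ν t)).real univ * (1 - t * 1) = 1 := by
    refine tendsto_nhds_unique h1 (l0.congr' ?_)
    filter_upwards [self_mem_nhdsWithin] with s hs
    exact (hν.lap_characteristic hnorm ht hs).symm
  rw [mul_one] at h2
  exact eq_inv_of_mul_eq_one_left h2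


/-! ### Deviation of the Laplace exponent from the identity; rigidity of scaling limits -/

lemma tendsto_const_mul_nhdsGT_zero {c : ℝ} (hc : 0 < c) :
    Tendsto (fun s : ℝ => c * s) (𝓝[>] 0) (𝓝[>] 0) := by
  refine tendsto_nhdsWithin_iff.2 ⟨?_, ?_⟩
  · have : Tendsto (fun s : ℝ => c * s) (𝓝 0) (𝓝 (c * 0)) := (continuous_const_mul c).tendsto 0
    rw [mul_zero] at this
    exact this.mono_left nhdsWithin_le_nhds
  · filter_upwards [self_mem_nhdsWithin] with s hs using mul_pos hc hs

/-- The relative deviation `(s - φ(s)) / φ(s)` of the Laplace exponent `φ` from the identity. -/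
noncomputable def ratio (m : Measure ℝ) (s : ℝ) : ℝ := (s - bern m s) / bern m s

section
variable {m : Measure ℝ} [IsProbabilityMeasure m]

lemma lap_lt_one (hm : m (Iio 0) = 0) (h0 : m (Ioi 0) ≠ 0) {s : ℝ} (hs : 0 < s) : lap m s < 1 := by
  have := lap_strictAnti hm h0 self_mem_Ici (mem_Ici.2 hs.le) hs
  rwa [lap_zero, probReal_univ] at this

lemma tendsto_lap_zero (hm : m (Iio 0) = 0) : Tendsto (lap m) (𝓝[>] 0) (𝓝 1) := by
  have := (continuousOn_lap hm 0 self_mem_Ici).tendsto.mono_left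
    (nhdsWithin_mono 0 Ioi_subset_Ici_self)
  rwa [lap_zero, probReal_univ] at this

lemma tendsto_bern_zero (hm : m (Iio 0) = 0) : Tendsto (bern m) (𝓝[>] 0) (𝓝 0) := by
  have := (continuousOn_bern hm 0 self_mem_Ici).tendsto.mono_left
    (nhdsWithin_mono 0 Ioi_subset_Ici_self)
  rwa [bern_zero] at this

lemma bern_le_self (hm : m (Iio 0) = 0) {s : ℝ} (hs : 0 ≤ s) : bern m s ≤ s := by
  simpa using bern_le hm hs

lemma tendsto_bern_div (hm : m (Iio 0) = 0) : Tendsto (fun s => bern m s / s) (𝓝[>] 0) (𝓝 1) := by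
  refine tendsto_of_tendsto_of_tendsto_of_le_of_le' (tendsto_lap_zero hm) tendsto_const_nhds ?_ ?_
  · filter_upwards [self_mem_nhdsWithin] with s (hs : 0 < s)
    rw [le_div_iff₀ hs, mul_comm]; exact mul_lap_le_bern hm hs.le
  · filter_upwards [self_mem_nhdsWithin] with s (hs : 0 < s)
    rw [div_le_one hs]; exact bern_le_self hm hs.le

lemma strictMonoOn_sub_bern (hm : m (Iio 0) = 0) (h0 : m (Ioi 0) ≠ 0) :
    StrictMonoOn (fun s => s - bern m s) (Ici 0) := by
  refine strictMonoOn_of_deriv_pos (convex_Ici 0)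
    (continuousOn_id.sub (continuousOn_bern hm)) fun s hs => ?_
  rw [interior_Ici] at hs
  have : HasDerivAt (fun s => s - bern m s) (1 - lap m s) s :=
    (hasDerivAt_id s).sub (hasDerivAt_bern hm hs)
  rw [this.deriv]
  linarith [lap_lt_one hm h0 hs]

lemma sub_bern_pos (hm : m (Iio 0) = 0) (h0 : m (Ioi 0) ≠ 0) {s : ℝ} (hs : 0 < s) :
    0 < s - bern m s := by
  simpa using strictMonoOn_sub_bern hm h0 self_mem_Ici (mem_Ici.2 hs.le) hs

/-- Strict form of the concavity inequality, obtained by splitting the integral at s/2. The sign it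
gives to the derivative of `ratio` makes `ratio` strictly increasing. -/
lemma mul_lap_lt_bern (hm : m (Iio 0) = 0) (h0 : m (Ioi 0) ≠ 0) {s : ℝ} (hs : 0 < s) :
    s * lap m s < bern m s := by
  have h1 := mul_lap_le_bern hm (half_pos hs).le
  have h2 := bern_sub hm (half_pos hs).le hs.le
  have h3 := intervalIntegral.integral_mono_on (half_le_self hs.le)
    (intervalIntegrable_const (c := lap m s)) (intervalIntegrable_lap hm (half_pos hs).le hs.le)
    (fun x hx => lap_anti hm ((half_pos hs).le.trans hx.1) hs.le hx.2)
  simp only [intervalIntegral.integral_const, smul_eq_mul] at h3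
  have h4 := lap_strictAnti hm h0 (half_pos hs).le hs.le (half_lt_self hs)
  nlinarith

lemma ne_zero_of_isProbabilityMeasure : m ≠ 0 := IsProbabilityMeasure.ne_zero m

lemma bern_pos' (hm : m (Iio 0) = 0) {s : ℝ} (hs : 0 < s) : 0 < bern m s :=
  bern_pos hm ne_zero_of_isProbabilityMeasure hs

lemma ratio_pos (hm : m (Iio 0) = 0) (h0 : m (Ioi 0) ≠ 0) {s : ℝ} (hs : 0 < s) : 0 < ratio m s :=
  div_pos (sub_bern_pos hm h0 hs) (bern_pos' hm hs)

lemma ratio_hasDerivAt (hm : m (Iio 0) = 0) {s : ℝ} (hs : 0 < s) :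
    HasDerivAt (ratio m) ((bern m s - s * lap m s) / bern m s ^ 2) s := by
  have h1 := hasDerivAt_bern hm hs
  have h2 := ((hasDerivAt_id s).sub h1).div h1 (bern_pos' hm hs).ne'
  convert! h2 using 1
  simp; ring

lemma ratio_continuousOn (hm : m (Iio 0) = 0) : ContinuousOn (ratio m) (Ioi 0) := fun _ hs =>
  (ratio_hasDerivAt hm hs).continuousAt.continuousWithinAt

lemma ratio_strictMono (hm : m (Iio 0) = 0) (h0 : m (Ioi 0) ≠ 0) :
    StrictMonoOn (ratio m) (Ioi 0) := by
  refine strictMonoOn_of_deriv_pos (convex_Ioi 0) (ratio_continuousOn hm) fun s hs => ?_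
  rw [interior_Ioi] at hs
  rw [(ratio_hasDerivAt hm hs).deriv]
  have := mul_lap_lt_bern hm h0 hs
  have := bern_pos' hm hs
  exact div_pos (by linarith) (by positivity)

lemma tendsto_ratio_zero (hm : m (Iio 0) = 0) : Tendsto (ratio m) (𝓝[>] 0) (𝓝 0) := by
  have h1 := ((tendsto_bern_div hm).inv₀ one_ne_zero).sub_const 1
  rw [inv_one, sub_self] at h1
  refine h1.congr' ?_
  filter_upwards [self_mem_nhdsWithin] with s (hs : 0 < s)
  have := bern_pos' hm hs
  rw [ratio]; field_simp

/-- Two applications of the monotone density theorem: s - φ has increasing derivative 1 - `lap`,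
whose own derivative `lapDeriv` is decreasing. The second one needs ρ ≠ 0. -/
lemma RegVaryingZero.firstMom_of_sub_bern (hm : m (Iio 0) = 0) (h0 : m (Ioi 0) ≠ 0) {ρ : ℝ}
    (hρ : 0 < ρ) (h : RegVaryingZero (fun s => s - bern m s) (1 + ρ)) :
    RegVaryingZero (lapDeriv m) (ρ - 1) := by
  have h1 : RegVaryingZero (fun s => 1 - lap m s) (1 + ρ - 1) :=
    h.deriv (by linarith) (fun s hs => sub_bern_pos hm h0 hs)
      (fun s hs => (hasDerivAt_id s).sub (hasDerivAt_bern hm hs))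
      (Or.inl fun s hs t ht hst => by
        have := lap_anti hm (Ioi_subset_Ici_self hs) (Ioi_subset_Ici_self ht) hst
        dsimp only; linarith)
  rw [add_sub_cancel_left] at h1
  refine h1.deriv hρ.ne' (fun s hs => by linarith [lap_lt_one hm h0 hs]) (fun s hs => ?_)
    (Or.inr (lapDeriv_anti hm))
  simpa using (hasDerivAt_lap hm hs).const_sub 1

lemma RegVaryingZero.sub_bern_of_lapDeriv (hm : m (Iio 0) = 0) (h0 : m (Ioi 0) ≠ 0) {ρ : ℝ}
    (h : RegVaryingZero (lapDeriv m) (ρ - 1)) :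
    RegVaryingZero (fun s => s - bern m s) (1 + ρ) := by
  have h1 : RegVaryingZero (fun s => 1 - lap m s) (ρ - 1 + 1) := by
    refine h.primitive (fun s hs => lapDeriv_pos hm h0 hs) (fun s hs => ?_) ?_
    · simpa using (hasDerivAt_lap hm hs).const_sub 1
    · simpa using (tendsto_lap_zero hm).const_sub 1
  rw [sub_add_cancel] at h1
  rw [add_comm]
  refine h1.primitive (fun s hs => by linarith [lap_lt_one hm h0 hs])
    (fun s hs => (hasDerivAt_id s).sub (hasDerivAt_bern hm hs)) ?_
  have h2 : Tendsto (fun s : ℝ => s) (𝓝[>] 0) (𝓝 0) := nhdsWithin_le_nhds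
  simpa using h2.sub (tendsto_bern_zero hm)

end

/-- A monotone function whose ratios have positive limits at `0+` is regularly varying. -/
theorem exists_regVaryingZero {R : ℝ → ℝ} (hpos : ∀ s, 0 < s → 0 < R s)
    (hmono : MonotoneOn R (Ioi 0))
    (hlim : ∀ c, 0 < c → ∃ g, 0 < g ∧ Tendsto (fun s => R (c * s) / R s) (𝓝[>] 0) (𝓝 g)) :
    ∃ ρ, RegVaryingZero R ρ := by
  have hlim' : ∀ c : ℝ, ∃ g, 0 < c → 0 < g ∧
      Tendsto (fun s => R (c * s) / R s) (𝓝[>] 0) (𝓝 g) := by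
    intro c
    by_cases hc : 0 < c
    · obtain ⟨g, hg⟩ := hlim c hc; exact ⟨g, fun _ => hg⟩
    · exact ⟨0, fun h => absurd h hc⟩
  choose G hG using hlim'
  have hmul : ∀ c d, 0 < c → 0 < d → G (c * d) = G c * G d := by
    intro c d hc hd
    refine tendsto_nhds_unique (hG _ (mul_pos hc hd)).2 ?_
    have h1 := ((hG c hc).2.comp (tendsto_const_mul_nhdsGT_zero hd)).mul (hG d hd).2
    refine h1.congr' ?_
    filter_upwards [self_mem_nhdsWithin] with s (hs : 0 < s)
    have := (hpos _ (mul_pos hd hs)).ne'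
    simp only [Function.comp_apply, mul_assoc]
    rw [div_mul_div_cancel₀ this]
  have hGmono : ∀ c d, 0 < c → c ≤ d → G c ≤ G d := by
    intro c d hc hcd
    refine le_of_tendsto_of_tendsto (hG c hc).2 (hG d (hc.trans_le hcd)).2 ?_
    filter_upwards [self_mem_nhdsWithin] with s (hs : 0 < s)
    have h1 := hmono (show c * s ∈ Ioi 0 from mul_pos hc hs)
      (show d * s ∈ Ioi 0 from mul_pos (hc.trans_le hcd) hs) (by nlinarith)
    have := hpos s hs
    gcongr
  -- The limits are multiplicative in c, hence additive in logarithmic coordinates. Monotonicity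
  -- gives measurability, and a measurable additive function is linear.
  let f : ℝ →+ ℝ :=
    { toFun := fun x => Real.log (G (Real.exp x))
      map_zero' := by
        have h1 := hmul 1 1 one_pos one_pos
        have h2 := (hG 1 one_pos).1
        rw [mul_one] at h1
        have h3 : G 1 = 1 := by
          have := mul_right_cancel₀ h2.ne' (show 1 * G 1 = G 1 * G 1 by linarith)
          exact this.symm
        simp [h3]
      map_add' := fun x y => by
        rw [Real.exp_add, hmul _ _ (Real.exp_pos _) (Real.exp_pos _),
          Real.log_mul (hG _ (Real.exp_pos _)).1.ne' (hG _ (Real.exp_pos _)).1.ne'] }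
  have hfmono : Monotone f := fun x y hxy =>
    Real.log_le_log (hG _ (Real.exp_pos _)).1
      (hGmono _ _ (Real.exp_pos _) (Real.exp_le_exp.2 hxy))
  have hfcont : Continuous f := MeasureTheory.Measure.AddMonoidHom.continuous_of_measurable f hfmono.measurable
  have hlin : ∀ x, f x = x * f 1 := fun x => by
    have := map_real_smul f hfcont x 1
    simpa using this
  refine ⟨f 1, fun c hc => ?_⟩
  have h1 := hlin (Real.log c)
  have h2 : f (Real.log c) = Real.log (G c) := by
    change Real.log (G (Real.exp (Real.log c))) = _
    rw [Real.exp_log hc]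
  have h3 : G c = c ^ f 1 := by
    rw [Real.rpow_def_of_pos hc, ← h1, h2, Real.exp_log (hG c hc).1]
  rw [← h3]
  exact (hG c hc).2

/-- The rigidity argument: limits along a family of points `S t w` that is asymptotically
parametrized by `1 - t` force regular variation. -/
theorem exists_tendsto_ratio {R φ M : ℝ → ℝ} {S : ℝ → ℝ → ℝ} (hR : StrictMonoOn R (Ioi 0))
    (hR0 : Tendsto R (𝓝[>] 0) (𝓝 0)) (hRpos : ∀ s, 0 < s → 0 < R s)
    (hφ : StrictMonoOn φ (Ici 0)) (hφc : ContinuousOn φ (Ici 0)) (hφ0 : φ 0 = 0)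
    (hM : StrictMonoOn M (Ioi 0)) (hMc : ContinuousOn M (Ioi 0)) (hMpos : ∀ w, 0 < w → 0 < M w)
    (hS : ∀ w, 0 < w → ∀ᶠ t in 𝓝[<] 1, 0 < S t w)
    (hRS : ∀ w, 0 < w → Tendsto (fun t => R (S t w) / (1 - t)) (𝓝[<] 1) (𝓝 (M w)))
    (hSS : ∀ w w', 0 < w → 0 < w' →
      Tendsto (fun t => S t w / S t w') (𝓝[<] 1) (𝓝 (φ w / φ w')))
    {c : ℝ} (hc : 0 < c) (hc1 : c < 1) :
    ∃ g, 0 < g ∧ g < 1 ∧ Tendsto (fun s => R (c * s) / R s) (𝓝[>] 0) (𝓝 g) := by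
  have hφpos : ∀ w, 0 < w → 0 < φ w := fun w hw => by
    rw [← hφ0]; exact hφ self_mem_Ici (mem_Ici.2 hw.le) hw
  -- Since S(t,w)/S(t,1) is close to φ(w)/φ(1), the point with φ(w₁) = c φ(1) corresponds to c s
  -- when w = 1 corresponds to s.
  obtain ⟨w₁, hw₁, hw₁'⟩ := intermediate_value_Icc (zero_le_one' ℝ)
    (hφc.mono Icc_subset_Ici_self) (show c * φ 1 ∈ Icc (φ 0) (φ 1) by
      rw [hφ0]; constructor <;> nlinarith [hφpos 1 one_pos])
  have hw₁0 : 0 < w₁ := by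
    rcases hw₁.1.lt_or_eq with h | h
    · exact h
    · rw [← h, hφ0] at hw₁'; nlinarith [hφpos 1 one_pos]
  have hw₁1 : w₁ < 1 := by
    rcases hw₁.2.lt_or_eq with h | h
    · exact h
    · rw [h] at hw₁'; nlinarith [hφpos 1 one_pos]
  have hM1 := hMpos 1 one_pos
  -- The time matched to s, chosen so that R(s) = M(1)(1 - t); thus s behaves like S(t,1).
  have ht : Tendsto (fun s => 1 - R s / M 1) (𝓝[>] 0) (𝓝[<] 1) := by
    refine tendsto_nhdsWithin_iff.2 ⟨?_, ?_⟩
    · simpa using (hR0.div_const (M 1)).const_sub 1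
    · filter_upwards [self_mem_nhdsWithin] with s hs
      have := div_pos (hRpos s hs) hM1
      simp only [mem_Iio]; linarith
  have hMat : ∀ w, 0 < w → ContinuousAt M w := fun w hw => hMc.continuousAt (Ioi_mem_nhds hw)
  have hφat : ∀ w, 0 < w → ContinuousAt φ w := fun w hw => hφc.continuousAt (Ici_mem_nhds hw)
  refine ⟨M w₁ / M 1, div_pos (hMpos _ hw₁0) hM1, ?_, ?_⟩
  · rw [div_lt_one hM1]; exact hM hw₁0 (mem_Ioi.2 one_pos) hw₁1
  refine tendsto_order.2 ⟨fun a ha => ?_, fun a ha => ?_⟩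
  · have e1 : ∀ᶠ w in 𝓝[<] w₁, a < M w / M 1 :=
      (((hMat _ hw₁0).div_const _).tendsto.mono_left nhdsWithin_le_nhds).eventually
        (lt_mem_nhds ha)
    obtain ⟨w, ⟨hwa, hw0⟩, hww⟩ := ((e1.and (mem_nhdsWithin_of_mem_nhds
      (Ioi_mem_nhds hw₁0))).and self_mem_nhdsWithin).exists
    have hw0 : 0 < w := hw0
    have hlt : φ w / φ 1 < c := by
      rw [div_lt_iff₀ (hφpos 1 one_pos), ← hw₁']; exact hφ hw0.le hw₁0.le hww
    -- With w < w₁ and v < 1 there is room for strict inequalities: S(t,v) < s because R(S(t,v)) <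
    -- R(s), and S(t,w) < c S(t,v) < c s, whence R(cs) > R(S(t,w)) > a R(s). The upper bound is
    -- symmetric.
    have e2 : ∀ᶠ v in 𝓝[<] (1 : ℝ), φ w / φ v < c :=
      ((continuousAt_const.div (hφat 1 one_pos) (hφpos 1 one_pos).ne').tendsto.mono_left
        nhdsWithin_le_nhds).eventually (gt_mem_nhds hlt)
    obtain ⟨v, ⟨hvc, hv0⟩, hv1⟩ := ((e2.and (mem_nhdsWithin_of_mem_nhds
      (Ioi_mem_nhds one_pos))).and self_mem_nhdsWithin).exists
    have hv0 : 0 < v := hv0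
    have hMv : M v < M 1 := hM hv0 (mem_Ioi.2 one_pos) hv1
    have f1 := (hSS w v hw0 hv0).eventually (gt_mem_nhds hvc)
    have f2 := (hRS v hv0).eventually (gt_mem_nhds hMv)
    have f3 := (hRS w hw0).eventually (lt_mem_nhds ((lt_div_iff₀ hM1).1 hwa))
    filter_upwards [ht.eventually (f1.and (f2.and (f3.and ((hS w hw0).and (hS v hv0))))),
      self_mem_nhdsWithin] with s hs (hs0 : 0 < s)
    obtain ⟨g1, g2, g3, g4, g5⟩ := hs
    have hRs := hRpos s hs0
    rw [sub_sub_cancel] at g2 g3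
    have hq : 0 < R s / M 1 := div_pos hRs hM1
    set t := 1 - R s / M 1
    rw [div_lt_iff₀ hq, mul_div_cancel₀ _ hM1.ne'] at g2
    rw [lt_div_iff₀ hq] at g3
    rw [div_lt_iff₀ g5] at g1
    have hSv : S t v < s := (hR.lt_iff_lt g5 hs0).1 g2
    have hSw : S t w < c * s := by nlinarith
    have hR2 : R (S t w) < R (c * s) := hR g4 (mul_pos hc hs0) hSw
    rw [lt_div_iff₀ hRs]
    refine lt_trans ?_ hR2
    convert g3 using 1
    field_simp
  · have e1 : ∀ᶠ w in 𝓝[>] w₁, M w / M 1 < a :=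
      (((hMat _ hw₁0).div_const _).tendsto.mono_left nhdsWithin_le_nhds).eventually
        (gt_mem_nhds ha)
    obtain ⟨w, hwa, hww⟩ := (e1.and self_mem_nhdsWithin).exists
    have hww : w₁ < w := hww
    have hw0 : 0 < w := hw₁0.trans hww
    have hlt : c < φ w / φ 1 := by
      rw [lt_div_iff₀ (hφpos 1 one_pos), ← hw₁']; exact hφ hw₁0.le hw0.le hww
    have e2 : ∀ᶠ v in 𝓝[>] (1 : ℝ), c < φ w / φ v :=
      ((continuousAt_const.div (hφat 1 one_pos) (hφpos 1 one_pos).ne').tendsto.mono_left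
        nhdsWithin_le_nhds).eventually (lt_mem_nhds hlt)
    obtain ⟨v, hvc, hv1⟩ := (e2.and self_mem_nhdsWithin).exists
    have hv1 : 1 < v := hv1
    have hv0 : 0 < v := one_pos.trans hv1
    have hMv : M 1 < M v := hM (mem_Ioi.2 one_pos) hv0 hv1
    have f1 := (hSS w v hw0 hv0).eventually (lt_mem_nhds hvc)
    have f2 := (hRS v hv0).eventually (lt_mem_nhds hMv)
    have f3 := (hRS w hw0).eventually (gt_mem_nhds ((div_lt_iff₀ hM1).1 hwa))
    filter_upwards [ht.eventually (f1.and (f2.and (f3.and ((hS w hw0).and (hS v hv0))))),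
      self_mem_nhdsWithin] with s hs (hs0 : 0 < s)
    obtain ⟨g1, g2, g3, g4, g5⟩ := hs
    have hRs := hRpos s hs0
    rw [sub_sub_cancel] at g2 g3
    have hq : 0 < R s / M 1 := div_pos hRs hM1
    set t := 1 - R s / M 1
    rw [lt_div_iff₀ hq, mul_div_cancel₀ _ hM1.ne'] at g2
    rw [div_lt_iff₀ hq] at g3
    rw [lt_div_iff₀ g5] at g1
    have hSv : s < S t v := (hR.lt_iff_lt hs0 g5).1 g2
    have hSw : c * s < S t w := by nlinarith
    have hR2 : R (c * s) < R (S t w) := hR (mul_pos hc hs0) g4 hSw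
    rw [div_lt_iff₀ hRs]
    refine hR2.trans ?_
    convert g3 using 1
    field_simp

lemma firstMom_sm {μ : Measure ℝ} (h0 : μ (Iic 0) = 0) (x : ℝ) :
    firstMom (sm μ) x = ∫ y in Ioc 0 x, y ^ 3 ∂μ := by
  rw [firstMom, ← integral_indicator measurableSet_Iic, integral_sm,
    ← integral_indicator measurableSet_Ioc]
  refine integral_congr_ae ((ae_pos_of_null h0).mono fun y hy => ?_)
  dsimp only
  by_cases h : y ≤ x
  · rw [indicator_of_mem (mem_Iic.2 h), indicator_of_mem (mem_Ioc.2 ⟨hy, h⟩)]; ring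
  · rw [indicator_of_notMem (show y ∉ Iic x from h),
      indicator_of_notMem (fun h' => h h'.2), mul_zero]

lemma exists_slowlyVarying {f : ℝ → ℝ} {b : ℝ} (hpos : ∀ᶠ x in atTop, 0 < f x)
    (hf : ∀ c : ℝ, 0 < c → Tendsto (fun x => f (c * x) / f x) atTop (𝓝 (c ^ b))) :
    ∃ L : ℝ → ℝ, IsSlowlyVarying L ∧ f ~[atTop] fun x => x ^ b * L x := by
  classical
  -- The value 1 only secures positivity where f is not positive, which does not happen near
  -- infinity.
  let L : ℝ → ℝ := fun x => if 0 < f x then f x * x ^ (-b) else 1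
  refine ⟨L, ⟨fun x hx => ?_, fun c hc => ?_⟩, ?_⟩
  · simp only [L]; split_ifs <;> positivity
  · have h1 := (hf c hc).mul_const (c ^ (-b))
    rw [← Real.rpow_add hc, add_neg_cancel, Real.rpow_zero] at h1
    refine h1.congr' ?_
    filter_upwards [hpos, (tendsto_id.const_mul_atTop hc).eventually hpos,
      eventually_gt_atTop 0] with x h1 h2 hx
    simp only [L, if_pos h1]
    rw [id_eq] at h2
    rw [if_pos h2, Real.mul_rpow hc.le hx.le]
    field_simp
  · refine Asymptotics.IsEquivalent.congr_left Asymptotics.IsEquivalent.refl ?_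
    filter_upwards [hpos, eventually_gt_atTop 0] with x h1 hx
    simp only [L, if_pos h1]
    rw [mul_left_comm, ← Real.rpow_add hx, add_neg_cancel, Real.rpow_zero, mul_one]

lemma tendsto_div_of_isEquivalent {f L : ℝ → ℝ} {b : ℝ} (hL : IsSlowlyVarying L)
    (hf : f ~[atTop] fun x => x ^ b * L x) {c : ℝ} (hc : 0 < c) :
    Tendsto (fun x => f (c * x) / f x) atTop (𝓝 (c ^ b)) := by
  obtain ⟨u, hu, hfu⟩ := hf.exists_eq_mul
  have hcx : Tendsto (fun x : ℝ => c * x) atTop atTop := tendsto_id.const_mul_atTop hc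
  have h1 := ((hu.comp hcx).div hu one_ne_zero).mul ((hL.2 c hc).const_mul (c ^ b))
  rw [div_one, one_mul, mul_one] at h1
  refine h1.congr' ?_
  filter_upwards [hfu, hcx.eventually hfu, eventually_gt_atTop 0] with x e1 e2 hx
  rw [e1, e2]
  simp only [Pi.mul_apply, Pi.div_apply, Function.comp_apply]
  rw [Real.mul_rpow hc.le hx.le]
  have := (hL.1 x hx).ne'
  have := (Real.rpow_pos_of_pos hx b).ne'
  by_cases hux : u x = 0
  · simp [hux]
  field_simp


/-! ### Necessity of regular variation -/

lemma secondMomentDistribution_eq {μ : Measure ℝ} (h0 : μ (Iic 0) = 0) (x : ℝ) :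
    secondMomentDistribution μ x = (sm μ).real (Iic x) / (sm μ).real univ := by
  have h1 : (sm μ).real (Iic x) = ∫ y in Ioc 0 x, y ^ 2 ∂μ := by
    rw [← integral_indicator_one measurableSet_Iic, integral_sm,
      ← integral_indicator measurableSet_Ioc]
    refine integral_congr_ae ((ae_pos_of_null h0).mono fun y hy => ?_)
    dsimp only
    by_cases h : y ≤ x
    · rw [indicator_of_mem (mem_Iic.2 h), indicator_of_mem (mem_Ioc.2 ⟨hy, h⟩), Pi.one_apply,
        mul_one]
    · rw [indicator_of_notMem (show y ∉ Iic x from h),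
        indicator_of_notMem (fun h' => h h'.2), mul_zero]
  have h2 : (sm μ).real univ = ∫ y, y ^ 2 ∂μ := by
    rw [← lap_zero, lap, integral_sm]; simp
  rw [secondMomentDistribution, h1, h2]

section
variable {ν : ℝ → Measure ℝ}

lemma map_mul_Iio {m : Measure ℝ} (hm : m (Iio 0) = 0) {c : ℝ} (hc : 0 < c) :
    m.map (c * ·) (Iio 0) = 0 := by
  rw [Measure.map_apply (by fun_prop) measurableSet_Iio]
  have : (c * ·) ⁻¹' Iio 0 = Iio (0 : ℝ) := by
    ext x; simp [hc]
  rw [this, hm]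

lemma map_mul_real_Iic {m : Measure ℝ} {c : ℝ} (hc : 0 < c) (y : ℝ) :
    (m.map (c⁻¹ * ·)).real (Iic y) = m.real (Iic (c * y)) := by
  rw [measureReal_def, measureReal_def, Measure.map_apply (by fun_prop) measurableSet_Iic]
  congr 2
  ext x
  simp only [mem_preimage, mem_Iic]
  rw [inv_mul_le_iff₀ hc]

lemma IsSolution.eventually_mem (t : ℝ) (ht : t < 1) : ∀ᶠ u in 𝓝[<] (1 : ℝ), u ∈ Ioo t 1 :=
  Ioo_mem_nhdsLT ht

lemma IsSolution.distribution_eq (hν : IsSolution 1 ν) (hnorm : secondMoment (ν 0) = 1)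
    {t : ℝ} (ht : t ∈ Ico (0 : ℝ) 1) {c : ℝ} (hc : 0 < c) (y : ℝ) :
    (1 - t) * ((sm (ν t)).map (c⁻¹ * ·)).real (Iic y) = secondMomentDistribution (ν t) (c * y) := by
  rw [secondMomentDistribution_eq (hν.radon t ht).null_nonpos, hν.sm_real_univ hnorm ht,
    map_mul_real_Iic hc, div_inv_eq_mul, mul_comm]

lemma secondMomentDistribution_mem_Icc {μ : Measure ℝ} (h0 : μ (Iic 0) = 0)
    (hμ : secondMoment μ < ∞) (x : ℝ) : secondMomentDistribution μ x ∈ Icc (0 : ℝ) 1 := by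
  have := isFiniteMeasure_sm hμ
  rw [secondMomentDistribution_eq h0]
  exact ⟨by positivity, div_le_one_of_le₀ (measureReal_mono (subset_univ _)) (by positivity)⟩

/-- Every point at time t is reached by a characteristic: since φ(s) ≤ s, the foot point z/(1-t)
already overshoots z. -/
lemma exists_sub_mul_bern_eq {m : Measure ℝ} [IsProbabilityMeasure m] (hm : m (Iio 0) = 0)
    {t z : ℝ} (ht : t ∈ Ico (0 : ℝ) 1) (hz : 0 < z) : ∃ s, 0 < s ∧ s - t * bern m s = z := by
  have hc : ContinuousOn (fun s => s - t * bern m s) (Icc 0 (z / (1 - t))) :=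
    (continuousOn_id.sub ((continuousOn_bern hm).const_mul t)).mono Icc_subset_Ici_self
  have h1t : 0 < 1 - t := by linarith [ht.2]
  have hzt : 0 ≤ z / (1 - t) := by positivity
  obtain ⟨s, hs, hs'⟩ := intermediate_value_Icc hzt hc (show z ∈ _ by
    constructor
    · simpa using hz.le
    · have h1 := bern_le_self hm hzt
      have h2 : z / (1 - t) * (1 - t) = z := div_mul_cancel₀ _ h1t.ne'
      nlinarith [mul_le_mul_of_nonneg_left h1 ht.1])
  refine ⟨s, lt_of_le_of_ne hs.1 fun h => ?_, hs'⟩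
  rw [← h] at hs'
  simp at hs'
  linarith

/-- Convergence of the rescaled second-moment distribution functions implies convergence of
the rescaled Laplace transforms. -/
theorem IsSolution.tendsto_lap_of_tendsto_distribution (hν : IsSolution 1 ν)
    (hnorm : secondMoment (ν 0) = 1) {lam : ℝ → ℝ} {P : Measure ℝ} [IsProbabilityMeasure P]
    (hlam : Tendsto lam (𝓝[<] 1) atTop) (hP : P (Iio 0) = 0)
    (hlim : ∀ x : ℝ, 0 ≤ x → ContinuousAt (cdf P) x →
      Tendsto (fun t => secondMomentDistribution (ν t) (lam t * x)) (𝓝[<] 1) (𝓝 (cdf P x)))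
    {w : ℝ} (hw : 0 < w) :
    Tendsto (fun t => (1 - t) * lap ((sm (ν t)).map ((lam t)⁻¹ * ·)) w) (𝓝[<] 1)
      (𝓝 (lap P w)) := by
  have hev : ∀ᶠ t in 𝓝[<] (1 : ℝ), t ∈ Ico (0 : ℝ) 1 ∧ 0 < lam t := by
    filter_upwards [IsSolution.eventually_mem 0 one_pos, hlam.eventually_gt_atTop 0] with t h1 h2
    exact ⟨Ioo_subset_Ico_self h1, h2⟩
  rw [lap_eq_integral hP hw]
  -- Dominated convergence for the Laplace transform written with the distribution function;
  -- discontinuities of the limit are countable, hence null.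
  have h1 : Tendsto (fun t => ∫ y in Ioi 0, w * Real.exp (-(w * y)) *
      secondMomentDistribution (ν t) (lam t * y)) (𝓝[<] 1)
      (𝓝 (∫ y in Ioi 0, w * Real.exp (-(w * y)) * P.real (Iic y))) := by
    refine tendsto_integral_filter_of_dominated_convergence
      (fun y => w * Real.exp (-(w * y))) ?_ ?_ ?_ ?_
    · filter_upwards [hev] with t ⟨ht, hl⟩
      have := isFiniteMeasure_sm (hν.secondMoment_lt_top ht)
      refine Measurable.aestronglyMeasurable (Measurable.mul (by fun_prop) ?_)
      simp only [← hν.distribution_eq hnorm ht hl]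
      refine Measurable.const_mul (Monotone.measurable fun x y hxy => ?_) _
      exact measureReal_mono (Iic_subset_Iic.2 hxy)
    · filter_upwards [hev] with t ⟨ht, hl⟩
      refine Eventually.of_forall fun y => ?_
      have h2 := secondMomentDistribution_mem_Icc (hν.radon t ht).null_nonpos
        (hν.secondMoment_lt_top ht) (lam t * y)
      rw [norm_mul, Real.norm_of_nonneg (by positivity), Real.norm_of_nonneg h2.1]
      exact mul_le_of_le_one_right (by positivity) h2.2
    · have := (integrableOn_pow_mul_exp 0 hw).const_mul w
      simpa [IntegrableOn] using this
    · have h2 : ∀ᵐ y : ℝ, ContinuousAt (cdf P) y := by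
        filter_upwards [(cdf P).mono.countable_not_continuousAt.ae_notMem volume] with y hy
        simpa using hy
      filter_upwards [ae_restrict_of_ae h2, ae_restrict_mem measurableSet_Ioi] with y hy hy'
      rw [← cdf_eq_real]
      exact (hlim y (le_of_lt hy') hy).const_mul _
  refine h1.congr' ?_
  filter_upwards [hev] with t ⟨ht, hl⟩
  have := isFiniteMeasure_sm (hν.secondMoment_lt_top ht)
  rw [lap_eq_integral (map_mul_Iio (sm_Iio (hν.radon t ht).null_nonpos) (inv_pos.2 hl)) hw,
    ← integral_const_mul]
  refine integral_congr_ae (Eventually.of_forall fun y => ?_)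
  dsimp only
  rw [← hν.distribution_eq hnorm ht hl]
  ring

/-- Characteristics translate convergence of the rescaled laws into asymptotics of the initial
exponent along foot points S(t,w). Rigidity then forces its deviation from the identity to vary
regularly. -/
theorem IsSolution.regularVariation_of_tendsto (hν : IsSolution 1 ν)
    (hnorm : secondMoment (ν 0) = 1) {lam : ℝ → ℝ} {P : Measure ℝ} [IsProbabilityMeasure P]
    (hlam : Tendsto lam (𝓝[<] 1) atTop) (hP : P (Iio 0) = 0)
    (hnontriv : ∃ x : ℝ, 0 < x ∧ cdf P x < 1)
    (hlim : ∀ x : ℝ, 0 ≤ x → ContinuousAt (cdf P) x →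
      Tendsto (fun t => secondMomentDistribution (ν t) (lam t * x)) (𝓝[<] 1) (𝓝 (cdf P x))) :
    ∃ ρ ∈ Ioc (0 : ℝ) 1, ∃ L : ℝ → ℝ, IsSlowlyVarying L ∧
      (fun x : ℝ => ∫ y in Ioc 0 x, y ^ 3 ∂(ν 0)) ~[atTop] (fun x : ℝ => x ^ (1 - ρ) * L x) := by
  have h00 : (0 : ℝ) ∈ Ico (0 : ℝ) 1 := ⟨le_rfl, one_pos⟩
  have hrad0 := (hν.radon 0 h00).null_nonpos
  have hprob : IsProbabilityMeasure (sm (ν 0)) := ⟨by rw [sm_univ, hnorm]⟩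
  have hm := sm_Iio hrad0
  have hm0 : sm (ν 0) (Ioi 0) ≠ 0 := by
    intro h
    have h1 : sm (ν 0) univ = 0 := by
      rw [← Iic_union_Ioi (a := (0 : ℝ))]
      exact measure_union_null (sm_Iic hrad0) h
    rw [measure_univ] at h1
    exact one_ne_zero h1
  -- Nontriviality excludes the Dirac mass at 0, for which `ratio P` would vanish identically.
  have hP0 : P (Ioi 0) ≠ 0 := by
    obtain ⟨x, hx, hx1⟩ := hnontriv
    intro h
    have h1 : P (Iic x)ᶜ = 0 := measure_mono_null (fun y hy => hx.trans (by simpa using hy)) h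
    rw [cdf_eq_real, measureReal_def, (prob_compl_eq_zero_iff measurableSet_Iic).1 h1] at hx1
    simp at hx1
  set m := sm (ν 0) with hmdef
  have hev : ∀ᶠ t in 𝓝[<] (1 : ℝ), t ∈ Ico (0 : ℝ) 1 ∧ 0 < lam t := by
    filter_upwards [IsSolution.eventually_mem 0 one_pos, hlam.eventually_gt_atTop 0] with t h1 h2
    exact ⟨Ioo_subset_Ico_self h1, h2⟩
  have hbern : ∀ w, 0 < w → Tendsto
      (fun t => (1 - t) * (lam t * bern (sm (ν t)) ((lam t)⁻¹ * w))) (𝓝[<] 1) (𝓝 (bern P w)) := by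
    intro w hw
    have h1 : Tendsto (fun t => ∫ u in (0 : ℝ)..w,
        (1 - t) * lap ((sm (ν t)).map ((lam t)⁻¹ * ·)) u) (𝓝[<] 1) (𝓝 (bern P w)) := by
      refine intervalIntegral.tendsto_integral_filter_of_dominated_convergence (fun _ => 1)
        ?_ ?_ intervalIntegrable_const ?_
      · filter_upwards [hev] with t ⟨ht, hl⟩
        have := isFiniteMeasure_sm (hν.secondMoment_lt_top ht)
        exact ((intervalIntegrable_lap (map_mul_Iio (sm_Iio (hν.radon t ht).null_nonpos)
          (inv_pos.2 hl)) le_rfl hw.le).const_mul _).def'.aestronglyMeasurable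
      · filter_upwards [hev] with t ⟨ht, hl⟩
        have := isFiniteMeasure_sm (hν.secondMoment_lt_top ht)
        refine Eventually.of_forall fun u hu => ?_
        rw [uIoc_of_le hw.le] at hu
        have h1t : 0 < 1 - t := by linarith [ht.2]
        rw [lap_map_mul, Real.norm_of_nonneg (mul_nonneg h1t.le (lap_nonneg _))]
        have h2 := lap_le (sm_Iio (hν.radon t ht).null_nonpos)
          (show 0 ≤ (lam t)⁻¹ * u from mul_nonneg (inv_pos.2 hl).le hu.1.le)
        rw [hν.sm_real_univ hnorm ht] at h2
        calc (1 - t) * _ ≤ (1 - t) * (1 - t)⁻¹ := mul_le_mul_of_nonneg_left h2 h1t.le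
          _ = 1 := mul_inv_cancel₀ h1t.ne'
      · refine Eventually.of_forall fun u hu => ?_
        rw [uIoc_of_le hw.le] at hu
        exact hν.tendsto_lap_of_tendsto_distribution hnorm hlam hP hlim hu.1
    refine h1.congr' ?_
    filter_upwards [hev] with t ⟨ht, hl⟩
    rw [intervalIntegral.integral_const_mul]
    have := bern_map_mul (m := sm (ν t)) (inv_pos.2 hl).ne' w
    rw [inv_inv] at this
    rw [← this, bern]
  have hex : ∀ t w : ℝ, ∃ s : ℝ, t ∈ Ico (0 : ℝ) 1 → 0 < lam t → 0 < w →
      0 < s ∧ s - t * bern m s = (lam t)⁻¹ * w := by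
    intro t w
    by_cases h : t ∈ Ico (0 : ℝ) 1 ∧ 0 < lam t ∧ 0 < w
    · obtain ⟨s, hs⟩ := exists_sub_mul_bern_eq hm h.1 (mul_pos (inv_pos.2 h.2.1) h.2.2)
      exact ⟨s, fun _ _ _ => hs⟩
    · exact ⟨0, fun h1 h2 h3 => absurd ⟨h1, h2, h3⟩ h⟩
  choose S hS using hex
  have hSφ : ∀ w, 0 < w → Tendsto (fun t => (1 - t) * (lam t * bern m (S t w))) (𝓝[<] 1)
      (𝓝 (bern P w)) := by
    intro w hw
    refine (hbern w hw).congr' ?_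
    filter_upwards [hev] with t ⟨ht, hl⟩
    obtain ⟨h1, h2⟩ := hS t w ht hl hw
    rw [← h2, (hν.bern_characteristic hnorm ht h1).2]
  -- As λ(S - tφ(S)) = w, the quantity λ(S - φ(S)) equals w - (1-t) λ φ(S).
  have hSe : ∀ w, 0 < w → Tendsto (fun t => lam t * (S t w - bern m (S t w))) (𝓝[<] 1)
      (𝓝 (w - bern P w)) := by
    intro w hw
    refine ((hSφ w hw).const_sub w).congr' ?_
    filter_upwards [hev] with t ⟨ht, hl⟩
    obtain ⟨h1, h2⟩ := hS t w ht hl hw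
    have h3 : lam t * (S t w - t * bern m (S t w)) = w := by
      rw [h2, mul_inv_cancel_left₀ hl.ne']
    linear_combination -h3
  have hSpos : ∀ w, 0 < w → ∀ᶠ t in 𝓝[<] 1, 0 < S t w := by
    intro w hw
    filter_upwards [hev] with t ⟨ht, hl⟩ using (hS t w ht hl hw).1
  have hS0 : ∀ w, 0 < w → Tendsto (fun t => S t w) (𝓝[<] 1) (𝓝[>] 0) := by
    intro w hw
    refine tendsto_nhdsWithin_iff.2 ⟨?_, hSpos w hw⟩
    -- A convergent quantity divided by λ → ∞. Strict monotonicity of s - φ(s) then brings S itself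
    -- to 0.
    have h1 : Tendsto (fun t => S t w - bern m (S t w)) (𝓝[<] 1) (𝓝 0) := by
      have h2 := (hSe w hw).mul hlam.inv_tendsto_atTop
      rw [mul_zero] at h2
      refine h2.congr' ?_
      filter_upwards [hev] with t ⟨ht, hl⟩
      simp only [Pi.inv_apply]
      field_simp
    refine tendsto_order.2 ⟨fun a ha => (hSpos w hw).mono fun t ht => ha.trans ht, fun a ha => ?_⟩
    filter_upwards [h1.eventually (gt_mem_nhds (sub_bern_pos hm hm0 ha)), hSpos w hw] with t h2 h3
    exact ((strictMonoOn_sub_bern hm hm0).lt_iff_lt h3.le ha.le).1 h2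
  have hkey : ∀ {c : ℝ}, 0 < c → c < 1 → ∃ g, 0 < g ∧ g < 1 ∧
      Tendsto (fun s => ratio m (c * s) / ratio m s) (𝓝[>] 0) (𝓝 g) := fun hc hc1 =>
    exists_tendsto_ratio (R := ratio m) (φ := bern P) (M := ratio P) (S := S)
    (ratio_strictMono hm hm0) (tendsto_ratio_zero hm) (fun s hs => ratio_pos hm hm0 hs)
    (bern_strictMono hP ne_zero_of_isProbabilityMeasure) (continuousOn_bern hP) bern_zero
    (ratio_strictMono hP hP0) (ratio_continuousOn hP) (fun w hw => ratio_pos hP hP0 hw) hSpos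
    (fun w hw => by
      refine ((hSe w hw).div (hSφ w hw) (bern_pos' hP hw).ne').congr' ?_
      filter_upwards [hev, hSpos w hw] with t ⟨ht, hl⟩ hs
      have h1t : 1 - t ≠ 0 := by linarith [ht.2]
      have := (bern_pos' hm hs).ne'
      simp only [Pi.div_apply, ratio]
      field_simp)
    (fun w w' hw hw' => by
      have h1 := ((hSφ w hw).div (hSφ w' hw') (bern_pos' hP hw').ne').mul
        (((tendsto_bern_div hm).comp (hS0 w' hw')).div ((tendsto_bern_div hm).comp (hS0 w hw))
          one_ne_zero)
      rw [div_one, mul_one] at h1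
      refine h1.congr' ?_
      filter_upwards [hev, hSpos w hw, hSpos w' hw'] with t ⟨ht, hl⟩ hs hs'
      have h1t : 1 - t ≠ 0 := by linarith [ht.2]
      have := (bern_pos' hm hs).ne'
      have := (bern_pos' hm hs').ne'
      simp only [Pi.div_apply, Function.comp_apply]
      field_simp) hc hc1
  obtain ⟨ρ, hρ⟩ := exists_regVaryingZero (R := ratio m) (fun s hs => ratio_pos hm hm0 hs)
    (ratio_strictMono hm hm0).monotoneOn (fun c hc => by
      rcases lt_trichotomy c 1 with h | h | h
      · obtain ⟨g, hg0, -, hg⟩ := hkey hc h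
        exact ⟨g, hg0, hg⟩
      · refine ⟨1, one_pos, tendsto_const_nhds.congr' ?_⟩
        filter_upwards [self_mem_nhdsWithin] with s hs
        rw [h, one_mul, div_self (ratio_pos hm hm0 hs).ne']
      · obtain ⟨g, hg0, -, hg⟩ := hkey (inv_pos.2 hc) (inv_lt_one_of_one_lt₀ h)
        refine ⟨g⁻¹, inv_pos.2 hg0, ?_⟩
        refine ((hg.comp (tendsto_const_mul_nhdsGT_zero hc)).inv₀ hg0.ne').congr fun s => ?_
        simp only [Function.comp_apply]
        rw [inv_mul_cancel_left₀ hc.ne', inv_div])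
  -- The rigidity argument gives a limit strictly below 1 at c = 1/2, which excludes a nonpositive
  -- exponent.
  have hρ0 : 0 < ρ := by
    obtain ⟨g, hg0, hg1, hg⟩ := hkey (c := 1 / 2) (by norm_num) (by norm_num)
    have h1 := tendsto_nhds_unique hg (hρ (1 / 2) (by norm_num))
    by_contra hneg
    have h2 : (1 : ℝ) ≤ (1 / 2) ^ ρ :=
      Real.one_le_rpow_of_pos_of_le_one_of_nonpos (by norm_num) (by norm_num) (not_lt.1 hneg)
    linarith
  -- The deviation is R φ with φ(s) ~ s, which raises the index by one.
  have he : RegVaryingZero (fun s => s - bern m s) (1 + ρ) := by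
    intro c hc
    have h1 := ((hρ c hc).mul (((tendsto_bern_div hm).comp (tendsto_const_mul_nhdsGT_zero hc)).div
      (tendsto_bern_div hm) one_ne_zero)).const_mul c
    rw [div_one, mul_one, ← Real.rpow_one_add' hc.le (by linarith)] at h1
    refine h1.congr' ?_
    filter_upwards [self_mem_nhdsWithin] with s (hs : 0 < s)
    have e1 := (bern_pos' hm hs).ne'
    have e2 := (bern_pos' hm (mul_pos hc hs)).ne'
    have e3 := (sub_bern_pos hm hm0 hs).ne'
    simp only [Pi.div_apply, Function.comp_apply, ratio]
    field_simp
  have hH := he.firstMom_of_sub_bern hm hm0 hρ0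
  -- `lapDeriv` is decreasing and varies with index ρ - 1, which therefore cannot be positive.
  have hρ1 : ρ ≤ 1 := by
    have h1 : (2 : ℝ) ^ (ρ - 1) ≤ 1 := by
      refine le_of_tendsto (hH 2 two_pos) ?_
      filter_upwards [self_mem_nhdsWithin] with s (hs : 0 < s)
      refine div_le_one_of_le₀ ?_ (lapDeriv_pos hm hm0 hs).le
      exact lapDeriv_anti hm hs (mem_Ioi.2 (by linarith)) (by linarith)
    by_contra hneg
    have h2 : (1 : ℝ) < 2 ^ (ρ - 1) := Real.one_lt_rpow one_lt_two (by linarith [not_le.1 hneg])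
    linarith
  have hratio : ∀ c : ℝ, 0 < c →
      Tendsto (fun x => firstMom m (c * x) / firstMom m x) atTop (𝓝 (c ^ (1 - ρ))) := fun c hc =>
    tendsto_firstMom_div hm hm0 (by rwa [neg_sub]) hc
  have hpos : ∀ᶠ x in atTop, 0 < firstMom m x := by
    have h1 : (0 : ℝ) < 2 ^ (1 - ρ) := by positivity
    filter_upwards [(hratio 2 two_pos).eventually (lt_mem_nhds h1)] with x hx
    rcases (firstMom_nonneg hm x).lt_or_eq with h | h
    · exact h
    · rw [← h] at hx; simp at hx
  obtain ⟨L, hL, hfL⟩ := exists_slowlyVarying hpos hratio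
  refine ⟨ρ, ⟨hρ0, hρ1⟩, L, hL, ?_⟩
  have : (fun x => ∫ y in Ioc 0 x, y ^ 3 ∂(ν 0)) = firstMom m := by
    ext x; exact (firstMom_sm hrad0 x).symm
  rwa [this]

end

/-! ### Sufficiency: the length scale and the limit law -/

section
variable {m : Measure ℝ} [IsProbabilityMeasure m]

/-- Near t = 1 solve R(S) = 1 - t and set λ = 1/(S - φ(S)). As t increases S decreases, so λ
increases. Below a time t₀ at which the equation is already solvable, λ is continued linearly down
to λ(0) = 0. -/
lemma exists_scale (hm : m (Iio 0) = 0) (h0 : m (Ioi 0) ≠ 0) :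
    ∃ S lam : ℝ → ℝ, Tendsto S (𝓝[<] 1) (𝓝[>] 0) ∧ (∀ᶠ t in 𝓝[<] 1, ratio m (S t) = 1 - t) ∧
      StrictMonoOn lam (Ico 0 1) ∧ (∀ t ∈ Ioo (0 : ℝ) 1, 0 < lam t) ∧
      Tendsto lam (𝓝[<] 1) atTop ∧ ∀ᶠ t in 𝓝[<] 1, lam t = (S t - bern m (S t))⁻¹ := by
  have hr1 := ratio_pos hm h0 one_pos
  obtain ⟨t₀, ht₀, ht₀1, ht₀r⟩ : ∃ t₀ : ℝ, 0 < t₀ ∧ t₀ < 1 ∧ 1 - t₀ ≤ ratio m 1 := by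
    refine ⟨1 - min (ratio m 1) (1 / 2), ?_, ?_, ?_⟩
    · linarith [min_le_right (ratio m 1) (1 / 2)]
    · linarith [lt_min hr1 (show (0 : ℝ) < 1 / 2 by norm_num)]
    · linarith [min_le_left (ratio m 1) (1 / 2)]
  have hex : ∀ t : ℝ, ∃ s : ℝ, t ∈ Ico t₀ 1 → 0 < s ∧ ratio m s = 1 - t := by
    intro t
    by_cases ht : t ∈ Ico t₀ 1
    · have h1t : 0 < 1 - t := by linarith [ht.2]
      obtain ⟨a, ha1, ha, ha2⟩ := (((tendsto_ratio_zero hm).eventually (gt_mem_nhds h1t)).and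
        (Ioo_mem_nhdsGT one_pos : ∀ᶠ a in 𝓝[>] (0 : ℝ), a ∈ Ioo (0 : ℝ) 1)).exists
      obtain ⟨s, hs, hs'⟩ := intermediate_value_Icc ha2.le
        ((ratio_continuousOn hm).mono fun x hx => ha.trans_le hx.1)
        (show 1 - t ∈ Icc (ratio m a) (ratio m 1) from ⟨ha1.le, by linarith [ht.1]⟩)
      exact ⟨s, fun _ => ⟨ha.trans_le hs.1, hs'⟩⟩
    · exact ⟨0, fun h => absurd h ht⟩
  choose S hS using hex
  have hSanti : ∀ t ∈ Ico t₀ 1, ∀ t' ∈ Ico t₀ 1, t < t' → S t' < S t := by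
    intro t ht t' ht' h
    refine ((ratio_strictMono hm h0).lt_iff_lt (hS t' ht').1 (hS t ht).1).1 ?_
    rw [(hS t' ht').2, (hS t ht).2]
    linarith
  have hev : ∀ᶠ t in 𝓝[<] (1 : ℝ), t ∈ Ico t₀ 1 :=
    (IsSolution.eventually_mem t₀ ht₀1).mono fun t ht => Ioo_subset_Ico_self ht
  have hS0 : Tendsto S (𝓝[<] 1) (𝓝 0) := by
    refine tendsto_order.2 ⟨fun a ha => hev.mono fun t ht => ha.trans (hS t ht).1, fun a ha => ?_⟩
    have h1 : Tendsto (fun t : ℝ => 1 - t) (𝓝[<] 1) (𝓝 0) := by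
      have : Tendsto (fun t : ℝ => 1 - t) (𝓝 1) (𝓝 (1 - 1)) :=
        (continuous_const.sub continuous_id).tendsto 1
      rw [sub_self] at this
      exact this.mono_left nhdsWithin_le_nhds
    filter_upwards [h1.eventually (gt_mem_nhds (ratio_pos hm h0 ha)), hev] with t h2 ht
    refine ((ratio_strictMono hm h0).lt_iff_lt (hS t ht).1 ha).1 ?_
    rwa [(hS t ht).2]
  have hSw : Tendsto S (𝓝[<] 1) (𝓝[>] 0) :=
    tendsto_nhdsWithin_iff.2 ⟨hS0, hev.mono fun t ht => (hS t ht).1⟩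
  have hepos : ∀ t ∈ Ico t₀ 1, 0 < S t - bern m (S t) := fun t ht =>
    sub_bern_pos hm h0 (hS t ht).1
  have ht₀m : t₀ ∈ Ico t₀ 1 := ⟨le_rfl, ht₀1⟩
  have hc := inv_pos.2 (hepos t₀ ht₀m)
  have hlam : ∀ t ∈ Ico t₀ 1, ∀ t' ∈ Ico t₀ 1, t < t' →
      (S t - bern m (S t))⁻¹ < (S t' - bern m (S t'))⁻¹ := fun t ht t' ht' h =>
    inv_strictAnti₀ (hepos t' ht') (strictMonoOn_sub_bern hm h0 (hS t' ht').1.le (hS t ht).1.le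
      (hSanti t ht t' ht' h))
  have hevlam : ∀ᶠ t in 𝓝[<] (1 : ℝ), (if t < t₀ then t / t₀ * (S t₀ - bern m (S t₀))⁻¹
      else (S t - bern m (S t))⁻¹) = (S t - bern m (S t))⁻¹ := by
    filter_upwards [hev] with t ht
    rw [if_neg (not_lt.2 ht.1)]
  refine ⟨S, fun t => if t < t₀ then t / t₀ * (S t₀ - bern m (S t₀))⁻¹
    else (S t - bern m (S t))⁻¹, hSw, hev.mono fun t ht => (hS t ht).2, ?_, ?_, ?_, hevlam⟩
  · intro t ht t' ht' h
    dsimp only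
    by_cases h1 : t < t₀
    · rw [if_pos h1]
      have h2 : t / t₀ < 1 := (div_lt_one ht₀).2 h1
      by_cases h3 : t' < t₀
      · rw [if_pos h3]
        gcongr
      · rw [if_neg h3]
        refine (mul_lt_of_lt_one_left hc h2).trans_le ?_
        rcases (not_lt.1 h3).lt_or_eq with h4 | h4
        · exact (hlam t₀ ht₀m t' ⟨h4.le, ht'.2⟩ h4).le
        · rw [h4]
    · rw [if_neg h1, if_neg fun h3 => h1 (h.trans h3)]
      exact hlam t ⟨not_lt.1 h1, ht.2⟩ t' ⟨(not_lt.1 h1).trans h.le, ht'.2⟩ h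
  · intro t ht
    dsimp only
    split_ifs with h1
    · have := ht.1
      positivity
    · exact inv_pos.2 (hepos t ⟨not_lt.1 h1, ht.2⟩)
  · refine Tendsto.congr' (hevlam.mono fun t ht => ht.symm) ?_
    refine tendsto_inv_nhdsGT_zero.comp (tendsto_nhdsWithin_iff.2 ⟨?_, hev.mono hepos⟩)
    have := hS0.sub ((tendsto_bern_zero hm).comp hSw)
    rwa [sub_zero] at this

end

/-- Pointwise convergence of monotone functions along moving points. -/
lemma tendsto_of_antitone_of_moving {ι : Type*} {l : Filter ι} {f W : ι → ℝ → ℝ} {k h : ℝ → ℝ}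
    (hf : ∀ᶠ i in l, AntitoneOn (f i) (Ioi 0)) (hk : StrictMonoOn k (Ioi 0))
    (hk0 : ∀ y, 0 < y → 0 < k y)
    (hW : ∀ y, 0 < y → Tendsto (fun i => W i y) l (𝓝 (k y)))
    (hfW : ∀ y, 0 < y → Tendsto (fun i => f i (W i y)) l (𝓝 (h y)))
    {y : ℝ} (hy : 0 < y) (hh : ContinuousAt h y) :
    Tendsto (fun i => f i (k y)) l (𝓝 (h y)) := by
  refine tendsto_order.2 ⟨fun a ha => ?_, fun a ha => ?_⟩
  -- The moving point attached to a slightly larger y' eventually lies beyond k(y), so monotonicity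
  -- compares the two values; the upper bound uses a slightly smaller y'.
  · obtain ⟨y', hy', hy'a⟩ : ∃ y', y < y' ∧ a < h y' :=
      (((hh.mono_left nhdsWithin_le_nhds : Tendsto h (𝓝[>] y) _).eventually
        (lt_mem_nhds ha)).and self_mem_nhdsWithin).exists.imp fun y' h => ⟨h.2, h.1⟩
    have hy'0 := hy.trans hy'
    filter_upwards [hf, (hW y' hy'0).eventually (lt_mem_nhds (hk hy hy'0 hy')),
      (hfW y' hy'0).eventually (lt_mem_nhds hy'a)] with i h1 h2 h3
    exact h3.trans_le (h1 (hk0 y hy) (mem_Ioi.2 ((hk0 y hy).trans h2)) h2.le)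
  · obtain ⟨y', ⟨hy'0, hy'⟩, hy'a⟩ : ∃ y', (0 < y' ∧ y' < y) ∧ h y' < a :=
      (((hh.mono_left nhdsWithin_le_nhds : Tendsto h (𝓝[<] y) _).eventually
        (gt_mem_nhds ha)).and (Ioo_mem_nhdsLT hy)).exists.imp fun y' h => ⟨h.2, h.1⟩
    filter_upwards [hf, (hW y' hy'0).eventually (gt_mem_nhds (hk hy'0 hy hy')),
      (hW y' hy'0).eventually (lt_mem_nhds (hk0 y' hy'0)),
      (hfW y' hy'0).eventually (gt_mem_nhds hy'a)] with i h1 h2 h4 h3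
    exact (h1 h4 (hk0 y hy) h2.le).trans_lt h3

section
variable {ρ : ℝ}

lemma strictMonoOn_add_rpow (hρ : 0 < ρ) :
    StrictMonoOn (fun y : ℝ => y + y ^ (1 + ρ)) (Ici 0) := fun y hy y' _ h =>
  add_lt_add h (Real.rpow_lt_rpow hy h (by linarith))

lemma exists_add_rpow_eq (hρ : 0 < ρ) {w : ℝ} (hw : 0 < w) :
    ∃ y, 0 < y ∧ y ≤ w ∧ y + y ^ (1 + ρ) = w := by
  have hc : ContinuousOn (fun y : ℝ => y + y ^ (1 + ρ)) (Icc 0 w) :=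
    (continuous_id.add (Real.continuous_rpow_const (by linarith))).continuousOn
  obtain ⟨y, hy, hyw⟩ := intermediate_value_Icc hw.le hc (show w ∈ _ by
    constructor
    · simp [Real.zero_rpow (show 1 + ρ ≠ 0 by linarith), hw.le]
    · simp only [le_add_iff_nonneg_right]; positivity)
  refine ⟨y, lt_of_le_of_ne hy.1 fun h => ?_, hy.2, hyw⟩
  simp [← h, Real.zero_rpow (show 1 + ρ ≠ 0 by linarith)] at hyw
  linarith

lemma continuous_inv_one_add_rpow (hρ : 0 < ρ) :
    ContinuousOn (fun y : ℝ => (1 + (1 + ρ) * y ^ ρ)⁻¹) (Ici 0) := by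
  refine ContinuousOn.inv₀ (Continuous.continuousOn ?_) fun y hy => ?_
  · exact continuous_const.add (continuous_const.mul (Real.continuous_rpow_const hρ.le))
  · have : 0 ≤ y ^ ρ := Real.rpow_nonneg hy _
    positivity

end

/-- If the third moment of the initial data varies regularly, then the rescaled second-moment
distributions converge to a limit whose Laplace transform is explicit. -/
theorem IsSolution.exists_limit {ν : ℝ → Measure ℝ} (hν : IsSolution 1 ν)
    (hnorm : secondMoment (ν 0) = 1) {ρ : ℝ} (hρ : ρ ∈ Ioc (0 : ℝ) 1) {L : ℝ → ℝ}
    (hL : IsSlowlyVarying L)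
    (hf : (fun x : ℝ => ∫ y in Ioc 0 x, y ^ 3 ∂(ν 0)) ~[atTop] (fun x : ℝ => x ^ (1 - ρ) * L x)) :
    ∃ lam : ℝ → ℝ, StrictMonoOn lam (Ico 0 1) ∧ (∀ t ∈ Ioo (0 : ℝ) 1, 0 < lam t) ∧
      Tendsto lam (𝓝[<] 1) atTop ∧
      ∃ P : Measure ℝ, IsProbabilityMeasure P ∧ P (Iio 0) = 0 ∧
        (∀ y, 0 < y → lap P (y + y ^ (1 + ρ)) = (1 + (1 + ρ) * y ^ ρ)⁻¹) ∧
        ∀ a, 0 ≤ a → P {a} = 0 →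
          Tendsto (fun t => secondMomentDistribution (ν t) (lam t * a)) (𝓝[<] 1)
            (𝓝 (P.real (Iic a))) := by
  have hρ0 := hρ.1
  have h00 : (0 : ℝ) ∈ Ico (0 : ℝ) 1 := ⟨le_rfl, one_pos⟩
  have hrad0 := (hν.radon 0 h00).null_nonpos
  have hprob : IsProbabilityMeasure (sm (ν 0)) := ⟨by rw [sm_univ, hnorm]⟩
  have hm := sm_Iio hrad0
  have hm0 : sm (ν 0) (Ioi 0) ≠ 0 := by
    intro h
    have h1 : sm (ν 0) univ = 0 := by
      rw [← Iic_union_Ioi (a := (0 : ℝ))]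
      exact measure_union_null (sm_Iic hrad0) h
    rw [measure_univ] at h1
    exact one_ne_zero h1
  have he : RegVaryingZero (fun s => s - bern (sm (ν 0)) s) (1 + ρ) := by
    refine RegVaryingZero.sub_bern_of_lapDeriv hm hm0 ?_
    have h1 := regVaryingZero_lapDeriv hm (b := 1 - ρ) (by linarith [hρ.2]) (by linarith)
      fun c hc => by
        have : firstMom (sm (ν 0)) = fun x => ∫ y in Ioc 0 x, y ^ 3 ∂(ν 0) := by
          ext x; exact firstMom_sm hrad0 x
        rw [this]
        exact tendsto_div_of_isEquivalent hL hf hc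
    rwa [neg_sub] at h1
  obtain ⟨S, lam, hS, hSr, hlm, hlp, hlt, hle⟩ := exists_scale hm hm0
  refine ⟨lam, hlm, hlp, hlt, ?_⟩
  set m := sm (ν 0) with hmdef
  set W : ℝ → ℝ → ℝ := fun t y => lam t * (S t * y - t * bern m (S t * y)) with hWdef
  set f : ℝ → ℝ → ℝ := fun t w => (1 - t) * lap (sm (ν t)) ((lam t)⁻¹ * w) with hfdef
  have hev : ∀ᶠ t in 𝓝[<] (1 : ℝ), t ∈ Ioo (0 : ℝ) 1 ∧ 0 < S t ∧ ratio m (S t) = 1 - t ∧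
      lam t = (S t - bern m (S t))⁻¹ := by
    filter_upwards [IsSolution.eventually_mem 0 one_pos, hS.eventually self_mem_nhdsWithin, hSr,
      hle] with t h1 h2 h3 h4 using ⟨h1, h2, h3, h4⟩
  have hSy : ∀ y, 0 < y → Tendsto (fun t => y * S t) (𝓝[<] 1) (𝓝[>] 0) := fun y hy =>
    (tendsto_const_mul_nhdsGT_zero hy).comp hS
  -- With e(s) = s - φ(s), the choices λ = 1/e(S) and 1 - t = e(S)/φ(S) make the rescaled end point
  -- e(Sy)/e(S) + φ(Sy)/φ(S).
  have hW : ∀ y, 0 < y → Tendsto (fun t => W t y) (𝓝[<] 1) (𝓝 (y + y ^ (1 + ρ))) := by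
    intro y hy
    have h1 := ((he y hy).comp hS).add ((((tendsto_bern_div hm).comp (hSy y hy)).div
      ((tendsto_bern_div hm).comp hS) one_ne_zero).mul_const y)
    rw [div_one, one_mul, add_comm] at h1
    refine h1.congr' ?_
    filter_upwards [hev] with t ⟨ht, hs, hr, hl⟩
    have e1 := (bern_pos' hm hs).ne'
    have e2 := (sub_bern_pos hm hm0 hs).ne'
    have e3 : t = 1 - (S t - bern m (S t)) / bern m (S t) := by
      rw [ratio] at hr; linarith
    simp only [hWdef, hl, Pi.div_apply, Function.comp_apply]
    rw [mul_comm (S t) y]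
    generalize hB : bern m (y * S t) = B
    generalize hA : bern m (S t) = A at e1 e2 e3
    generalize S t = σ at e2 e3 hs
    rw [e3]
    field_simp
    ring
  -- With A = `lap m (S y)`, the value is (1-t)A/(1-tA) = A/(A + (1-A)/(1-t)). Here A → 1, and
  -- (1-A)/(1-t) → (1+ρ) y^ρ by the monotone density theorem.
  have hfW : ∀ y, 0 < y → Tendsto (fun t => f t (W t y)) (𝓝[<] 1)
      (𝓝 ((1 + (1 + ρ) * y ^ ρ)⁻¹)) := by
    intro y hy
    have h1 : Tendsto (fun s => s * (1 - lap m (s * y)) / (s - bern m s)) (𝓝[>] 0)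
        (𝓝 ((1 + ρ) * y ^ (1 + ρ - 1))) :=
      he.tendsto_deriv_of_monotone (f' := fun s => 1 - lap m s)
        (fun s hs => sub_bern_pos hm hm0 hs)
        (fun s hs => (hasDerivAt_id s).sub (hasDerivAt_bern hm hs))
        (Or.inl fun a ha b hb hab => sub_le_sub_left
          (lap_anti hm (mem_Ici.2 (le_of_lt ha)) (mem_Ici.2 (le_of_lt hb)) hab) _) hy
    rw [add_sub_cancel_left] at h1
    have h2 := (tendsto_lap_zero hm).comp (hSy y hy)
    have hyρ : 0 < y ^ ρ := Real.rpow_pos_of_pos hy _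
    have h3 := h2.div (h2.add ((h1.comp hS).mul ((tendsto_bern_div hm).comp hS)))
      (by positivity)
    rw [mul_one, one_div] at h3
    refine h3.congr' ?_
    filter_upwards [hev] with t ⟨ht, hs, hr, hl⟩
    have e0 : 0 < lam t := hlp t ht
    have h4 := hν.lap_characteristic hnorm (Ioo_subset_Ico_self ht) (mul_pos hs hy)
    have e1 := (bern_pos' hm hs).ne'
    have e2 := (sub_bern_pos hm hm0 hs).ne'
    have h5 : t * lap m (S t * y) < 1 := by
      have := lap_lt_one hm hm0 (mul_pos hs hy)
      have := lap_nonneg (m := m) (S t * y)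
      nlinarith [ht.1, ht.2]
    have h6 : lap (sm (ν t)) (S t * y - t * bern m (S t * y)) =
        lap m (S t * y) / (1 - t * lap m (S t * y)) := by
      rw [eq_div_iff (by linarith)]; exact h4
    simp only [hfdef, hWdef, Pi.div_apply, Function.comp_apply]
    rw [inv_mul_cancel_left₀ e0.ne', h6, mul_comm y (S t)]
    rw [ratio] at hr
    generalize lap m (S t * y) = A at *
    generalize bern m (S t) = B at *
    have h7 : 1 - t ≠ 0 := by linarith [ht.2]
    have h8 : S t * (1 - A) / (S t - B) * (B / S t) = (1 - A) / (1 - t) := by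
      rw [← hr]; field_simp
    rw [h8, ← mul_div_assoc, div_eq_div_iff]
    · field_simp
      ring
    · have : A + (1 - A) / (1 - t) = (1 - t * A) / (1 - t) := by field_simp; ring
      rw [this]
      exact div_ne_zero (by linarith) h7
    · linarith
  have hfanti : ∀ᶠ t in 𝓝[<] (1 : ℝ), AntitoneOn (f t) (Ioi 0) := by
    filter_upwards [hev] with t ⟨ht, _⟩
    have ht' := Ioo_subset_Ico_self ht
    have := isFiniteMeasure_sm (hν.secondMoment_lt_top ht')
    have hl := inv_pos.2 (hlp t ht)
    have h1t : 0 ≤ 1 - t := by linarith [ht.2]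
    intro a ha b hb hab
    refine mul_le_mul_of_nonneg_left ?_ h1t
    exact lap_anti (sm_Iio (hν.radon t ht').null_nonpos) (mul_pos hl ha).le (mul_pos hl hb).le
      (mul_le_mul_of_nonneg_left hab hl.le)
  have hk0 : ∀ y : ℝ, 0 < y → 0 < y + y ^ (1 + ρ) := fun y hy => by positivity
  have hlim : ∀ y, 0 < y → Tendsto (fun t => f t (y + y ^ (1 + ρ))) (𝓝[<] 1)
      (𝓝 ((1 + (1 + ρ) * y ^ ρ)⁻¹)) := fun y hy =>
    tendsto_of_antitone_of_moving hfanti ((strictMonoOn_add_rpow hρ0).mono Ioi_subset_Ici_self)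
      hk0 hW hfW hy ((continuous_inv_one_add_rpow hρ0).continuousAt (Ici_mem_nhds hy))
  -- Y inverts y ↦ y + y^(1+ρ). The bound Y(w) ≤ w later gives the limit 1 of the transform at 0+,
  -- so that no mass is lost.
  choose! Y hY0 hYle hYeq using fun (w : ℝ) (hw : 0 < w) => exists_add_rpow_eq hρ0 hw
  set U : ℝ → Measure ℝ := fun t => if t ∈ Ioo (0 : ℝ) 1 then
    ENNReal.ofReal (1 - t) • (sm (ν t)).map ((lam t)⁻¹ * ·) else Measure.dirac 0 with hUdef
  have hUof : ∀ t ∈ Ioo (0 : ℝ) 1, U t = ENNReal.ofReal (1 - t) • (sm (ν t)).map ((lam t)⁻¹ * ·) :=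
    fun t ht => if_pos ht
  have hUprob : ∀ t, IsProbabilityMeasure (U t) := by
    intro t
    by_cases ht : t ∈ Ioo (0 : ℝ) 1
    · rw [hUof t ht]
      have ht' := Ioo_subset_Ico_self ht
      have := isFiniteMeasure_sm (hν.secondMoment_lt_top ht')
      have h1 : sm (ν t) univ = ENNReal.ofReal (1 - t)⁻¹ := by
        rw [← hν.sm_real_univ hnorm ht', ofReal_measureReal]
      have h1t : 0 < 1 - t := by linarith [ht.2]
      constructor
      rw [Measure.smul_apply, Measure.map_apply (by fun_prop) MeasurableSet.univ, preimage_univ, h1,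
        smul_eq_mul, ← ENNReal.ofReal_mul h1t.le, mul_inv_cancel₀ h1t.ne', ENNReal.ofReal_one]
    · simp only [hUdef, if_neg ht]
      infer_instance
  have hU0 : ∀ t, U t (Iio 0) = 0 := by
    intro t
    by_cases ht : t ∈ Ioo (0 : ℝ) 1
    · rw [hUof t ht, Measure.smul_apply, map_mul_Iio
        (sm_Iio (hν.radon t (Ioo_subset_Ico_self ht)).null_nonpos) (inv_pos.2 (hlp t ht)),
        smul_zero]
    · simp only [hUdef, if_neg ht]
      simp
  have hUlap : ∀ t ∈ Ioo (0 : ℝ) 1, ∀ w, lap (U t) w = f t w := by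
    intro t ht w
    have h1t : 0 ≤ 1 - t := by linarith [ht.2]
    rw [hUof t ht, lap, integral_smul_measure, ENNReal.toReal_ofReal h1t, smul_eq_mul]
    change (1 - t) * lap _ w = _
    rw [lap_map_mul]
  obtain ⟨P, hP, hP0, hPlap, hPlim⟩ := exists_limit_of_tendsto_lap hU0
    (g := fun w => (1 + (1 + ρ) * Y w ^ ρ)⁻¹) (l := 𝓝[<] (1 : ℝ)) (fun w hw => by
      have h1 := hlim (Y w) (hY0 w hw)
      rw [hYeq w hw] at h1
      refine h1.congr' ?_
      filter_upwards [hev] with t ⟨ht, _⟩ using (hUlap t ht w).symm) (by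
      have h1 : Tendsto Y (𝓝[>] 0) (𝓝[≥] 0) := by
        refine tendsto_nhdsWithin_iff.2 ⟨?_, ?_⟩
        · refine tendsto_of_tendsto_of_tendsto_of_le_of_le' tendsto_const_nhds
            (tendsto_id.mono_left nhdsWithin_le_nhds) ?_ ?_
          · filter_upwards [self_mem_nhdsWithin] with w hw using (hY0 w hw).le
          · filter_upwards [self_mem_nhdsWithin] with w hw using hYle w hw
        · filter_upwards [self_mem_nhdsWithin] with w hw using (hY0 w hw).le
      have h2 := (continuous_inv_one_add_rpow hρ0 0 self_mem_Ici).tendsto.comp h1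
      simpa [Real.zero_rpow hρ0.ne', Function.comp_def] using h2)
  refine ⟨P, hP, hP0, fun y hy => ?_, fun a ha haP => ?_⟩
  · have h1 := hYeq _ (hk0 y hy)
    have h2 := (strictMonoOn_add_rpow hρ0).injOn (hY0 _ (hk0 y hy)).le hy.le h1
    rw [hPlap _ (hk0 y hy), h2]
  · refine (hPlim a ha haP).congr' ?_
    filter_upwards [hev] with t ⟨ht, _⟩
    have h1t : 0 ≤ 1 - t := by linarith [ht.2]
    rw [← hν.distribution_eq hnorm (Ioo_subset_Ico_self ht) (hlp t ht), hUof t ht,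
      measureReal_ennreal_smul_apply, ENNReal.toReal_ofReal h1t]


/-! ### Lagrange inversion by contour integrals -/

section
open Complex Metric

/-- A form of the Lagrange inversion formula, with the coefficients written as contour integrals. -/
theorem hasSum_circleIntegral_lagrange {h φ : ℂ → ℂ} (hh : DifferentiableOn ℂ h (ball 0 1))
    (hφ : DifferentiableOn ℂ φ (ball 0 1)) :
    ∃ δ : ℝ, 0 < δ ∧ ∀ z u₀ : ℂ, ‖z‖ < δ → ‖u₀‖ < 1 / 2 → u₀ = z * φ u₀ →
      HasSum (fun k : ℕ => z ^ k * ∮ u in C(0, 1 / 2), u⁻¹ ^ k * (u⁻¹ * (h u * φ u ^ k)))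
        (2 * Real.pi * I * (h u₀ / (1 - z * deriv φ u₀))) := by
  have hKU : closedBall (0 : ℂ) (1 / 2) ⊆ ball 0 1 := closedBall_subset_ball (by norm_num)
  have hK : IsCompact (closedBall (0 : ℂ) (1 / 2)) := isCompact_closedBall _ _
  obtain ⟨C₁, hC₁⟩ := hK.exists_bound_of_continuousOn (hφ.continuousOn.mono hKU)
  obtain ⟨C₂, hC₂⟩ := hK.exists_bound_of_continuousOn
    ((hφ.deriv isOpen_ball).continuousOn.mono hKU)
  set C := max 1 (max C₁ C₂) with hCdef
  have hC : 0 < C := zero_lt_one.trans_le (le_max_left _ _)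
  have hCφ : ∀ u ∈ closedBall (0 : ℂ) (1 / 2), ‖φ u‖ ≤ C := fun u hu =>
    (hC₁ u hu).trans ((le_max_left _ _).trans (le_max_right _ _))
  have hCφ' : ∀ u ∈ closedBall (0 : ℂ) (1 / 2), ‖deriv φ u‖ ≤ C := fun u hu =>
    (hC₂ u hu).trans ((le_max_right _ _).trans (le_max_right _ _))
  -- With |z| C ≤ 1/4, on |u| = 1/2 the quotient z φ(u)/u has modulus at most 1/2, so the geometric
  -- series in it converges uniformly.
  refine ⟨1 / (4 * C), by positivity, fun z u₀ hz hu₀ hu₀z => ?_⟩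
  have hzC : ‖z‖ * C ≤ 1 / 4 := by
    rw [lt_div_iff₀ (by positivity)] at hz
    linarith
  have hu₀K : u₀ ∈ ball (0 : ℂ) (1 / 2) := by simpa using hu₀
  have hslope : ∀ u ∈ closedBall (0 : ℂ) (1 / 2), ‖dslope φ u₀ u‖ ≤ C := by
    intro u hu
    rcases eq_or_ne u u₀ with rfl | hne
    · rw [dslope_same]; exact hCφ' _ hu
    · rw [dslope_of_ne _ hne, slope_def_field, norm_div,
        div_le_iff₀ (norm_pos_iff.2 (sub_ne_zero.2 hne))]
      exact (convex_closedBall (0 : ℂ) (1 / 2)).norm_image_sub_le_of_norm_deriv_le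
        (fun x hx => hφ.differentiableAt (isOpen_ball.mem_nhds (hKU hx))) hCφ'
        (ball_subset_closedBall hu₀K) hu
  -- From u₀ = zφ(u₀) follows u - zφ(u) = (u - u₀)(1 - z `dslope φ u₀ u`). The second factor does
  -- not vanish, so Cauchy's formula at the only zero u₀ yields h(u₀)/(1 - zφ'(u₀)).
  have hg0 : ∀ u ∈ closedBall (0 : ℂ) (1 / 2), 1 - z * dslope φ u₀ u ≠ 0 := by
    intro u hu h0
    have h1 : ‖z * dslope φ u₀ u‖ = 1 := by rw [← sub_eq_zero.1 h0, norm_one]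
    rw [norm_mul] at h1
    have := mul_le_mul_of_nonneg_left (hslope u hu) (norm_nonneg z)
    linarith
  have hF : DifferentiableOn ℂ (fun u => h u / (1 - z * dslope φ u₀ u)) (closedBall 0 (1 / 2)) := by
    refine (hh.mono hKU).div ((differentiableOn_const _).sub ((differentiableOn_const _).mul
      (((differentiableOn_dslope ?_).2 hφ).mono hKU))) hg0
    exact isOpen_ball.mem_nhds (hKU (ball_subset_closedBall hu₀K))
  have hcauchy := hF.circleIntegral_sub_inv_smul hu₀K
  simp only [dslope_same, smul_eq_mul] at hcauchy
  rw [← hcauchy]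
  have hcm : ∀ θ, circleMap (0 : ℂ) (1 / 2) θ ∈ closedBall (0 : ℂ) (1 / 2) := fun θ =>
    circleMap_mem_closedBall _ (by norm_num) _
  have hch : Continuous fun θ => h (circleMap 0 (1 / 2) θ) :=
    (hh.continuousOn.mono hKU).comp_continuous (continuous_circleMap _ _) hcm
  have hcφ : Continuous fun θ => φ (circleMap 0 (1 / 2) θ) :=
    (hφ.continuousOn.mono hKU).comp_continuous (continuous_circleMap _ _) hcm
  have hne : ∀ θ, circleMap (0 : ℂ) (1 / 2) θ ≠ 0 := fun θ =>
    circleMap_ne_center (by norm_num)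
  have hnorm : ∀ θ, ‖circleMap (0 : ℂ) (1 / 2) θ‖ = 1 / 2 := fun θ => by simp
  have hratio : ∀ θ, ‖z * (circleMap (0 : ℂ) (1 / 2) θ)⁻¹ * φ (circleMap 0 (1 / 2) θ)‖ ≤ 1 / 2 := by
    intro θ
    rw [norm_mul, norm_mul, norm_inv, hnorm]
    have := mul_le_mul_of_nonneg_left (hCφ _ (hcm θ)) (norm_nonneg z)
    norm_num
    linarith
  simp only [← circleIntegral.integral_const_mul]
  refine intervalIntegral.hasSum_integral_of_dominated_convergence
    (fun k θ => ‖h (circleMap 0 (1 / 2) θ)‖ * (1 / 2) ^ k) (fun k => ?_) (fun k => ?_) ?_ ?_ ?_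
  · refine Continuous.aestronglyMeasurable ?_
    have hinv : Continuous fun θ => (circleMap (0 : ℂ) (1 / 2) θ)⁻¹ :=
      (continuous_circleMap _ _).inv₀ hne
    simp only [deriv_circleMap, smul_eq_mul]
    exact ((continuous_circleMap _ _).mul continuous_const).mul (continuous_const.mul
      ((hinv.pow k).mul (hinv.mul (hch.mul (hcφ.pow k)))))
  · refine Eventually.of_forall fun θ _ => ?_
    have h1 : deriv (circleMap 0 (1 / 2)) θ • (z ^ k * ((circleMap 0 (1 / 2) θ)⁻¹ ^ k *
        ((circleMap 0 (1 / 2) θ)⁻¹ * (h (circleMap 0 (1 / 2) θ) * φ (circleMap 0 (1 / 2) θ) ^ k))))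
        = I * (h (circleMap 0 (1 / 2) θ) *
          (z * (circleMap (0 : ℂ) (1 / 2) θ)⁻¹ * φ (circleMap 0 (1 / 2) θ)) ^ k) := by
      rw [deriv_circleMap, smul_eq_mul, mul_pow, mul_pow]
      have := hne θ
      field_simp
    rw [h1, norm_mul, norm_mul, norm_I, one_mul, norm_pow]
    exact mul_le_mul_of_nonneg_left (pow_le_pow_left₀ (norm_nonneg _) (hratio θ) k) (norm_nonneg _)
  · exact Eventually.of_forall fun _ _ =>
      (summable_geometric_of_lt_one (by norm_num) (by norm_num)).mul_left _
  · simp only [tsum_mul_left]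
    exact (hch.norm.mul continuous_const).intervalIntegrable _ _
  · refine Eventually.of_forall fun θ _ => HasSum.const_smul _ ?_
    have h1 := (hasSum_geometric_of_norm_lt_one ((hratio θ).trans_lt (by norm_num))).mul_right
      ((circleMap 0 (1 / 2) θ)⁻¹ * h (circleMap 0 (1 / 2) θ))
    generalize hu : circleMap (0 : ℂ) (1 / 2) θ = u at h1
    have hu0 : u ≠ 0 := hu ▸ hne θ
    have huK := hu ▸ hcm θ
    have h2 := sub_smul_dslope φ u₀ u
    rw [smul_eq_mul] at h2
    have h3 : u - z * φ u = (u - u₀) * (1 - z * dslope φ u₀ u) := by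
      rw [mul_sub, mul_one, mul_left_comm, h2, mul_sub, ← hu₀z]; ring
    have h4 : u - z * φ u ≠ 0 := by
      rw [h3]
      refine mul_ne_zero ?_ (hg0 u huK)
      intro h5
      have h6 := hnorm θ
      rw [hu, sub_eq_zero.1 h5] at h6
      linarith
    have h5 : 1 - z * u⁻¹ * φ u = (u - z * φ u) * u⁻¹ := by field_simp
    have h6 : (1 - z * u⁻¹ * φ u)⁻¹ * (u⁻¹ * h u) =
        (u - u₀)⁻¹ * (h u / (1 - z * dslope φ u₀ u)) := by
      rw [h5, mul_inv, inv_inv, mul_assoc, mul_inv_cancel_left₀ hu0, h3, mul_inv, mul_assoc,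
        ← div_eq_inv_mul (h u)]
    rw [h6] at h1
    refine (congrArg (fun f => HasSum f _) (funext fun k => ?_)).mpr h1
    dsimp only
    rw [mul_pow, mul_pow]; ring

lemma differentiableOn_one_add_cpow (a : ℂ) :
    DifferentiableOn ℂ (fun u : ℂ => (1 + u) ^ a) (ball 0 1) := by
  intro u hu
  refine (DifferentiableAt.cpow_const ?_ ?_).differentiableWithinAt
  · fun_prop
  · left
    have h1 : ‖u‖ < 1 := by simpa using hu
    have h2 := (abs_le.1 (abs_re_le_norm u)).1
    simp only [add_re, one_re]
    linarith

/-- Both sides are the n-th Taylor coefficient of (1+u)^a: one from the binomial series, the other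
from Cauchy's formula. -/
lemma choose_eq_circleIntegral (a : ℂ) (n : ℕ) :
    Ring.choose a n = (2 * Real.pi * I : ℂ)⁻¹ *
      ∮ u in C(0, 1 / 2), u⁻¹ ^ n * (u⁻¹ * (1 + u) ^ a) := by
  have h1 : HasFPowerSeriesAt (fun u : ℂ => (1 + u) ^ a)
      (cauchyPowerSeries (fun u : ℂ => (1 + u) ^ a) 0 (1 / 2 : NNReal)) 0 :=
    (((differentiableOn_one_add_cpow a).mono (closedBall_subset_ball
      (by norm_num))).hasFPowerSeriesOnBall (by norm_num)).hasFPowerSeriesAt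
  have h2 := congrArg (fun p => p n fun _ => (1 : ℂ))
    (one_add_cpow_hasFPowerSeriesAt_zero.eq_formalMultilinearSeries h1)
  simp only [cauchyPowerSeries_apply, binomialSeries_apply, List.ofFn_const, List.prod_replicate,
    one_pow, smul_eq_mul, mul_one, sub_zero, one_div] at h2
  rw [h2]
  simp

/-- The generating function of the coefficients `Ring.choose (k * β - 1) k`. -/
theorem hasSum_choose_mul_pow (β : ℝ) :
    ∃ δ : ℝ, 0 < δ ∧ ∀ z u : ℝ, 0 ≤ z → z < δ → 0 ≤ u → u < 1 / 2 → u = z * (1 + u) ^ β →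
      HasSum (fun k : ℕ => Ring.choose (k * β - 1) k * z ^ k) (1 + (1 - β) * u)⁻¹ := by
  -- Take h = (1+u)^(-1) and φ = (1+u)^β: the k-th coefficient is that of u^k in (1+u)^(kβ-1).
  obtain ⟨δ, hδ, H⟩ := hasSum_circleIntegral_lagrange (differentiableOn_one_add_cpow (-1))
    (differentiableOn_one_add_cpow β)
  refine ⟨δ, hδ, fun z u hz hzδ hu hu2 hzu => ?_⟩
  have h1u : (0 : ℝ) < 1 + u := by linarith
  have hcast : ((1 + u : ℝ) : ℂ) ^ (β : ℂ) = ((1 + u) ^ β : ℝ) := (ofReal_cpow h1u.le β).symm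
  rw [ofReal_add, ofReal_one] at hcast
  have h1 := H z u (by rwa [norm_real, Real.norm_of_nonneg hz])
    (by rwa [norm_real, Real.norm_of_nonneg hu]) (by
      rw [hcast, ← ofReal_mul, ← hzu])
  have h2 := h1.mul_left (2 * Real.pi * I : ℂ)⁻¹
  have hpi : (2 * Real.pi * I : ℂ) ≠ 0 := two_pi_I_ne_zero
  rw [inv_mul_cancel_left₀ hpi] at h2
  have hne : (1 + u : ℂ) ≠ 0 := by
    rw [← ofReal_one, ← ofReal_add]; exact ofReal_ne_zero.2 h1u.ne'
  have hd : deriv (fun u : ℂ => (1 + u) ^ (β : ℂ)) u = β * (1 + u : ℂ) ^ (β : ℂ) / (1 + u) := by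
    have h3 : HasDerivAt (fun u : ℂ => (1 + u) ^ (β : ℂ)) (β * (1 + u : ℂ) ^ ((β : ℂ) - 1) * 1) u :=
      ((hasDerivAt_id (u : ℂ)).const_add 1).cpow_const (by
        left; simpa using h1u)
    rw [h3.deriv, cpow_sub _ _ hne, cpow_one]
    ring
  -- By z(1+u)^β = u the derivative term is βu/(1+u), and the powers of 1+u cancel.
  have hval : (1 + u : ℂ) ^ (-1 : ℂ) / (1 - z * deriv (fun u : ℂ => (1 + u) ^ (β : ℂ)) u) =
      ((1 + (1 - β) * u)⁻¹ : ℝ) := by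
    rw [hd, hcast, cpow_neg_one]
    have h5 : (z : ℂ) * (((β : ℂ) * ((1 + u) ^ β : ℝ)) / (1 + u)) = β * u / (1 + u) := by
      rw [← mul_div_assoc, mul_left_comm, ← ofReal_mul, ← hzu]
    rw [h5]
    push_cast
    have h6 : (1 : ℂ) - β * u / (1 + u) = (1 + (1 - β) * u) / (1 + u) := by
      field_simp; ring
    rw [h6, div_div_eq_mul_div, inv_mul_cancel₀ hne, one_div]
  rw [hval] at h2
  rw [← hasSum_ofReal]
  refine (congrArg (fun f => HasSum f _) (funext fun k => ?_)).mpr h2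
  rw [ofReal_mul, ofReal_choose, ofReal_pow, choose_eq_circleIntegral]
  rw [mul_comm, mul_left_comm]
  congr 2
  refine circleIntegral.integral_congr (by norm_num) fun v hv => ?_
  have hv1 : (1 + v : ℂ) ≠ 0 := by
    intro h0
    have h4 : v = -1 := by linear_combination h0
    simp [h4] at hv
  congr 2
  push_cast
  rw [sub_eq_add_neg, cpow_add _ _ hv1, cpow_nat_mul, mul_comm]

end

/-! ### The series M_ρ: convergence and Laplace transform -/

lemma Gamma_add_nat_eq_prod {a : ℝ} (n : ℕ) (ha : ∀ j : ℕ, a + j ≠ 0) :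
    Real.Gamma (a + n) = (∏ j ∈ Finset.range n, (a + j)) * Real.Gamma a := by
  induction n with
  | zero => simp
  | succ n ih =>
    rw [Finset.prod_range_succ, Nat.cast_succ, ← add_assoc, Real.Gamma_add_one (ha n), ih]
    ring

/-- Euler's reflection formula, after shifting Γ(1 - c) by k. If sin πc = 0 then c is an integer
between 1 and k, and both sides vanish. -/
lemma Gamma_mul_sinc_mul_Gamma {c : ℝ} {k : ℕ} (hc : 0 < c) (hck : c ≤ k) :
    Real.Gamma (1 + k - c) * (Real.sin (Real.pi * c) / (Real.pi * c)) * Real.Gamma (1 + c) =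
      ∏ j ∈ Finset.range k, ((j : ℝ) + 1 - c) := by
  have hpi := Real.pi_pos
  by_cases hs : Real.sin (Real.pi * c) = 0
  · rw [hs, zero_div, mul_zero, zero_mul]
    obtain ⟨n, hn⟩ := Real.sin_eq_zero_iff.1 hs
    have hnc : (n : ℝ) = c := mul_right_cancel₀ hpi.ne' (by linarith)
    have hn0 : 0 < n := by rw [← hnc] at hc; exact_mod_cast hc
    have hnk : n ≤ k := by rw [← hnc] at hck; exact_mod_cast hck
    obtain ⟨j, rfl⟩ : ∃ j : ℕ, n = j + 1 := ⟨(n - 1).toNat, by omega⟩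
    refine (Finset.prod_eq_zero (i := j) (Finset.mem_range.2 (by omega)) ?_).symm
    rw [← hnc]; push_cast; ring
  · have h1 := Real.Gamma_mul_Gamma_one_sub c
    have hne : ∀ j : ℕ, 1 - c + j ≠ 0 := by
      intro j hj
      apply hs
      rw [Real.sin_eq_zero_iff]
      refine ⟨j + 1, ?_⟩
      push_cast
      rw [mul_comm]; congr 1; linarith
    have h2 := Gamma_add_nat_eq_prod k hne
    have h3 : Real.Gamma (1 - c) ≠ 0 := by
      intro h0
      rw [h0, mul_zero] at h1
      exact div_ne_zero hpi.ne' hs h1.symm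
    rw [show 1 + (k : ℝ) - c = 1 - c + k by ring, h2, add_comm 1 c, Real.Gamma_add_one hc.ne']
    have h4 : Real.sin (Real.pi * c) / (Real.pi * c) * (c * Real.Gamma c) * Real.Gamma (1 - c)
        = 1 := by
      rw [mul_assoc, mul_assoc, h1]
      field_simp
    calc _ = (∏ j ∈ Finset.range k, (1 - c + (j : ℝ))) *
          (Real.sin (Real.pi * c) / (Real.pi * c) * (c * Real.Gamma c) * Real.Gamma (1 - c)) := by
          ring
      _ = _ := by
          rw [h4, mul_one]
          exact Finset.prod_congr rfl fun j _ => by ring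

lemma choose_sub_one_eq_prod (c : ℝ) (k : ℕ) :
    Ring.choose (c - 1) k = (-1) ^ k * (∏ j ∈ Finset.range k, ((j : ℝ) + 1 - c)) / k.factorial := by
  rw [Ring.choose_eq_smul, ← Polynomial.aeval_eq_smeval, Polynomial.aeval_def,
    Polynomial.eval₂_eq_eval_map, descPochhammer_map, descPochhammer_eval_eq_prod_range,
    smul_eq_mul, div_eq_inv_mul]
  congr 1
  have h := Finset.prod_const (s := Finset.range k) (-1 : ℝ)
  rw [Finset.card_range] at h
  rw [← h, ← Finset.prod_mul_distrib]
  exact Finset.prod_congr rfl fun j _ => by ring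

/-- Log-convexity of Γ between 1 and k + 1 bounds the two factors by k! to the powers 1 - c/k and
c/k. -/
lemma Gamma_mul_Gamma_le_factorial {c : ℝ} {k : ℕ} (hc : 0 < c) (hck : c < k) :
    Real.Gamma (1 + k - c) * Real.Gamma (1 + c) ≤ k.factorial := by
  have hk : (0 : ℝ) < k := hc.trans hck
  have h0 : 0 < c / k := by positivity
  have h1 : 0 < 1 - c / k := by rw [sub_pos, div_lt_one hk]; exact hck
  have hk1 : (0 : ℝ) < k + 1 := by linarith
  have a1 := Real.Gamma_mul_add_mul_le_rpow_Gamma_mul_rpow_Gamma one_pos hk1 h1 h0 (by ring)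
  have a2 := Real.Gamma_mul_add_mul_le_rpow_Gamma_mul_rpow_Gamma one_pos hk1 h0 h1 (by ring)
  rw [Real.Gamma_one, Real.one_rpow, one_mul, Real.Gamma_nat_eq_factorial] at a1 a2
  have e1 : (1 - c / k) * 1 + c / k * (k + 1) = 1 + c := by field_simp; ring
  have e2 : c / k * 1 + (1 - c / k) * (k + 1) = 1 + k - c := by field_simp; ring
  rw [e1] at a1
  rw [e2] at a2
  have hf : (0 : ℝ) < k.factorial := by exact_mod_cast k.factorial_pos
  calc _ ≤ (k.factorial : ℝ) ^ (1 - c / k) * (k.factorial : ℝ) ^ (c / k) :=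
        mul_le_mul a2 a1 (Real.Gamma_nonneg_of_nonneg (by linarith)) (by positivity)
    _ = _ := by rw [← Real.rpow_add hf, sub_add_cancel, Real.rpow_one]

/-- Keep only the part x > A of the Gamma integral, where x^c ≥ A^c. -/
lemma rpow_mul_exp_neg_le_Gamma {A c : ℝ} (hA : 0 ≤ A) (hc : 0 ≤ c) :
    A ^ c * Real.exp (-A) ≤ Real.Gamma (1 + c) := by
  have hint := Real.GammaIntegral_convergent (show 0 < 1 + c by linarith)
  rw [Real.Gamma_eq_integral (by linarith), ← integral_exp_neg_Ioi, ← integral_const_mul]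
  rw [add_sub_cancel_left] at *
  refine (setIntegral_mono_on ((integrableOn_exp_neg_Ioi A).const_mul _)
    (hint.mono_set (Ioi_subset_Ioi hA)) measurableSet_Ioi fun x hx => ?_).trans
    (setIntegral_mono_set hint ?_ (Ioi_subset_Ioi hA).eventuallyLE)
  · rw [mul_comm]
    exact mul_le_mul_of_nonneg_left (Real.rpow_le_rpow hA (le_of_lt hx) hc) (Real.exp_pos _).le
  · filter_upwards [ae_restrict_mem measurableSet_Ioi] with x (hx : 0 < x)
    exact mul_nonneg (Real.exp_pos _).le (Real.rpow_nonneg hx.le _)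

/-- The terms of the series defining `scalingDistribution`. -/
noncomputable def scalingTerm (ρ : ℝ) (n : ℕ) (x : ℝ) : ℝ :=
  (-1 : ℝ) ^ n * x ^ (((n : ℝ) + 1) * beta ρ) / ((n + 1).factorial : ℝ)
    * Real.Gamma (1 + ((n : ℝ) + 1) - ((n : ℝ) + 1) * beta ρ)
    * (Real.sin (Real.pi * ((n : ℝ) + 1) * beta ρ) / (Real.pi * ((n : ℝ) + 1) * beta ρ))

section
variable {ρ : ℝ}

lemma beta_pos (hρ : 0 < ρ) : 0 < beta ρ := by rw [beta]; positivity

lemma beta_lt_one (hρ : 0 < ρ) : beta ρ < 1 := by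
  rw [beta, div_lt_one (by linarith)]; linarith

lemma mul_beta_lt (hρ : 0 < ρ) (n : ℕ) : ((n : ℝ) + 1) * beta ρ < ((n + 1 : ℕ) : ℝ) := by
  push_cast
  exact mul_lt_of_lt_one_right (by positivity) (beta_lt_one hρ)

/-- The term is at most x^c/Γ(1+c) with c = (n+1)β. Bounding Γ from below at A = 2^(1/β) x produces
the geometric factor, because A^c = 2^(n+1) x^c. One exponential thus serves all n, and termwise
Laplace transformation is justified for w > 2^(1/β). -/
lemma abs_scalingTerm_le (hρ : 0 < ρ) (n : ℕ) {x : ℝ} (hx : 0 ≤ x) :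
    |scalingTerm ρ n x| ≤ Real.exp (2 ^ (1 / beta ρ) * x) * (1 / 2) ^ (n + 1) := by
  have hβ := beta_pos hρ
  set c := ((n : ℝ) + 1) * beta ρ with hcdef
  have hc : 0 < c := by positivity
  have hΓ : 0 < Real.Gamma (1 + c) := Real.Gamma_pos_of_pos (by linarith)
  have hf : (0 : ℝ) < (n + 1).factorial := by exact_mod_cast (n + 1).factorial_pos
  have h1 := Gamma_mul_Gamma_le_factorial hc (mul_beta_lt hρ n)
  have hc1 := mul_beta_lt hρ n
  rw [← hcdef] at hc1
  push_cast at h1 hc1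
  have hΓ2 : 0 ≤ Real.Gamma (1 + ((n : ℝ) + 1) - c) := Real.Gamma_nonneg_of_nonneg (by linarith)
  have hsin : |Real.sin (Real.pi * c) / (Real.pi * c)| ≤ 1 := by
    rw [abs_div]
    exact div_le_one_of_le₀ Real.abs_sin_le_abs (abs_nonneg _)
  have h2 : |scalingTerm ρ n x| ≤ x ^ c / Real.Gamma (1 + c) := by
    rw [scalingTerm, mul_assoc Real.pi, ← hcdef, abs_mul, abs_mul, abs_div, abs_mul, abs_pow,
      abs_neg, abs_one, one_pow, one_mul, abs_of_nonneg hΓ2, abs_of_pos hf,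
      abs_of_nonneg (Real.rpow_nonneg hx c)]
    refine (mul_le_of_le_one_right (by positivity) hsin).trans ?_
    rw [div_mul_eq_mul_div, div_le_div_iff₀ hf hΓ, mul_assoc]
    exact mul_le_mul_of_nonneg_left h1 (Real.rpow_nonneg hx c)
  refine h2.trans ?_
  set A := 2 ^ (1 / beta ρ) * x with hA
  have hA0 : 0 ≤ A := by positivity
  have h3 := rpow_mul_exp_neg_le_Gamma hA0 hc.le
  rw [div_le_iff₀ hΓ]
  have h4 : x ^ c = (1 / 2) ^ (n + 1) * A ^ c := by
    rw [hA, Real.mul_rpow (by positivity) hx, ← Real.rpow_mul (by norm_num), hcdef,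
      show 1 / beta ρ * (((n : ℝ) + 1) * beta ρ) = ((n + 1 : ℕ) : ℝ) by push_cast; field_simp,
      Real.rpow_natCast, ← mul_assoc, ← mul_pow]
    norm_num
  rw [h4]
  calc (1 / 2 : ℝ) ^ (n + 1) * A ^ c
      = Real.exp A * (1 / 2) ^ (n + 1) * (A ^ c * Real.exp (-A)) := by
        rw [Real.exp_neg]; field_simp
    _ ≤ _ := mul_le_mul_of_nonneg_left h3 (by positivity)

lemma summable_half_pow : Summable fun n : ℕ => (1 / 2 : ℝ) ^ (n + 1) :=
  (summable_nat_add_iff 1).2 summable_geometric_two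

lemma continuous_scalingTerm (hρ : 0 < ρ) (n : ℕ) : Continuous (scalingTerm ρ n) := by
  have h := Real.continuous_rpow_const (show 0 ≤ ((n : ℝ) + 1) * beta ρ from
    (mul_pos (by positivity) (beta_pos hρ)).le)
  exact (((continuous_const.mul h).div_const _).mul continuous_const).mul continuous_const

lemma summable_scalingTerm (hρ : 0 < ρ) {x : ℝ} (hx : 0 ≤ x) :
    Summable fun n => scalingTerm ρ n x :=
  Summable.of_norm_bounded (summable_half_pow.mul_left _) fun n => abs_scalingTerm_le hρ n hx

lemma continuousOn_scalingDistribution (hρ : 0 < ρ) :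
    ContinuousOn (scalingDistribution ρ) (Ici 0) := by
  intro x hx
  have h1 : ContinuousOn (scalingDistribution ρ) (Icc 0 (x + 1)) := by
    refine continuousOn_tsum (f := scalingTerm ρ)
      (u := fun n => Real.exp (2 ^ (1 / beta ρ) * (x + 1)) * (1 / 2) ^ (n + 1))
      (fun n => (continuous_scalingTerm hρ n).continuousOn) (summable_half_pow.mul_left _)
      fun n y hy => (abs_scalingTerm_le hρ n hy.1).trans ?_
    have := hy.2
    gcongr
  refine (h1 x ⟨hx, by linarith⟩).mono_of_mem_nhdsWithin ?_
  rw [← Ici_inter_Iic]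
  exact inter_mem self_mem_nhdsWithin (mem_nhdsWithin_of_mem_nhds (Iic_mem_nhds (by linarith)))

lemma abs_scalingDistribution_le (hρ : 0 < ρ) {x : ℝ} (hx : 0 ≤ x) :
    |scalingDistribution ρ x| ≤ Real.exp (2 ^ (1 / beta ρ) * x) := by
  have h1 : HasSum (fun n : ℕ => Real.exp (2 ^ (1 / beta ρ) * x) * (1 / 2 : ℝ) ^ (n + 1))
      (Real.exp (2 ^ (1 / beta ρ) * x)) := by
    have := (hasSum_geometric_two' (1 : ℝ)).mul_left (Real.exp (2 ^ (1 / beta ρ) * x))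
    rw [mul_one] at this
    refine (congrArg (fun f => HasSum f _) (funext fun n => ?_)).mpr this
    rw [div_div, ← pow_succ', one_div_pow]
  exact tsum_of_norm_bounded (f := fun n => scalingTerm ρ n x) h1
    fun n => abs_scalingTerm_le hρ n hx

lemma scalingDistribution_zero (hρ : 0 < ρ) : scalingDistribution ρ 0 = 0 := by
  have : ∀ n : ℕ, scalingTerm ρ n 0 = 0 := fun n => by
    rw [scalingTerm, Real.zero_rpow (mul_pos (by positivity) (beta_pos hρ)).ne']
    ring
  exact (tsum_congr this).trans tsum_zero

/-- The transform of x^c supplies the factor Γ(1+c) that completes the reflection identity, so the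
Gamma and sine factors collapse to a generalized binomial coefficient. -/
lemma integral_exp_mul_scalingTerm (hρ : 0 < ρ) (n : ℕ) {w : ℝ} (hw : 0 < w) :
    ∫ x in Ioi 0, Real.exp (-(w * x)) * scalingTerm ρ n x =
      -(1 / w) * (Ring.choose (((n + 1 : ℕ) : ℝ) * beta ρ - 1) (n + 1) *
        (w ^ (-beta ρ)) ^ (n + 1)) := by
  have hβ := beta_pos hρ
  set c := ((n : ℝ) + 1) * beta ρ with hcdef
  have hc : 0 < c := by positivity
  have hf : ((n + 1).factorial : ℝ) ≠ 0 := by exact_mod_cast (n + 1).factorial_ne_zero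
  have h1 := Real.integral_rpow_mul_exp_neg_mul_Ioi (show 0 < 1 + c by linarith) hw
  rw [add_sub_cancel_left] at h1
  have h2 := Gamma_mul_sinc_mul_Gamma hc (mul_beta_lt hρ n).le
  have h3 : ∀ x, Real.exp (-(w * x)) * scalingTerm ρ n x =
      ((-1) ^ n / (n + 1).factorial * (Real.Gamma (1 + ((n + 1 : ℕ) : ℝ) - c) *
        (Real.sin (Real.pi * c) / (Real.pi * c)))) * (x ^ c * Real.exp (-(w * x))) := by
    intro x
    rw [scalingTerm, mul_assoc Real.pi, ← hcdef]
    push_cast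
    ring
  simp only [h3]
  rw [integral_const_mul, h1, choose_sub_one_eq_prod]
  rw [show ((n + 1 : ℕ) : ℝ) * beta ρ = c by push_cast; rfl, ← h2]
  have h4 : (w ^ (-beta ρ)) ^ (n + 1) = (1 / w) ^ c := by
    rw [← Real.rpow_natCast, ← Real.rpow_mul hw.le, one_div, Real.inv_rpow hw.le,
      ← Real.rpow_neg hw.le]
    congr 1
    rw [hcdef]; push_cast; ring
  rw [h4, Real.rpow_add (by positivity), Real.rpow_one, pow_succ]
  ring

lemma hasSum_laplace_scalingDistribution (hρ : 0 < ρ) {w : ℝ} (hw : 2 ^ (1 / beta ρ) < w) :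
    HasSum (fun n : ℕ => Ring.choose (((n + 1 : ℕ) : ℝ) * beta ρ - 1) (n + 1) *
      (w ^ (-beta ρ)) ^ (n + 1))
      (-(∫ x in Ioi 0, w * Real.exp (-(w * x)) * scalingDistribution ρ x)) := by
  have hw0 : 0 < w := lt_trans (by positivity) hw
  have hint : IntegrableOn (fun x => Real.exp (-((w - 2 ^ (1 / beta ρ)) * x))) (Ioi 0) := by
    simpa using integrableOn_pow_mul_exp 0 (sub_pos.2 hw)
  have h1 : HasSum (fun n : ℕ => ∫ x in Ioi 0, Real.exp (-(w * x)) * scalingTerm ρ n x)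
      (∫ x in Ioi 0, Real.exp (-(w * x)) * scalingDistribution ρ x) := by
    refine hasSum_integral_of_dominated_convergence
      (fun n x => Real.exp (-((w - 2 ^ (1 / beta ρ)) * x)) * (1 / 2) ^ (n + 1)) ?_ ?_ ?_ ?_ ?_
    · intro n
      have := continuous_scalingTerm hρ n
      exact Continuous.aestronglyMeasurable (by fun_prop)
    · intro n
      filter_upwards [ae_restrict_mem measurableSet_Ioi] with x (hx : 0 < x)
      rw [norm_mul, Real.norm_of_nonneg (Real.exp_pos _).le]
      refine (mul_le_mul_of_nonneg_left (abs_scalingTerm_le hρ n hx.le)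
        (Real.exp_pos _).le).trans (le_of_eq ?_)
      rw [← mul_assoc, ← Real.exp_add]
      congr 2; ring
    · exact Eventually.of_forall fun x => summable_half_pow.mul_left _
    · simp only [tsum_mul_left]
      exact hint.mul_const _
    · filter_upwards [ae_restrict_mem measurableSet_Ioi] with x (hx : 0 < x)
      exact (summable_scalingTerm hρ hx.le).hasSum.mul_left _
  have h2 := h1.mul_left (-w)
  have h3 : ∫ x in Ioi 0, w * Real.exp (-(w * x)) * scalingDistribution ρ x =
      w * ∫ x in Ioi 0, Real.exp (-(w * x)) * scalingDistribution ρ x := by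
    rw [← integral_const_mul]
    simp only [mul_assoc]
  rw [h3, ← neg_mul]
  refine (congrArg (fun f => HasSum f _) (funext fun n => ?_)).mpr h2
  rw [integral_exp_mul_scalingTerm hρ n hw0]
  field_simp

/-- The Laplace transform of `scalingDistribution`, in parametric form. -/
theorem exists_laplace_scalingDistribution (hρ : 0 < ρ) :
    ∃ Y : ℝ, 0 < Y ∧ ∀ y, Y < y → 2 ^ (1 / beta ρ) < y + y ^ (1 + ρ) ∧
      ∫ x in Ioi 0, (y + y ^ (1 + ρ)) * Real.exp (-((y + y ^ (1 + ρ)) * x)) *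
        scalingDistribution ρ x = (1 + (1 + ρ) * y ^ ρ)⁻¹ := by
  obtain ⟨δ, hδ, H⟩ := hasSum_choose_mul_pow (beta ρ)
  have hβ := beta_pos hρ
  have t1 : Tendsto (fun y : ℝ => y + y ^ (1 + ρ)) atTop atTop :=
    tendsto_atTop_mono' _ (by
      filter_upwards [eventually_gt_atTop 0] with y hy
      have : 0 ≤ y ^ (1 + ρ) := by positivity
      simpa using this) tendsto_id
  have t2 := (tendsto_rpow_neg_atTop hβ).comp t1
  have t3 := tendsto_rpow_neg_atTop hρ
  obtain ⟨Y, hY⟩ := eventually_atTop.1 ((t1.eventually_gt_atTop (2 ^ (1 / beta ρ))).and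
    ((t2.eventually (gt_mem_nhds hδ)).and (t3.eventually (gt_mem_nhds
      (show (0 : ℝ) < 1 / 2 by norm_num)))))
  refine ⟨max Y 1, by positivity, fun y hy => ?_⟩
  obtain ⟨h1, h2, h3⟩ := hY y ((le_max_left _ _).trans hy.le)
  have hy0 : 0 < y := lt_of_lt_of_le one_pos ((le_max_right _ _).trans hy.le)
  refine ⟨h1, ?_⟩
  have hw0 : 0 < y + y ^ (1 + ρ) := by positivity
  have hyρ : 0 < y ^ ρ := by positivity
  -- With w = y + y^(1+ρ), z = w^(-β) and u = y^(-ρ), this identity yields the Lagrange equation u =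
  -- z(1+u)^β, since (1+ρ)β = ρ.
  have e1 : 1 + y ^ (-ρ) = y ^ (-(1 + ρ)) * (y + y ^ (1 + ρ)) := by
    rw [mul_add, ← Real.rpow_add hy0, neg_add_cancel, Real.rpow_zero, ← Real.rpow_add_one hy0.ne']
    rw [add_comm]; congr 2; ring
  have e2 : y ^ (-ρ) = (y + y ^ (1 + ρ)) ^ (-beta ρ) * (1 + y ^ (-ρ)) ^ beta ρ := by
    rw [e1, Real.mul_rpow (by positivity) hw0.le, mul_left_comm, ← Real.rpow_add hw0,
      neg_add_cancel, Real.rpow_zero, mul_one, ← Real.rpow_mul hy0.le]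
    congr 1
    rw [beta]; field_simp
  have h4 := H ((y + y ^ (1 + ρ)) ^ (-beta ρ)) (y ^ (-ρ)) (by positivity) h2 (by positivity) h3 e2
  -- The series for M_ρ begins at k = 1, so the term 1 at k = 0 is split off.
  have h5 := ((hasSum_nat_add_iff' 1).2 h4).unique (hasSum_laplace_scalingDistribution hρ h1)
  simp only [Finset.sum_range_one, Ring.choose_zero_right, pow_zero, mul_one] at h5
  have h6 : (1 + (1 - beta ρ) * y ^ (-ρ))⁻¹ = 1 - (1 + (1 + ρ) * y ^ ρ)⁻¹ := by
    have : 1 - beta ρ = (1 + ρ)⁻¹ := by rw [beta]; field_simp; ring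
    rw [this, Real.rpow_neg hy0.le]
    field_simp
    ring
  rw [h6] at h5
  linarith

end

/-! ### Uniqueness and identification of the limit law -/

/-- Uniqueness for Laplace transforms: vanishing at all natural numbers suffices. -/
theorem ae_eq_zero_of_laplace_eq_zero {G : ℝ → ℝ} (hG : IntegrableOn G (Ioi 0))
    (h : ∀ n : ℕ, ∫ x in Ioi 0, Real.exp (-(n * x)) * G x = 0) :
    ∀ᵐ x : ℝ, x ∈ Ioi 0 → G x = 0 := by
  have hexp : ∀ (f : ℝ → ℝ), (∀ x ∈ Ioi (0 : ℝ), |f x| ≤ 1) → Measurable f →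
      IntegrableOn (fun x => f x * G x) (Ioi 0) := fun f hf hfm =>
    Integrable.bdd_mul hG hfm.aestronglyMeasurable
      ((ae_restrict_mem measurableSet_Ioi).mono fun x hx => hf x hx)
  have hmono : ∀ n : ℕ, IntegrableOn (fun x => Real.exp (-x) ^ n * G x) (Ioi 0) := fun n =>
    hexp (fun x => Real.exp (-x) ^ n) (fun x (hx : 0 < x) => by
      rw [abs_of_nonneg (by positivity)]
      exact pow_le_one₀ (Real.exp_pos _).le (Real.exp_le_one_iff.2 (by linarith))) (by fun_prop)
  have hpoly : ∀ p : Polynomial ℝ, IntegrableOn (fun x => p.eval (Real.exp (-x)) * G x) (Ioi 0) ∧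
      ∫ x in Ioi 0, p.eval (Real.exp (-x)) * G x = 0 := by
    intro p
    induction p using Polynomial.induction_on' with
    | add p q hp hq =>
      simp only [Polynomial.eval_add, add_mul]
      exact ⟨hp.1.add hq.1, by rw [integral_add hp.1 hq.1, hp.2, hq.2, add_zero]⟩
    | monomial n a =>
      simp only [Polynomial.eval_monomial, mul_assoc]
      refine ⟨(hmono n).const_mul a, ?_⟩
      rw [integral_const_mul]
      have : ∫ x in Ioi 0, Real.exp (-x) ^ n * G x = 0 := by
        simpa only [← Real.exp_nat_mul, mul_neg] using h n
      rw [this, mul_zero]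
  refine isOpen_Ioi.ae_eq_zero_of_integral_contDiff_smul_eq_zero hG.locallyIntegrableOn ?_
  intro g hg hgc hgs
  have hg0 : ∀ x, x ≤ 0 → g x = 0 := fun x hx =>
    image_eq_zero_of_notMem_tsupport fun hx' => not_lt.2 hx (hgs hx')
  obtain ⟨B, hB⟩ : ∃ B : ℝ, ∀ x, B < x → g x = 0 := by
    obtain ⟨B, hB⟩ := hgc.isCompact.bddAbove
    exact ⟨B, fun x hx => image_eq_zero_of_notMem_tsupport fun hx' => not_lt.2 (hB hx') hx⟩
  -- In the variable u = e^{-x} the test function is continuous up to u = 0, since g vanishes for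
  -- large x; at u = 0 the default log 0 = 0 gives g(0) = 0, as required. Weierstrass approximation
  -- then applies.
  have hfc : ContinuousOn (fun u => g (-Real.log u)) (Icc 0 1) := by
    intro u hu
    refine ContinuousAt.continuousWithinAt ?_
    rcases eq_or_ne u 0 with rfl | hu0
    · have : (fun u => g (-Real.log u)) =ᶠ[𝓝 0] fun _ => 0 := by
        filter_upwards [Ioo_mem_nhds (neg_lt_zero.2 (Real.exp_pos (-B))) (Real.exp_pos (-B))]
          with v hv
        rcases eq_or_ne v 0 with rfl | hv0
        · rw [Real.log_zero, neg_zero, hg0 0 le_rfl]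
        · refine hB _ ?_
          rw [← Real.log_abs, lt_neg, Real.log_lt_iff_lt_exp (abs_pos.2 hv0)]
          exact abs_lt.2 hv
      exact continuousAt_const.congr this.symm
    · exact hg.continuous.continuousAt.comp (Real.continuousAt_log hu0).neg
  have hgi : ∫ x, g x • G x = ∫ x in Ioi 0, g x * G x := by
    rw [← integral_indicator measurableSet_Ioi]
    refine integral_congr_ae (Eventually.of_forall fun x => ?_)
    dsimp only
    by_cases hx : x ∈ Ioi (0 : ℝ)
    · rw [indicator_of_mem hx, smul_eq_mul]
    · rw [indicator_of_notMem hx, hg0 x (not_lt.1 hx), zero_smul]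
  rw [hgi]
  obtain ⟨K, hK⟩ := hg.continuous.bounded_above_of_compact_support hgc
  have hgint : IntegrableOn (fun x => g x * G x) (Ioi 0) :=
    Integrable.bdd_mul hG hg.continuous.aestronglyMeasurable (Eventually.of_forall hK)
  rw [← abs_nonpos_iff]
  refine le_of_forall_pos_le_add fun ε hε => ?_
  set N := ∫ x in Ioi 0, |G x| with hN
  have hN0 : 0 ≤ N := integral_nonneg fun x => abs_nonneg _
  obtain ⟨p, hp⟩ := exists_polynomial_near_of_continuousOn 0 1 _ hfc (ε / (N + 1)) (by positivity)
  have h1 : ∫ x in Ioi 0, g x * G x =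
      ∫ x in Ioi 0, (g x * G x - p.eval (Real.exp (-x)) * G x) := by
    rw [integral_sub hgint (hpoly p).1, (hpoly p).2, sub_zero]
  rw [h1, zero_add]
  calc ‖∫ x in Ioi 0, (g x * G x - p.eval (Real.exp (-x)) * G x)‖
      ≤ ∫ x in Ioi 0, ε / (N + 1) * |G x| := by
        refine norm_integral_le_of_norm_le (hG.abs.const_mul _) ?_
        filter_upwards [ae_restrict_mem measurableSet_Ioi] with x (hx : 0 < x)
        rw [← sub_mul, norm_mul]
        refine mul_le_mul_of_nonneg_right ?_ (abs_nonneg _)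
        have := hp (Real.exp (-x)) ⟨(Real.exp_pos _).le, Real.exp_le_one_iff.2 (by linarith)⟩
        rw [Real.log_exp, neg_neg, abs_sub_comm] at this
        exact this.le
    _ = ε / (N + 1) * N := integral_const_mul _ _
    _ ≤ ε := by
        rw [div_mul_eq_mul_div, div_le_iff₀ (by positivity)]
        nlinarith

section
variable {P : Measure ℝ} [IsProbabilityMeasure P] {ρ : ℝ}

/-- The probability measure on `[0, ∞)` with the given Laplace transform has distribution
function `scalingDistribution ρ`. -/
theorem real_Iic_eq_scalingDistribution (hP : P (Iio 0) = 0) (hρ : 0 < ρ)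
    (hlap : ∀ y, 0 < y → lap P (y + y ^ (1 + ρ)) = (1 + (1 + ρ) * y ^ ρ)⁻¹) {x : ℝ} (hx : 0 ≤ x) :
    P.real (Iic x) = scalingDistribution ρ x := by
  obtain ⟨Y, hY, H⟩ := exists_laplace_scalingDistribution hρ
  set B : ℝ := 2 ^ (1 / beta ρ) with hB
  set w₀ : ℝ := max (B + 1) (Y + Y ^ (1 + ρ) + 1) with hw₀
  have hBpos : 0 < B := by positivity
  have hw₀B : B < w₀ := lt_of_lt_of_le (by linarith) (le_max_left _ _)
  have hw₀Y : Y + Y ^ (1 + ρ) < w₀ := lt_of_lt_of_le (by linarith) (le_max_right _ _)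
  have hw₀0 : 0 < w₀ := hBpos.trans hw₀B
  have hmeasF : Measurable fun x => P.real (Iic x) :=
    Monotone.measurable fun x y hxy => measureReal_mono (Iic_subset_Iic.2 hxy)
  have hmeasM : AEStronglyMeasurable (scalingDistribution ρ) (volume.restrict (Ioi 0)) :=
    ((continuousOn_scalingDistribution hρ).mono Ioi_subset_Ici_self).aestronglyMeasurable
      measurableSet_Ioi
  have hFint : ∀ w, B < w → IntegrableOn (fun x => Real.exp (-(w * x)) * P.real (Iic x)) (Ioi 0) := by
    intro w hw
    have h1 : IntegrableOn (fun x => Real.exp (-(w * x))) (Ioi 0) := by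
      simpa using integrableOn_pow_mul_exp 0 (hBpos.trans hw)
    refine Integrable.mono' h1 ((by fun_prop : Continuous fun x : ℝ =>
      Real.exp (-(w * x))).aestronglyMeasurable.mul hmeasF.aestronglyMeasurable)
      (Eventually.of_forall fun x => ?_)
    rw [norm_mul, Real.norm_of_nonneg (Real.exp_pos _).le, Real.norm_of_nonneg (by positivity)]
    exact mul_le_of_le_one_right (Real.exp_pos _).le measureReal_le_one
  have hMint : ∀ w, B < w →
      IntegrableOn (fun x => Real.exp (-(w * x)) * scalingDistribution ρ x) (Ioi 0) := by
    intro w hw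
    have h1 : IntegrableOn (fun x => Real.exp (-((w - B) * x))) (Ioi 0) := by
      simpa using integrableOn_pow_mul_exp 0 (sub_pos.2 hw)
    refine Integrable.mono' h1 ((by fun_prop : Continuous fun x : ℝ =>
      Real.exp (-(w * x))).aestronglyMeasurable.mul hmeasM) ?_
    filter_upwards [ae_restrict_mem measurableSet_Ioi] with x (hx : 0 < x)
    rw [norm_mul, Real.norm_of_nonneg (Real.exp_pos _).le]
    refine (mul_le_mul_of_nonneg_left (abs_scalingDistribution_le hρ hx.le)
      (Real.exp_pos _).le).trans (le_of_eq ?_)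
    rw [← Real.exp_add]; congr 1; ring
  have heq : ∀ w, w₀ ≤ w → ∫ x in Ioi 0, Real.exp (-(w * x)) * P.real (Iic x) =
      ∫ x in Ioi 0, Real.exp (-(w * x)) * scalingDistribution ρ x := by
    intro w hw
    have hw0 : 0 < w := hw₀0.trans_le hw
    obtain ⟨y, hy0, -, hyw⟩ := exists_add_rpow_eq hρ hw0
    have hYy : Y < y := by
      refine ((strictMonoOn_add_rpow hρ).lt_iff_lt hY.le hy0.le).1 ?_
      rw [hyw]
      exact hw₀Y.trans_le hw
    have h1 := (H y hYy).2
    rw [← hlap y hy0, hyw, lap_eq_integral hP hw0] at h1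
    simp only [mul_assoc] at h1
    rw [integral_const_mul, integral_const_mul] at h1
    exact (mul_left_cancel₀ hw0.ne' h1).symm
  -- The transforms agree only from w₀ on, so the weight e^{-w₀ x} is put into G, and the arguments
  -- w₀ + n suffice. The weight also makes M_ρ integrable.
  have hae := ae_eq_zero_of_laplace_eq_zero
    (G := fun x => Real.exp (-(w₀ * x)) * (P.real (Iic x) - scalingDistribution ρ x))
    (by
      simp only [mul_sub]
      exact (hFint w₀ hw₀B).sub (hMint w₀ hw₀B)) (fun n => by
      have hwn : w₀ ≤ w₀ + n := by simp
      have h1 : ∀ x : ℝ, Real.exp (-(n * x)) * (Real.exp (-(w₀ * x)) *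
          (P.real (Iic x) - scalingDistribution ρ x)) =
          Real.exp (-((w₀ + n) * x)) * P.real (Iic x) -
          Real.exp (-((w₀ + n) * x)) * scalingDistribution ρ x := by
        intro x
        rw [← mul_assoc, ← Real.exp_add, mul_sub, show -((n : ℝ) * x) + -(w₀ * x) =
          -((w₀ + n) * x) by ring]
      simp only [h1]
      rw [integral_sub (hFint _ (hw₀B.trans_le hwn)) (hMint _ (hw₀B.trans_le hwn)), heq _ hwn,
        sub_self])
  -- Almost everywhere equality gives points of equality arbitrarily close on the right of x; right
  -- continuity of both functions carries it to x.
  have hfreq : ∃ᶠ z in 𝓝[>] x, P.real (Iic z) - scalingDistribution ρ z = 0 := by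
    intro hev
    obtain ⟨b, hb, hsub⟩ := (mem_nhdsGT_iff_exists_Ioo_subset).1 hev
    have h1 : volume (Ioo x b) = 0 := by
      refine measure_mono_null ?_ hae
      intro z hz
      simp only [mem_compl_iff, Set.mem_ofPred_eq, not_forall]
      refine ⟨hx.trans_lt hz.1, fun h0 => hsub hz ?_⟩
      exact (mul_eq_zero.1 h0).resolve_left (Real.exp_pos _).ne'
    rw [Real.volume_Ioo, ENNReal.ofReal_eq_zero] at h1
    linarith [mem_Ioi.1 hb]
  have hlim : Tendsto (fun z => P.real (Iic z) - scalingDistribution ρ z) (𝓝[>] x)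
      (𝓝 (P.real (Iic x) - scalingDistribution ρ x)) := by
    refine Tendsto.sub ?_ ?_
    · have := ((cdf P).right_continuous x).tendsto.mono_left (nhdsWithin_mono _ Ioi_subset_Ici_self)
      have h2 : ⇑(cdf P) = fun z => P.real (Iic z) := funext fun z => cdf_eq_real P z
      rwa [h2] at this
    · exact ((continuousOn_scalingDistribution hρ) x hx).tendsto.mono_left
        (nhdsWithin_mono _ fun z hz => hx.trans (le_of_lt hz))
  by_contra hne
  exact hfreq (hlim.eventually_ne (sub_ne_zero.2 hne))

/-- The distribution function is the continuous function M_ρ, and M_ρ(0) = 0 also excludes an atom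
at 0. Hence convergence holds at every x. -/
lemma measure_singleton_eq_zero (hP : P (Iio 0) = 0) (hρ : 0 < ρ)
    (hlap : ∀ y, 0 < y → lap P (y + y ^ (1 + ρ)) = (1 + (1 + ρ) * y ^ ρ)⁻¹) {a : ℝ} (ha : 0 ≤ a) :
    P {a} = 0 := by
  have hF := fun {x : ℝ} (hx : 0 ≤ x) => real_Iic_eq_scalingDistribution hP hρ hlap hx
  rcases ha.eq_or_lt with rfl | ha
  · have h1 := hF le_rfl
    rw [scalingDistribution_zero hρ, measureReal_eq_zero_iff] at h1
    exact measure_mono_null (by simp) h1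
  · have h1 : Tendsto (scalingDistribution ρ) (𝓝[<] a) (𝓝 (scalingDistribution ρ a)) :=
      (((continuousOn_scalingDistribution hρ).continuousAt (Ici_mem_nhds ha)).tendsto).mono_left
        nhdsWithin_le_nhds
    have h2 : ∀ᶠ z in 𝓝[<] a,
        P.real {a} ≤ scalingDistribution ρ a - scalingDistribution ρ z := by
      filter_upwards [Ioo_mem_nhdsLT ha] with z hz
      rw [← hF ha.le, ← hF hz.1.le]
      have h3 : P.real {a} + P.real (Iic z) ≤ P.real (Iic a) := by
        rw [← measureReal_union (by simpa using hz.2) measurableSet_Iic]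
        exact measureReal_mono (union_subset (by simp) (Iic_subset_Iic.2 hz.2.le))
      linarith
    have h3 := ge_of_tendsto (h1.const_sub (scalingDistribution ρ a)) h2
    rw [sub_self] at h3
    exact (measureReal_eq_zero_iff).1 (le_antisymm h3 (by positivity))

/-- The given transform is the reciprocal of the derivative of y + y^(1+ρ), so the composite has
derivative 1 and value 0 at 0. -/
lemma bern_add_rpow (hP : P (Iio 0) = 0) (hρ : 0 < ρ)
    (hlap : ∀ y, 0 < y → lap P (y + y ^ (1 + ρ)) = (1 + (1 + ρ) * y ^ ρ)⁻¹) {y : ℝ} (hy : 0 ≤ y) :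
    bern P (y + y ^ (1 + ρ)) = y := by
  have hk : Continuous fun y : ℝ => y + y ^ (1 + ρ) :=
    continuous_id.add (Real.continuous_rpow_const (by linarith))
  have hc : ContinuousOn (fun y : ℝ => bern P (y + y ^ (1 + ρ)) - y) (Icc 0 y) := by
    refine ContinuousOn.sub ((continuousOn_bern hP).comp hk.continuousOn fun z hz => ?_)
      continuousOn_id
    have := Real.rpow_nonneg hz.1 (1 + ρ)
    exact add_nonneg hz.1 this
  have hd : ∀ z ∈ Ioo 0 y, HasDerivAt (fun y : ℝ => bern P (y + y ^ (1 + ρ)) - y) 0 z := by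
    intro z hz
    have hz0 := hz.1
    have hw0 : 0 < z + z ^ (1 + ρ) := by positivity
    have h1 := (hasDerivAt_id z).add (Real.hasDerivAt_rpow_const (p := 1 + ρ) (Or.inl hz0.ne'))
    have h2 := ((hasDerivAt_bern hP hw0).comp z h1).sub (hasDerivAt_id z)
    rw [hlap z hz0, add_sub_cancel_left, inv_mul_cancel₀ (by positivity), sub_self] at h2
    exact h2
  rcases hy.eq_or_lt with rfl | hy
  · rw [Real.zero_rpow (by linarith), add_zero, bern_zero]
  · obtain ⟨z, hz, hz'⟩ := exists_hasDerivAt_eq_slope _ _ hy hc hd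
    rw [eq_comm, div_eq_zero_iff] at hz'
    have h3 := hz'.resolve_right (by linarith)
    simp only [Real.zero_rpow (show 1 + ρ ≠ 0 by linarith), add_zero, bern_zero, sub_zero] at h3
    linarith

end

/-! ### The scaling solution: moments and exponential test functions -/

/-- The measure `x⁻² m(dx)`. -/
noncomputable def unsm (m : Measure ℝ) : Measure ℝ :=
  m.withDensity fun x => ENNReal.ofReal ((x ^ 2)⁻¹)

section
variable {m : Measure ℝ}

lemma unsm_Iic (hm : m (Iic 0) = 0) : unsm m (Iic 0) = 0 :=
  withDensity_absolutelyContinuous _ _ hm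

lemma sm_unsm (hm : m (Iic 0) = 0) : sm (unsm m) = m := by
  rw [sm, unsm, ← withDensity_mul _ (by fun_prop) (by fun_prop)]
  conv_rhs => rw [← withDensity_one (μ := m)]
  refine withDensity_congr_ae ?_
  filter_upwards [ae_pos_of_null hm] with x hx
  rw [Pi.mul_apply, Pi.one_apply, ← ENNReal.ofReal_mul (by positivity),
    inv_mul_cancel₀ (by positivity), ENNReal.ofReal_one]

lemma isRadonPos_unsm [IsFiniteMeasure m] (hm : m (Iic 0) = 0) : IsRadonPos (unsm m) := by
  refine ⟨unsm_Iic hm, fun B hB hB0 => ?_⟩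
  rcases B.eq_empty_or_nonempty with rfl | hne
  · simp
  obtain ⟨a, haB, ha⟩ := hB.exists_isLeast hne
  have ha0 : 0 < a := hB0 haB
  rw [unsm, withDensity_apply _ hB.measurableSet]
  calc ∫⁻ x in B, ENNReal.ofReal ((x ^ 2)⁻¹) ∂m
      ≤ ∫⁻ _ in B, ENNReal.ofReal ((a ^ 2)⁻¹) ∂m := by
        refine setLIntegral_mono measurable_const fun x hx => ENNReal.ofReal_le_ofReal ?_
        have := ha hx
        gcongr
    _ = ENNReal.ofReal ((a ^ 2)⁻¹) * m B := by rw [setLIntegral_const]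
    _ < ∞ := ENNReal.mul_lt_top ENNReal.ofReal_lt_top (measure_lt_top _ _)

instance [SFinite m] : SFinite (unsm m) := by unfold unsm; infer_instance

end

/-- The function `e^{-sx} - 1 + sx`. -/
noncomputable def expTaylor (s x : ℝ) : ℝ := Real.exp (-(s * x)) - 1 + s * x

lemma continuous_expTaylor (s : ℝ) : Continuous (expTaylor s) := by
  unfold expTaylor; fun_prop

lemma expTaylor_eq_integral (s x : ℝ) :
    expTaylor s x = ∫ r in (0 : ℝ)..s, x * (1 - Real.exp (-(r * x))) := by
  have h : ∀ r ∈ uIcc 0 s, HasDerivAt (fun r => expTaylor r x) (x * (1 - Real.exp (-(r * x)))) r := by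
    intro r _
    have h1 := ((hasDerivAt_mul_const (x := r) x).neg.exp.sub_const 1).add
      (hasDerivAt_mul_const (x := r) x)
    refine h1.congr_deriv ?_
    rw [Pi.neg_apply]
    ring
  rw [intervalIntegral.integral_eq_sub_of_hasDerivAt h
    (Continuous.intervalIntegrable (by fun_prop) _ _)]
  simp [expTaylor]

lemma integral_expTaylor {μ : Measure ℝ} [SFinite μ] (h0 : μ (Iic 0) = 0) (h : secondMoment μ < ∞)
    {s : ℝ} (hs : 0 ≤ s) : ∫ x, expTaylor s x ∂μ = ∫ r in (0 : ℝ)..s, bern (sm μ) r := by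
  have h1 : ∫ r in (0 : ℝ)..s, bern (sm μ) r =
      ∫ r in (0 : ℝ)..s, (∫ x, x * (1 - Real.exp (-(r * x))) ∂μ) := by
    refine intervalIntegral.integral_congr fun r hr => ?_
    rw [uIcc_of_le hs] at hr
    exact bern_sm h0 h hr.1
  rw [h1, intervalIntegral_integral_swap]
  · simp only [← expTaylor_eq_integral]
  · rw [uIoc_of_le hs]
    have h2 : Integrable (fun z : ℝ × ℝ => s * z.2 ^ 2) ((volume.restrict (Ioc 0 s)).prod μ) := by
      have := (integrable_const (μ := volume.restrict (Ioc 0 s)) s).mul_prod (integrable_sq h)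
      exact this
    refine Integrable.mono' h2 (by fun_prop : Continuous fun z : ℝ × ℝ =>
      z.2 * (1 - Real.exp (-(z.1 * z.2)))).aestronglyMeasurable ?_
    have h3 : ∀ᵐ z ∂((volume.restrict (Ioc 0 s)).prod μ), z.1 ∈ Ioc 0 s ∧ 0 < z.2 := by
      refine Measure.ae_prod_iff_ae_ae ?_ |>.2 ?_
      · exact (measurableSet_Ioc.preimage measurable_fst).inter
          (measurableSet_Ioi.preimage measurable_snd)
      · filter_upwards [ae_restrict_mem measurableSet_Ioc] with r hr
        filter_upwards [ae_pos_of_null h0] with x hx using ⟨hr, hx⟩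
    filter_upwards [h3] with z ⟨hz1, hz2⟩
    have h4 := one_sub_exp_nonneg hz1.1.le hz2.le
    have h5 := one_sub_exp_le z.1 z.2
    have h6 : z.1 * z.2 ≤ s * z.2 := mul_le_mul_of_nonneg_right hz1.2 hz2.le
    rw [Function.uncurry_def, Real.norm_of_nonneg (mul_nonneg hz2.le h4)]
    nlinarith

/-- The linear part cancels and the rest factorizes into (1 - e^{-sx})(1 - e^{-sy}), so a single
square appears. -/
lemma coagulation_expTaylor {μ : Measure ℝ} (h0 : μ (Iic 0) = 0) (h : secondMoment μ < ∞)
    {s : ℝ} (hs : 0 ≤ s) : coagulation (expTaylor s) μ = 1 / 2 * bern (sm μ) s ^ 2 := by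
  have h1 : ∀ x y : ℝ, (expTaylor s (x + y) - expTaylor s x - expTaylor s y) * (x * y) =
      x * (1 - Real.exp (-(s * x))) * (y * (1 - Real.exp (-(s * y)))) := by
    intro x y
    have : Real.exp (-(s * (x + y))) = Real.exp (-(s * x)) * Real.exp (-(s * y)) := by
      rw [← Real.exp_add]; congr 1; ring
    simp only [expTaylor, this]
    ring
  simp only [coagulation, h1]
  simp only [integral_const_mul, integral_mul_const]
  rw [bern_sm h0 h hs]
  ring

/-- The candidate for the scaling solution. -/
noncomputable def scalingMeasure (ρ : ℝ) (P : Measure ℝ) (t : ℝ) : Measure ℝ :=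
  unsm (ENNReal.ofReal ((1 - t)⁻¹) • P.map (((1 - t) ^ (1 / beta ρ))⁻¹ * ·))

lemma smul_map_Iic {P : Measure ℝ} {ρ t : ℝ} (hP : P (Iic 0) = 0) (ht : t < 1) : (ENNReal.ofReal ((1 - t)⁻¹) •
    P.map (((1 - t) ^ (1 / beta ρ))⁻¹ * ·)) (Iic 0) = 0 := by
  have hc : 0 < ((1 - t) ^ (1 / beta ρ))⁻¹ := inv_pos.2 (Real.rpow_pos_of_pos (by linarith) _)
  rw [Measure.smul_apply, Measure.map_apply (by fun_prop) measurableSet_Iic]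
  have : (((1 - t) ^ (1 / beta ρ))⁻¹ * ·) ⁻¹' Iic 0 = Iic (0 : ℝ) := by
    ext x
    simp only [mem_preimage, mem_Iic]
    exact ⟨fun h => le_of_mul_le_mul_left (by rwa [mul_zero]) hc,
      fun h => mul_nonpos_of_nonneg_of_nonpos hc.le h⟩
  rw [this, hP, smul_zero]

section
variable {P : Measure ℝ} [IsProbabilityMeasure P] {ρ t : ℝ}

instance : SFinite (scalingMeasure ρ P t) := by unfold scalingMeasure; infer_instance

instance : IsFiniteMeasure (ENNReal.ofReal ((1 - t)⁻¹) •
    P.map (((1 - t) ^ (1 / beta ρ))⁻¹ * ·)) := by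
  refine ⟨?_⟩
  rw [Measure.smul_apply, smul_eq_mul]
  exact ENNReal.mul_lt_top ENNReal.ofReal_lt_top (measure_lt_top _ _)

omit [IsProbabilityMeasure P] in
lemma sm_scalingMeasure (hP : P (Iic 0) = 0) (ht : t < 1) : sm (scalingMeasure ρ P t) =
    ENNReal.ofReal ((1 - t)⁻¹) • P.map (((1 - t) ^ (1 / beta ρ))⁻¹ * ·) :=
  sm_unsm (smul_map_Iic hP ht)

lemma isRadonPos_scalingMeasure (hP : P (Iic 0) = 0) (ht : t < 1) :
    IsRadonPos (scalingMeasure ρ P t) :=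
  isRadonPos_unsm (smul_map_Iic hP ht)

lemma secondMoment_scalingMeasure (hP : P (Iic 0) = 0) (ht : t < 1) :
    secondMoment (scalingMeasure ρ P t) = ENNReal.ofReal ((1 - t)⁻¹) := by
  rw [← sm_univ, sm_scalingMeasure hP ht, Measure.smul_apply,
    Measure.map_apply (by fun_prop) MeasurableSet.univ, preimage_univ, measure_univ, smul_eq_mul,
    mul_one]

lemma secondMomentDistribution_scalingMeasure (hP : P (Iic 0) = 0) (ht : t < 1) (x : ℝ) :
    secondMomentDistribution (scalingMeasure ρ P t) x =
      P.real (Iic ((1 - t) ^ (1 / beta ρ) * x)) := by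
  have h1 : 0 < 1 - t := by linarith
  have hc : 0 < (1 - t) ^ (1 / beta ρ) := Real.rpow_pos_of_pos h1 _
  rw [secondMomentDistribution_eq (isRadonPos_scalingMeasure hP ht).null_nonpos,
    measureReal_def, measureReal_def, sm_univ, secondMoment_scalingMeasure hP ht,
    ← measureReal_def, sm_scalingMeasure hP ht, measureReal_ennreal_smul_apply,
    ENNReal.toReal_ofReal (by positivity), map_mul_real_Iic hc,
    mul_div_cancel_left₀ _ (by positivity)]

lemma bern_smul (m : Measure ℝ) (c : ℝ≥0∞) (s : ℝ) : bern (c • m) s = c.toReal * bern m s := by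
  have : lap (c • m) = fun s => c.toReal * lap m s := by
    ext s; rw [lap, integral_smul_measure, smul_eq_mul]; rfl
  rw [bern, this, intervalIntegral.integral_const_mul]
  rfl

omit [IsProbabilityMeasure P] in
lemma bern_sm_scalingMeasure (hP : P (Iic 0) = 0) (ht : t < 1) (s : ℝ) :
    bern (sm (scalingMeasure ρ P t)) s =
      (1 - t) ^ (1 / beta ρ - 1) * bern P ((1 - t) ^ (-(1 / beta ρ)) * s) := by
  have h1 : 0 < 1 - t := by linarith
  have hc : 0 < (1 - t) ^ (1 / beta ρ) := Real.rpow_pos_of_pos h1 _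
  rw [sm_scalingMeasure hP ht, bern_smul, bern_map_mul (inv_pos.2 hc).ne', inv_inv,
    ENNReal.toReal_ofReal (by positivity), Real.rpow_sub_one h1.ne', Real.rpow_neg h1.le]
  field_simp

lemma measurable_scalingMeasure (ρ : ℝ) (P : Measure ℝ) [IsProbabilityMeasure P] {B : Set ℝ}
    (hB : MeasurableSet B) : Measurable fun t => scalingMeasure ρ P t B := by
  have h1 : ∀ t, scalingMeasure ρ P t B = ENNReal.ofReal ((1 - t)⁻¹) *
      ∫⁻ x, B.indicator (fun x => ENNReal.ofReal ((x ^ 2)⁻¹))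
        (((1 - t) ^ (1 / beta ρ))⁻¹ * x) ∂P := by
    intro t
    rw [scalingMeasure, unsm, withDensity_apply _ hB, ← lintegral_indicator hB,
      lintegral_smul_measure, lintegral_map (Measurable.indicator (by fun_prop) hB) (by fun_prop),
      smul_eq_mul]
  simp only [h1]
  refine Measurable.mul (by fun_prop) ?_
  refine Measurable.lintegral_prod_right' (f := fun z : ℝ × ℝ =>
    B.indicator (fun x => ENNReal.ofReal ((x ^ 2)⁻¹)) (((1 - z.1) ^ (1 / beta ρ))⁻¹ * z.2)) ?_
  exact (Measurable.indicator (by fun_prop) hB).comp (by fun_prop)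

/-- The primitive of `bern P` in parametric form. -/
lemma integral_bern_add_rpow (hP : P (Iio 0) = 0) (hρ : 0 < ρ)
    (hlap : ∀ y, 0 < y → lap P (y + y ^ (1 + ρ)) = (1 + (1 + ρ) * y ^ ρ)⁻¹) {y : ℝ} (hy : 0 ≤ y) :
    ∫ u in (0 : ℝ)..(y + y ^ (1 + ρ)), bern P u =
      y ^ 2 / 2 + (1 + ρ) / (2 + ρ) * y ^ (2 + ρ) := by
  have hk : Continuous fun y : ℝ => y + y ^ (1 + ρ) :=
    continuous_id.add (Real.continuous_rpow_const (by linarith))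
  have hk0 : ∀ z : ℝ, 0 ≤ z → 0 ≤ z + z ^ (1 + ρ) := fun z hz =>
    add_nonneg hz (Real.rpow_nonneg hz _)
  have hbc := continuousOn_bern hP
  have hii : ∀ a : ℝ, 0 ≤ a → IntervalIntegrable (bern P) volume 0 a := fun a ha =>
    (hbc.mono (by rw [uIcc_of_le ha]; exact Icc_subset_Ici_self)).intervalIntegrable
  have hB : ContinuousOn (fun a => ∫ u in (0 : ℝ)..a, bern P u) (Ici 0) := by
    intro a ha
    have h1 : ContinuousOn (fun a => ∫ u in (0 : ℝ)..a, bern P u) (uIcc 0 (a + 1)) := by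
      refine intervalIntegral.continuousOn_primitive_interval ?_
      rw [uIcc_of_le (add_nonneg ha zero_le_one)]
      exact (hbc.mono Icc_subset_Ici_self).integrableOn_Icc
    rw [uIcc_of_le (add_nonneg ha zero_le_one)] at h1
    refine (h1 a ⟨ha, by linarith⟩).mono_of_mem_nhdsWithin ?_
    rw [← Ici_inter_Iic]
    exact inter_mem self_mem_nhdsWithin (mem_nhdsWithin_of_mem_nhds (Iic_mem_nhds (by linarith)))
  have hc : ContinuousOn (fun y : ℝ => (∫ u in (0 : ℝ)..(y + y ^ (1 + ρ)), bern P u) -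
      (y ^ 2 / 2 + (1 + ρ) / (2 + ρ) * y ^ (2 + ρ))) (Icc 0 y) := by
    refine ContinuousOn.sub (hB.comp hk.continuousOn fun z hz => hk0 z hz.1) ?_
    have := Real.continuous_rpow_const (show 0 ≤ 2 + ρ by linarith)
    fun_prop
  have hd : ∀ z ∈ Ioo 0 y, HasDerivAt (fun y : ℝ => (∫ u in (0 : ℝ)..(y + y ^ (1 + ρ)), bern P u) -
      (y ^ 2 / 2 + (1 + ρ) / (2 + ρ) * y ^ (2 + ρ))) 0 z := by
    intro z hz
    have hz0 := hz.1
    have hw0 : 0 < z + z ^ (1 + ρ) := by positivity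
    have h1 := (hasDerivAt_id z).add (Real.hasDerivAt_rpow_const (p := 1 + ρ) (Or.inl hz0.ne'))
    have h2 : HasDerivAt (fun a => ∫ u in (0 : ℝ)..a, bern P u) (bern P (z + z ^ (1 + ρ)))
        (z + z ^ (1 + ρ)) := by
      refine intervalIntegral.integral_hasDerivAt_right (hii _ hw0.le) ?_
        (hbc.continuousAt (Ici_mem_nhds hw0))
      exact (hbc.mono Ioi_subset_Ici_self).stronglyMeasurableAtFilter isOpen_Ioi _ hw0
    have h3 := (h2.comp z h1).sub (((hasDerivAt_pow 2 z).div_const 2).add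
      ((Real.hasDerivAt_rpow_const (p := 2 + ρ) (Or.inl hz0.ne')).const_mul ((1 + ρ) / (2 + ρ))))
    refine h3.congr_deriv ?_
    rw [bern_add_rpow hP hρ hlap hz0.le]
    have e1 : z ^ (2 + ρ - 1) = z * z ^ ρ := by
      rw [show 2 + ρ - 1 = 1 + ρ by ring, Real.rpow_add hz0, Real.rpow_one]
    rw [e1, add_sub_cancel_left]
    field_simp
    ring
  rcases hy.eq_or_lt with rfl | hy
  · simp [Real.zero_rpow (show 1 + ρ ≠ 0 by linarith), Real.zero_rpow (show 2 + ρ ≠ 0 by linarith)]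
  · obtain ⟨z, hz, hz'⟩ := exists_hasDerivAt_eq_slope _ _ hy hc hd
    rw [eq_comm, div_eq_zero_iff] at hz'
    have h3 := hz'.resolve_right (by linarith)
    simp only [Real.zero_rpow (show 1 + ρ ≠ 0 by linarith),
      Real.zero_rpow (show 2 + ρ ≠ 0 by linarith), add_zero, intervalIntegral.integral_same] at h3
    linarith

lemma continuousOn_bern_sm_scalingMeasure (hP : P (Iic 0) = 0) {s : ℝ} (hs : 0 < s) :
    ContinuousOn (fun t => bern (sm (scalingMeasure ρ P t)) s) (Iio 1) := by
  have hP' : P (Iio 0) = 0 := measure_mono_null Iio_subset_Iic_self hP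
  refine ContinuousOn.congr (f := fun t => (1 - t) ^ (1 / beta ρ - 1) *
    bern P ((1 - t) ^ (-(1 / beta ρ)) * s)) ?_ fun t ht => bern_sm_scalingMeasure hP ht s
  have h1 : ∀ q : ℝ, ContinuousOn (fun t : ℝ => (1 - t) ^ q) (Iio 1) := fun q =>
    ContinuousOn.rpow_const (by fun_prop) fun t ht => Or.inl (by
      have : t < 1 := ht
      linarith)
  refine (h1 _).mul ((continuousOn_bern hP').comp ((h1 _).mul continuousOn_const) fun t ht => ?_)
  have : 0 < 1 - t := by linarith [mem_Iio.1 ht]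
  exact mem_Ici.2 (by positivity)

/-- With B the primitive of `bern P` and p = 1/β, the left side is (1-t)^(2p-1) B((1-t)^(-p) s). In
the parameter y with y + y^(1+ρ) = (1-r)^(-p) s its derivative is elementary: the y^(2+ρ) terms
cancel, leaving the required multiple of y²/2. -/
lemma integral_expTaylor_scalingMeasure (hP : P (Iic 0) = 0) (hρ : 0 < ρ)
    (hlap : ∀ y, 0 < y → lap P (y + y ^ (1 + ρ)) = (1 + (1 + ρ) * y ^ ρ)⁻¹) {s : ℝ} (hs : 0 < s)
    (ht : t ∈ Ico (0 : ℝ) 1) :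
    ∫ x, expTaylor s x ∂(scalingMeasure ρ P t) = ∫ x, expTaylor s x ∂(scalingMeasure ρ P 0) +
      ∫ r in (0 : ℝ)..t, coagulation (expTaylor s) (scalingMeasure ρ P r) := by
  have hP' : P (Iio 0) = 0 := measure_mono_null Iio_subset_Iic_self hP
  have hβ := beta_pos hρ
  set p := 1 / beta ρ with hp
  have hfin : ∀ {r : ℝ}, r < 1 → secondMoment (scalingMeasure ρ P r) < ∞ := fun hr => by
    rw [secondMoment_scalingMeasure hP hr]; exact ENNReal.ofReal_lt_top
  set B : ℝ → ℝ := fun a => ∫ u in (0 : ℝ)..a, bern P u with hBdef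
  have hJ : ∀ {r : ℝ}, r < 1 → ∫ x, expTaylor s x ∂(scalingMeasure ρ P r) =
      (1 - r) ^ (2 * p - 1) * B ((1 - r) ^ (-p) * s) := by
    intro r hr
    have h1 : 0 < 1 - r := by linarith
    rw [integral_expTaylor (isRadonPos_scalingMeasure hP hr).null_nonpos (hfin hr) hs.le]
    simp only [bern_sm_scalingMeasure hP hr]
    rw [intervalIntegral.integral_const_mul,
      intervalIntegral.integral_comp_mul_left _ (Real.rpow_pos_of_pos h1 _).ne', mul_zero,
      smul_eq_mul, ← mul_assoc, ← Real.rpow_neg h1.le, ← Real.rpow_add h1, neg_neg]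
    congr 2; ring
  have hbc := continuousOn_bern hP'
  have hd : ∀ r ∈ uIcc 0 t, HasDerivAt (fun r => (1 - r) ^ (2 * p - 1) * B ((1 - r) ^ (-p) * s))
      (coagulation (expTaylor s) (scalingMeasure ρ P r)) r := by
    intro r hr
    rw [uIcc_of_le ht.1] at hr
    have hr1 : r < 1 := hr.2.trans_lt ht.2
    have h1 : 0 < 1 - r := by linarith
    rw [coagulation_expTaylor (isRadonPos_scalingMeasure hP hr1).null_nonpos (hfin hr1) hs.le,
      bern_sm_scalingMeasure hP hr1]
    have hu0 : 0 < (1 - r) ^ (-p) * s := by positivity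
    obtain ⟨y, hy0, -, hy⟩ := exists_add_rpow_eq hρ hu0
    have hBd : HasDerivAt B (bern P ((1 - r) ^ (-p) * s)) ((1 - r) ^ (-p) * s) := by
      refine intervalIntegral.integral_hasDerivAt_right ?_ ?_ (hbc.continuousAt (Ici_mem_nhds hu0))
      · refine (hbc.mono ?_).intervalIntegrable
        rw [uIcc_of_le hu0.le]; exact Icc_subset_Ici_self
      · exact (hbc.mono Ioi_subset_Ici_self).stronglyMeasurableAtFilter isOpen_Ioi _ hu0
    have hsub : HasDerivAt (fun r : ℝ => 1 - r) (-1) r := (hasDerivAt_id r).const_sub 1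
    have h2 := (hsub.rpow_const (p := 2 * p - 1) (Or.inl h1.ne')).mul
      (hBd.comp r ((hsub.rpow_const (p := -p) (Or.inl h1.ne')).mul_const s))
    refine h2.congr_deriv ?_
    simp only [Function.comp_apply]
    have hBy : B ((1 - r) ^ (-p) * s) = y ^ 2 / 2 + (1 + ρ) / (2 + ρ) * y ^ (2 + ρ) := by
      rw [← hy]; exact integral_bern_add_rpow hP' hρ hlap hy0.le
    have hby : bern P ((1 - r) ^ (-p) * s) = y := by
      rw [← hy]; exact bern_add_rpow hP' hρ hlap hy0.le
    rw [hBy, hby]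
    have e1 : (1 - r) ^ (2 * p - 1) * (y * (-1 * -p * (1 - r) ^ (-p - 1) * s)) =
        (1 - r) ^ (2 * p - 2) * (p * y * (y + y ^ (1 + ρ))) := by
      rw [hy]
      have : (1 - r) ^ (2 * p - 1) * (1 - r) ^ (-p - 1) =
          (1 - r) ^ (2 * p - 2) * (1 - r) ^ (-p) := by
        rw [← Real.rpow_add h1, ← Real.rpow_add h1]; congr 1; ring
      linear_combination (y * p * s) * this
    have e2 : ((1 - r) ^ (p - 1) * y) ^ 2 = (1 - r) ^ (2 * p - 2) * y ^ 2 := by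
      rw [mul_pow, ← Real.rpow_natCast ((1 - r) ^ (p - 1)), ← Real.rpow_mul h1.le]
      congr 2; push_cast; ring
    rw [e1, e2, show 2 * p - 1 - 1 = 2 * p - 2 by ring]
    have e3 : y ^ (2 + ρ) = y ^ 2 * y ^ ρ := by
      rw [Real.rpow_add hy0]; norm_cast
    have e4 : y ^ (1 + ρ) = y * y ^ ρ := by rw [Real.rpow_add hy0, Real.rpow_one]
    have e5 : p = (1 + ρ) / ρ := by rw [hp, beta]; field_simp
    rw [e3, e4]
    generalize (1 - r) ^ (2 * p - 2) = T
    generalize y ^ ρ = Z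
    rw [e5]
    field_simp
    ring
  have hci : IntervalIntegrable (fun r => coagulation (expTaylor s) (scalingMeasure ρ P r))
      volume 0 t := by
    refine ContinuousOn.intervalIntegrable ?_
    rw [uIcc_of_le ht.1]
    refine ContinuousOn.congr (f := fun r => 1 / 2 * bern (sm (scalingMeasure ρ P r)) s ^ 2) ?_
      fun r hr => ?_
    · exact continuousOn_const.mul (((continuousOn_bern_sm_scalingMeasure hP hs).mono
        fun r hr => hr.2.trans_lt ht.2).pow 2)
    · have hr1 : r < 1 := hr.2.trans_lt ht.2
      exact coagulation_expTaylor (isRadonPos_scalingMeasure hP hr1).null_nonpos (hfin hr1) hs.le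
  rw [intervalIntegral.integral_eq_sub_of_hasDerivAt hd hci, hJ ht.2, hJ one_pos]
  ring

end

/-! ### Quadratically bounded functions and stability of the weak equation -/

/-- Measurable functions on `(0, ∞)` with quadratic bounds, uniform in the constant `K`. -/
structure IsQuadratic (K : ℝ) (f : ℝ → ℝ) : Prop where
  measurable : Measurable f
  abs_le : ∀ x, 0 < x → |f x| ≤ K * x ^ 2
  abs_sub_le : ∀ x y, 0 < x → 0 < y → |f (x + y) - f x - f y| ≤ K * (x * y)

section
variable {μ : Measure ℝ} {K K' : ℝ} {f g : ℝ → ℝ}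

lemma IsQuadratic.add (hf : IsQuadratic K f) (hg : IsQuadratic K' g) :
    IsQuadratic (K + K') (fun x => f x + g x) := by
  refine ⟨hf.measurable.add hg.measurable, fun x hx => ?_, fun x y hx hy => ?_⟩
  · rw [add_mul]
    exact (abs_add_le _ _).trans (add_le_add (hf.abs_le x hx) (hg.abs_le x hx))
  · rw [add_mul, show f (x + y) + g (x + y) - (f x + g x) - (f y + g y) =
      (f (x + y) - f x - f y) + (g (x + y) - g x - g y) by ring]
    exact (abs_add_le _ _).trans (add_le_add (hf.abs_sub_le x y hx hy) (hg.abs_sub_le x y hx hy))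

lemma IsQuadratic.const_mul (hf : IsQuadratic K f) (c : ℝ) :
    IsQuadratic (|c| * K) (fun x => c * f x) := by
  refine ⟨hf.measurable.const_mul c, fun x hx => ?_, fun x y hx hy => ?_⟩
  · rw [abs_mul, mul_assoc]
    exact mul_le_mul_of_nonneg_left (hf.abs_le x hx) (abs_nonneg c)
  · rw [← mul_sub, ← mul_sub, abs_mul, mul_assoc]
    exact mul_le_mul_of_nonneg_left (hf.abs_sub_le x y hx hy) (abs_nonneg c)

lemma IsQuadratic.integrable (hf : IsQuadratic K f) (h0 : μ (Iic 0) = 0)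
    (h : secondMoment μ < ∞) : Integrable f μ := by
  refine Integrable.mono' ((integrable_sq h).const_mul K) hf.measurable.aestronglyMeasurable ?_
  filter_upwards [ae_pos_of_null h0] with x hx using hf.abs_le x hx

lemma IsQuadratic.abs_integral_le (hf : IsQuadratic K f) (h0 : μ (Iic 0) = 0)
    (h : secondMoment μ < ∞) : |∫ x, f x ∂μ| ≤ K * ∫ x, x ^ 2 ∂μ := by
  rw [← integral_const_mul, ← Real.norm_eq_abs]
  refine norm_integral_le_of_norm_le ((integrable_sq h).const_mul K) ?_
  filter_upwards [ae_pos_of_null h0] with x hx using hf.abs_le x hx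

variable [SFinite μ]

lemma ae_prod_pos (h0 : μ (Iic 0) = 0) : ∀ᵐ z ∂(μ.prod μ), 0 < z.1 ∧ 0 < z.2 := by
  refine Measure.ae_prod_iff_ae_ae ?_ |>.2 ?_
  · exact (measurableSet_Ioi.preimage measurable_fst).inter
      (measurableSet_Ioi.preimage measurable_snd)
  · filter_upwards [ae_pos_of_null h0] with x hx
    filter_upwards [ae_pos_of_null h0] with y hy using ⟨hx, hy⟩

lemma IsQuadratic.ae_norm_le (hf : IsQuadratic K f) (h0 : μ (Iic 0) = 0) :
    ∀ᵐ z ∂(μ.prod μ), ‖(f (z.1 + z.2) - f z.1 - f z.2) * (z.1 * z.2)‖ ≤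
      K * (z.1 ^ 2 * z.2 ^ 2) := by
  filter_upwards [ae_prod_pos h0] with z ⟨h1, h2⟩
  have h3 : 0 < z.1 * z.2 := mul_pos h1 h2
  rw [norm_mul, Real.norm_eq_abs, Real.norm_of_nonneg h3.le]
  calc _ ≤ K * (z.1 * z.2) * (z.1 * z.2) :=
        mul_le_mul_of_nonneg_right (hf.abs_sub_le _ _ h1 h2) h3.le
    _ = _ := by ring

lemma IsQuadratic.integrable_prod (hf : IsQuadratic K f) (h0 : μ (Iic 0) = 0)
    (h : secondMoment μ < ∞) :
    Integrable (fun z : ℝ × ℝ => (f (z.1 + z.2) - f z.1 - f z.2) * (z.1 * z.2)) (μ.prod μ) := by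
  have := hf.measurable
  exact Integrable.mono' (((integrable_sq h).mul_prod (integrable_sq h)).const_mul K)
    (by fun_prop : Measurable fun z : ℝ × ℝ =>
      (f (z.1 + z.2) - f z.1 - f z.2) * (z.1 * z.2)).aestronglyMeasurable (hf.ae_norm_le h0)

lemma IsQuadratic.coagulation_eq (hf : IsQuadratic K f) (h0 : μ (Iic 0) = 0)
    (h : secondMoment μ < ∞) : coagulation f μ =
      1 / 2 * ∫ z, (f (z.1 + z.2) - f z.1 - f z.2) * (z.1 * z.2) ∂(μ.prod μ) := by
  rw [coagulation, integral_prod _ (hf.integrable_prod h0 h)]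

/-- The bound Kxy on the increment, times the kernel xy, gives K x² y², whose double integral is a
squared second moment. So K controls both sides of the weak equation. -/
lemma IsQuadratic.abs_coagulation_le (hf : IsQuadratic K f) (h0 : μ (Iic 0) = 0)
    (h : secondMoment μ < ∞) : |coagulation f μ| ≤ 1 / 2 * (K * (∫ x, x ^ 2 ∂μ) ^ 2) := by
  rw [hf.coagulation_eq h0 h, abs_mul, abs_of_pos (by norm_num : (0 : ℝ) < 1 / 2)]
  refine mul_le_mul_of_nonneg_left ?_ (by norm_num)
  have h1 := norm_integral_le_of_norm_le
    (((integrable_sq h).mul_prod (integrable_sq h)).const_mul K) (hf.ae_norm_le h0)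
  rw [integral_const_mul, integral_prod_mul (fun x : ℝ => x ^ 2) (fun x : ℝ => x ^ 2), ← pow_two]
    at h1
  exact h1

lemma IsQuadratic.coagulation_add (hf : IsQuadratic K f) (hg : IsQuadratic K' g)
    (h0 : μ (Iic 0) = 0) (h : secondMoment μ < ∞) :
    coagulation (fun x => f x + g x) μ = coagulation f μ + coagulation g μ := by
  rw [hf.coagulation_eq h0 h, hg.coagulation_eq h0 h, (hf.add hg).coagulation_eq h0 h, ← mul_add,
    ← integral_add (hf.integrable_prod h0 h) (hg.integrable_prod h0 h)]
  congr 2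
  ext z; ring

omit [SFinite μ] in
lemma coagulation_const_mul (c : ℝ) : coagulation (fun x => c * f x) μ = c * coagulation f μ := by
  simp only [coagulation, ← mul_sub, mul_assoc c, integral_const_mul]
  ring

omit [SFinite μ] in
lemma coagulation_congr (h0 : μ (Iic 0) = 0) (h : ∀ x, 0 < x → f x = g x) :
    coagulation f μ = coagulation g μ := by
  unfold coagulation
  congr 1
  refine integral_congr_ae ((ae_pos_of_null h0).mono fun x hx => ?_)
  refine integral_congr_ae ((ae_pos_of_null h0).mono fun y hy => ?_)
  dsimp only
  rw [h x hx, h y hy, h _ (add_pos hx hy)]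

end

/-- Bounds for functions with bounded second derivative vanishing to second order at zero. -/
lemma isQuadratic_of_deriv {h h1 h2 : ℝ → ℝ} {K : ℝ} (hmeas : Measurable h)
    (hd : ∀ x, 0 < x → HasDerivAt h (h1 x) x) (hd1 : ∀ x, 0 < x → HasDerivAt h1 (h2 x) x)
    (hK : ∀ x, 0 < x → |h2 x| ≤ K) (h0 : Tendsto h (𝓝[>] 0) (𝓝 0))
    (h10 : Tendsto h1 (𝓝[>] 0) (𝓝 0)) : IsQuadratic K h := by
  have hK0 : 0 ≤ K := (abs_nonneg _).trans (hK 1 one_pos)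
  -- The mean value inequality is used on [a, b], then a → 0; values at 0 itself are never involved.
  have hlip : ∀ a b, 0 < a → 0 < b → |h1 b - h1 a| ≤ K * |b - a| := fun a b ha hb =>
    (convex_Ioi (0 : ℝ)).norm_image_sub_le_of_norm_hasDerivWithin_le
      (fun x hx => (hd1 x hx).hasDerivWithinAt) (fun x hx => hK x hx) ha hb
  have hid : Tendsto (fun a : ℝ => a) (𝓝[>] 0) (𝓝 0) := tendsto_id.mono_left nhdsWithin_le_nhds
  have hb1 : ∀ b, 0 < b → |h1 b| ≤ K * b := by
    intro b hb
    have t1 := (h10.const_sub (h1 b)).abs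
    have t2 := ((hid.const_sub b).abs).const_mul K
    rw [sub_zero] at t1 t2
    rw [abs_of_pos hb] at t2
    exact le_of_tendsto_of_tendsto t1 t2
      (eventually_nhdsWithin_of_forall fun a ha => hlip a b ha hb)
  refine ⟨hmeas, fun b hb => ?_, fun x y hx hy => ?_⟩
  · have t1 := (h0.const_sub (h b)).abs
    have t2 := ((hid.const_sub b).abs).const_mul (K * b)
    rw [sub_zero] at t1 t2
    rw [abs_of_pos hb] at t2
    rw [pow_two, ← mul_assoc]
    refine le_of_tendsto_of_tendsto t1 t2 ?_
    filter_upwards [Ioo_mem_nhdsGT hb] with a ha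
    refine (convex_Icc a b).norm_image_sub_le_of_norm_hasDerivWithin_le
      (fun x hx => (hd x (ha.1.trans_le hx.1)).hasDerivWithinAt) (fun x hx => ?_)
      (left_mem_Icc.2 ha.2.le) (right_mem_Icc.2 ha.2.le)
    exact (hb1 x (ha.1.trans_le hx.1)).trans (mul_le_mul_of_nonneg_left hx.2 hK0)
  · have hF : ∀ z, 0 < z → HasDerivAt (fun z => h (z + y) - h z - h y) (h1 (z + y) - h1 z) z :=
      fun z hz => (((hd (z + y) (add_pos hz hy)).comp_add_const z y).sub (hd z hz)).sub_const _
    have hF' : ∀ z, 0 < z → |h1 (z + y) - h1 z| ≤ K * y := fun z hz => by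
      have := hlip z (z + y) hz (add_pos hz hy)
      rwa [add_sub_cancel_left, abs_of_pos hy] at this
    have hF0 : Tendsto (fun z => h (z + y) - h z - h y) (𝓝[>] 0) (𝓝 0) := by
      have t1 : Tendsto (fun z => h (z + y)) (𝓝[>] 0) (𝓝 (h y)) := by
        refine (hd y hy).continuousAt.tendsto.comp ?_
        have : Tendsto (fun z : ℝ => z + y) (𝓝[>] 0) (𝓝 (0 + y)) := hid.add_const y
        rwa [zero_add] at this
      have := (t1.sub h0).sub_const (h y)
      rwa [sub_zero, sub_self] at this
    have t1 := (hF0.const_sub (h (x + y) - h x - h y)).abs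
    have t2 := ((hid.const_sub x).abs).const_mul (K * y)
    rw [sub_zero] at t1 t2
    rw [abs_of_pos hx] at t2
    rw [mul_comm x y, ← mul_assoc]
    refine le_of_tendsto_of_tendsto t1 t2 (eventually_nhdsWithin_of_forall fun a ha => ?_)
    exact (convex_Ioi (0 : ℝ)).norm_image_sub_le_of_norm_hasDerivWithin_le
      (fun z hz => (hF z hz).hasDerivWithinAt) (fun z hz => hF' z hz) ha hx

/-- A quadratically bounded function for which the weak form of the equation holds along `σ`. -/
def SatisfiesWeak (σ : ℝ → Measure ℝ) (f : ℝ → ℝ) : Prop :=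
  (∃ K, IsQuadratic K f) ∧ ∀ t ∈ Ico (0 : ℝ) 1,
    ContinuousOn (fun r => coagulation f (σ r)) (Icc 0 t) ∧
    ∫ x, f x ∂(σ t) = ∫ x, f x ∂(σ 0) + ∫ r in (0 : ℝ)..t, coagulation f (σ r)

section
variable {σ : ℝ → Measure ℝ} {f g : ℝ → ℝ}

lemma SatisfiesWeak.intervalIntegrable (hf : SatisfiesWeak σ f) {t : ℝ} (ht : t ∈ Ico (0 : ℝ) 1) :
    IntervalIntegrable (fun r => coagulation f (σ r)) volume 0 t := by
  refine ContinuousOn.intervalIntegrable ?_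
  rw [uIcc_of_le ht.1]
  exact (hf.2 t ht).1

lemma SatisfiesWeak.const_mul (hf : SatisfiesWeak σ f) (c : ℝ) :
    SatisfiesWeak σ (fun x => c * f x) := by
  obtain ⟨⟨K, hK⟩, h⟩ := hf
  refine ⟨⟨_, hK.const_mul c⟩, fun t ht => ?_⟩
  simp only [coagulation_const_mul, integral_const_mul, intervalIntegral.integral_const_mul]
  exact ⟨continuousOn_const.mul (h t ht).1, by rw [(h t ht).2, mul_add]⟩

variable (hσ : ∀ t ∈ Ico (0 : ℝ) 1, SFinite (σ t) ∧ σ t (Iic 0) = 0 ∧ secondMoment (σ t) < ∞)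
include hσ

lemma SatisfiesWeak.add (hf : SatisfiesWeak σ f) (hg : SatisfiesWeak σ g) :
    SatisfiesWeak σ (fun x => f x + g x) := by
  obtain ⟨K, hK⟩ := hf.1
  obtain ⟨K', hK'⟩ := hg.1
  refine ⟨⟨_, hK.add hK'⟩, fun t ht => ?_⟩
  have hco : ∀ r ∈ Icc 0 t, coagulation (fun x => f x + g x) (σ r) =
      coagulation f (σ r) + coagulation g (σ r) := fun r hr => by
    obtain ⟨h1, h2, h3⟩ := hσ r ⟨hr.1, hr.2.trans_lt ht.2⟩
    exact hK.coagulation_add hK' h2 h3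
  have hint : ∀ r ∈ Ico (0 : ℝ) 1, ∫ x, (f x + g x) ∂(σ r) = ∫ x, f x ∂(σ r) + ∫ x, g x ∂(σ r) :=
    fun r hr => by
      obtain ⟨h1, h2, h3⟩ := hσ r hr
      exact integral_add (hK.integrable h2 h3) (hK'.integrable h2 h3)
  refine ⟨((hf.2 t ht).1.add (hg.2 t ht).1).congr hco, ?_⟩
  rw [hint t ht, hint 0 ⟨le_rfl, one_pos⟩, (hf.2 t ht).2, (hg.2 t ht).2]
  rw [intervalIntegral.integral_congr (g := fun r => coagulation f (σ r) + coagulation g (σ r))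
    (fun r hr => hco r (by rwa [uIcc_of_le ht.1] at hr)),
    intervalIntegral.integral_add (hf.intervalIntegrable ht) (hg.intervalIntegrable ht)]
  ring

omit hσ in
lemma satisfiesWeak_zero : SatisfiesWeak σ (fun _ => 0) := by
  refine ⟨⟨0, measurable_const, fun x _ => by simp, fun x y _ _ => by simp⟩, fun t _ => ?_⟩
  have : ∀ r, coagulation (fun _ => 0) (σ r) = 0 := fun r => by simp [coagulation]
  simp only [this]
  exact ⟨continuousOn_const, by simp⟩

lemma satisfiesWeak_sum {ι : Type*} (s : Finset ι) {F : ι → ℝ → ℝ}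
    (hF : ∀ i ∈ s, SatisfiesWeak σ (F i)) : SatisfiesWeak σ (fun x => ∑ i ∈ s, F i x) := by
  classical
  induction s using Finset.induction_on with
  | empty => simpa using satisfiesWeak_zero
  | insert i s hi ih =>
    simp only [Finset.sum_insert hi]
    exact (hF i (Finset.mem_insert_self i s)).add hσ
      (ih fun j hj => hF j (Finset.mem_insert_of_mem hj))

/-- When f - g has quadratic constant ε, the integrals change by at most εM and the coagulation
terms by at most εM², uniformly on [0, t]. Uniform limits preserve continuity of the coagulation
term, and the total error ε(2M + M²) tends to 0. -/
lemma SatisfiesWeak.of_approx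
    (hbound : ∀ t ∈ Ico (0 : ℝ) 1, ∃ M, ∀ r ∈ Icc 0 t, ∫ x, x ^ 2 ∂(σ r) ≤ M)
    (hf : ∃ K, IsQuadratic K f)
    (happ : ∀ ε, 0 < ε → ∃ g, SatisfiesWeak σ g ∧ IsQuadratic ε (fun x => f x - g x)) :
    SatisfiesWeak σ f := by
  refine ⟨hf, fun t ht => ?_⟩
  obtain ⟨K, hK⟩ := hf
  obtain ⟨M, hM⟩ := hbound t ht
  have hσ' : ∀ r ∈ Icc 0 t, SFinite (σ r) ∧ σ r (Iic 0) = 0 ∧ secondMoment (σ r) < ∞ :=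
    fun r hr => hσ r ⟨hr.1, hr.2.trans_lt ht.2⟩
  have hsq0 : ∀ r, 0 ≤ ∫ x, x ^ 2 ∂(σ r) := fun r => integral_nonneg fun x => sq_nonneg x
  have hM0 : 0 ≤ M := (hsq0 0).trans (hM 0 ⟨le_rfl, ht.1⟩)
  have hco : ∀ {ε : ℝ} {g : ℝ → ℝ}, 0 ≤ ε → SatisfiesWeak σ g →
      IsQuadratic ε (fun x => f x - g x) → ∀ r ∈ Icc 0 t,
      |coagulation f (σ r) - coagulation g (σ r)| ≤ ε * M ^ 2 := by
    intro ε g hε hg hfg r hr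
    obtain ⟨h1, h2, h3⟩ := hσ' r hr
    obtain ⟨K', hK'⟩ := hg.1
    have h4 := hfg.coagulation_add hK' h2 h3
    simp only [sub_add_cancel] at h4
    have h5 := hfg.abs_coagulation_le h2 h3
    have h6 := pow_le_pow_left₀ (hsq0 r) (hM r hr) 2
    have h7 : 0 ≤ ε * (∫ x, x ^ 2 ∂(σ r)) ^ 2 := by positivity
    rw [h4, add_sub_cancel_right]
    calc _ ≤ _ := h5
      _ ≤ ε * (∫ x, x ^ 2 ∂(σ r)) ^ 2 := by linarith
      _ ≤ _ := mul_le_mul_of_nonneg_left h6 hε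
  have hcont : ContinuousOn (fun r => coagulation f (σ r)) (Icc 0 t) := by
    refine continuousOn_of_uniform_approx_of_continuousOn fun u hu => ?_
    obtain ⟨ε, hε, hεu⟩ := Metric.mem_uniformity_dist.1 hu
    obtain ⟨g, hg, hfg⟩ := happ (ε / (M ^ 2 + 1)) (by positivity)
    refine ⟨fun r => coagulation g (σ r), (hg.2 t ht).1, fun r hr => hεu ?_⟩
    rw [Real.dist_eq]
    refine (hco (by positivity) hg hfg r hr).trans_lt ?_
    rw [div_mul_eq_mul_div, div_lt_iff₀ (by positivity)]
    linarith
  refine ⟨hcont, ?_⟩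
  have hfi : IntervalIntegrable (fun r => coagulation f (σ r)) volume 0 t :=
    ContinuousOn.intervalIntegrable (by rwa [uIcc_of_le ht.1])
  have h0t : (0 : ℝ) ∈ Icc 0 t := ⟨le_rfl, ht.1⟩
  have htt : t ∈ Icc 0 t := ⟨ht.1, le_rfl⟩
  have hint : ∀ {ε : ℝ} {g : ℝ → ℝ}, 0 ≤ ε → SatisfiesWeak σ g →
      IsQuadratic ε (fun x => f x - g x) → ∀ r ∈ Icc 0 t,
      |∫ x, f x ∂(σ r) - ∫ x, g x ∂(σ r)| ≤ ε * M := by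
    intro ε g hε hg hfg r hr
    obtain ⟨h1, h2, h3⟩ := hσ' r hr
    obtain ⟨K', hK'⟩ := hg.1
    rw [← integral_sub (hK.integrable h2 h3) (hK'.integrable h2 h3)]
    exact (hfg.abs_integral_le h2 h3).trans (mul_le_mul_of_nonneg_left (hM r hr) hε)
  rw [← sub_eq_zero, ← abs_nonpos_iff]
  refine le_of_forall_pos_le_add fun δ hδ => ?_
  obtain ⟨g, hg, hfg⟩ := happ (δ / (2 * M + M ^ 2 + 1)) (by positivity)
  have hε : 0 ≤ δ / (2 * M + M ^ 2 + 1) := by positivity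
  set ε := δ / (2 * M + M ^ 2 + 1) with hεdef
  have a1 := hint hε hg hfg t htt
  have a2 := hint hε hg hfg 0 h0t
  have a3 : |(∫ r in (0 : ℝ)..t, coagulation f (σ r)) - ∫ r in (0 : ℝ)..t, coagulation g (σ r)| ≤
      ε * M ^ 2 := by
    rw [← intervalIntegral.integral_sub hfi (hg.intervalIntegrable ht)]
    have := intervalIntegral.norm_integral_le_of_norm_le_const (a := 0) (b := t)
      (f := fun r => coagulation f (σ r) - coagulation g (σ r)) (C := ε * M ^ 2) fun r hr => by
        rw [uIoc_of_le ht.1] at hr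
        exact hco hε hg hfg r (Ioc_subset_Icc_self hr)
    refine this.trans ?_
    rw [sub_zero, abs_of_nonneg ht.1]
    exact mul_le_of_le_one_right (by positivity) ht.2.le
  have a4 := (hg.2 t ht).2
  have a5 : ε * (2 * M + M ^ 2 + 1) = δ := div_mul_cancel₀ _ (by positivity)
  rw [abs_le] at a1 a2 a3 ⊢
  constructor <;> linarith [a1.1, a1.2, a2.1, a2.2, a3.1, a3.2]

end


/-! ### Approximation of test functions by exponentials -/

lemma hasDerivAt_expTaylor (s x : ℝ) :
    HasDerivAt (expTaylor s) (s * (1 - Real.exp (-(s * x)))) x := by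
  have h := ((hasDerivAt_exp_neg_mul s x).sub_const 1).add ((hasDerivAt_id x).const_mul s)
  refine h.congr_deriv ?_
  ring

lemma hasDerivAt_mul_one_sub_exp (s x : ℝ) :
    HasDerivAt (fun x => s * (1 - Real.exp (-(s * x)))) (s ^ 2 * Real.exp (-(s * x))) x := by
  have h := ((hasDerivAt_exp_neg_mul s x).const_sub 1).const_mul s
  refine h.congr_deriv ?_
  ring

lemma isQuadratic_expTaylor {s : ℝ} (hs : 0 ≤ s) : IsQuadratic (s ^ 2) (expTaylor s) := by
  refine isQuadratic_of_deriv (continuous_expTaylor s).measurable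
    (fun x _ => hasDerivAt_expTaylor s x) (fun x _ => hasDerivAt_mul_one_sub_exp s x)
    (fun x hx => ?_) ?_ ?_
  · rw [abs_of_nonneg (by positivity)]
    exact mul_le_of_le_one_right (by positivity)
      (Real.exp_le_one_iff.2 (neg_nonpos.2 (mul_nonneg hs hx.le)))
  · have := (continuous_expTaylor s).tendsto 0
    simp only [expTaylor, mul_zero, neg_zero, Real.exp_zero, sub_self, add_zero] at this
    exact this.mono_left nhdsWithin_le_nhds
  · have : Tendsto (fun x => s * (1 - Real.exp (-(s * x)))) (𝓝 0) (𝓝 (s * (1 - Real.exp (-(s * 0))))) :=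
      (by fun_prop : Continuous fun x => s * (1 - Real.exp (-(s * x)))).tendsto 0
    simp only [mul_zero, neg_zero, Real.exp_zero, sub_self] at this
    exact this.mono_left nhdsWithin_le_nhds

/-- The combination of the functions `expTaylor k` with second derivative `p(e^{-x}) - p(0)`. -/
noncomputable def polyExp (p : Polynomial ℝ) (x : ℝ) : ℝ :=
  ∑ k ∈ Finset.range (p.natDegree + 1), p.coeff k / (k : ℝ) ^ 2 * expTaylor k x

/-- The derivative of `polyExp p`. -/
noncomputable def polyExpDeriv (p : Polynomial ℝ) (x : ℝ) : ℝ :=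
  ∑ k ∈ Finset.range (p.natDegree + 1),
    p.coeff k / (k : ℝ) ^ 2 * ((k : ℝ) * (1 - Real.exp (-(k * x))))

lemma hasDerivAt_polyExp (p : Polynomial ℝ) (x : ℝ) :
    HasDerivAt (polyExp p) (polyExpDeriv p x) x :=
  HasDerivAt.fun_sum fun k _ => (hasDerivAt_expTaylor k x).const_mul _

lemma hasDerivAt_polyExpDeriv (p : Polynomial ℝ) (x : ℝ) :
    HasDerivAt (polyExpDeriv p) (p.eval (Real.exp (-x)) - p.eval 0) x := by
  have h : HasDerivAt (polyExpDeriv p) (∑ k ∈ Finset.range (p.natDegree + 1),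
      p.coeff k / (k : ℝ) ^ 2 * ((k : ℝ) ^ 2 * Real.exp (-(k * x)))) x :=
    HasDerivAt.fun_sum fun k _ => (hasDerivAt_mul_one_sub_exp k x).const_mul _
  refine h.congr_deriv ?_
  -- The index k = 0 is split off on both sides: division by 0² removes it from `polyExpDeriv`, in
  -- agreement with subtracting p(0).
  rw [Polynomial.eval_eq_sum_range, ← Polynomial.coeff_zero_eq_eval_zero, Finset.sum_range_succ',
    Finset.sum_range_succ']
  simp only [Nat.cast_zero, pow_zero, mul_one, add_sub_cancel_right]
  rw [zero_pow two_ne_zero, div_zero, zero_mul, add_zero]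
  refine Finset.sum_congr rfl fun k _ => ?_
  have hk : (((k + 1 : ℕ) : ℝ)) ^ 2 ≠ 0 := by positivity
  rw [← mul_assoc, div_mul_cancel₀ _ hk, ← Real.exp_nat_mul]
  congr 2; ring

lemma continuous_polyExp (p : Polynomial ℝ) : Continuous (polyExp p) :=
  continuous_iff_continuousAt.2 fun x => (hasDerivAt_polyExp p x).continuousAt

lemma continuous_polyExpDeriv (p : Polynomial ℝ) : Continuous (polyExpDeriv p) :=
  continuous_iff_continuousAt.2 fun x => (hasDerivAt_polyExpDeriv p x).continuousAt

lemma polyExp_zero (p : Polynomial ℝ) : polyExp p 0 = 0 :=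
  Finset.sum_eq_zero fun k _ => by simp [expTaylor]

lemma polyExpDeriv_zero (p : Polynomial ℝ) : polyExpDeriv p 0 = 0 :=
  Finset.sum_eq_zero fun k _ => by simp

section
variable {f : ℝ → ℝ}

lemma IsTestFunction.hasDerivAt (hf : IsTestFunction 2 f) {x : ℝ} (hx : 0 < x) :
    HasDerivAt f (iteratedDeriv 1 f x) x := by
  rw [iteratedDeriv_one]
  exact ((hf.contDiffOn.differentiableOn (by norm_num)).differentiableAt
    (Ioi_mem_nhds hx)).hasDerivAt

lemma IsTestFunction.contDiffOn_deriv (hf : IsTestFunction 2 f) : ContDiffOn ℝ 1 (deriv f) (Ioi 0) := by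
  have h := hf.contDiffOn
  rw [show ((2 : ℕ) : WithTop ℕ∞) = 1 + 1 by norm_num] at h
  exact ((contDiffOn_succ_iff_deriv_of_isOpen isOpen_Ioi).1 h).2.2

lemma IsTestFunction.hasDerivAt_deriv (hf : IsTestFunction 2 f) {x : ℝ} (hx : 0 < x) :
    HasDerivAt (iteratedDeriv 1 f) (iteratedDeriv 2 f x) x := by
  rw [iteratedDeriv_succ (n := 1), iteratedDeriv_one]
  exact ((hf.contDiffOn_deriv.differentiableOn (by norm_num)).differentiableAt
    (Ioi_mem_nhds hx)).hasDerivAt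

lemma IsTestFunction.continuousOn_deriv_two (hf : IsTestFunction 2 f) :
    ContinuousOn (iteratedDeriv 2 f) (Ioi 0) := by
  rw [iteratedDeriv_succ (n := 1), iteratedDeriv_one]
  exact hf.contDiffOn_deriv.continuousOn_deriv_of_isOpen isOpen_Ioi (by norm_num)

lemma IsTestFunction.exists_abs_deriv_two_le (hf : IsTestFunction 2 f) :
    ∃ C α : ℝ, 0 ≤ C ∧ 0 < α ∧ ∀ x, 0 < x → |iteratedDeriv 2 f x| ≤ C * Real.exp (-(α * x)) := by
  obtain ⟨C, α, hα, h⟩ := hf.decay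
  have h1 : ∀ x, 0 < x → |iteratedDeriv 2 f x| ≤ C * Real.exp (-(α * x)) := fun x hx => by
    rw [← neg_mul]
    refine le_trans ?_ (h x hx)
    exact Finset.single_le_sum (f := fun j => |iteratedDeriv j f x|)
      (fun j _ => abs_nonneg _) (by simp)
  refine ⟨C, α, ?_, hα, h1⟩
  have h2 := (abs_nonneg _).trans (h1 1 one_pos)
  exact nonneg_of_mul_nonneg_left h2 (Real.exp_pos _)

/-- Extend H continuously to [0, 1] and approximate within ε/2. The extension vanishes at 0, so
discarding p(0) costs at most another ε/2. -/
lemma exists_polynomial_near_of_tendsto {H : ℝ → ℝ} {l ε : ℝ} (hHc : ContinuousOn H (Ioo 0 1))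
    (hH0 : Tendsto H (𝓝[>] 0) (𝓝 0)) (hH1 : Tendsto H (𝓝[<] 1) (𝓝 l)) (hε : 0 < ε) :
    ∃ p : Polynomial ℝ, ∀ u ∈ Ioo (0 : ℝ) 1, |H u - (p.eval u - p.eval 0)| ≤ ε := by
  have hG := continuousOn_Icc_extendFrom_Ioo hHc hH0 hH1
  obtain ⟨p, hp⟩ := exists_polynomial_near_of_continuousOn 0 1 _ hG (ε / 2) (by positivity)
  refine ⟨p, fun u hu => ?_⟩
  have a1 := hp u (Ioo_subset_Icc_self hu)
  have a2 := hp 0 ⟨le_rfl, zero_le_one⟩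
  rw [eq_lim_at_left_extendFrom_Ioo one_pos hH0, sub_zero] at a2
  rw [extendFrom_eq (subset_closure hu) (hHc u hu).tendsto] at a1
  rw [abs_lt] at a1 a2
  rw [abs_le]
  constructor <;> linarith [a1.1, a1.2, a2.1, a2.2]

/-- The second derivative of a test function is uniformly close to a polynomial in `e^{-x}`
without constant term. -/
lemma IsTestFunction.exists_polynomial (hf : IsTestFunction 2 f) {ε : ℝ} (hε : 0 < ε) :
    ∃ p : Polynomial ℝ, ∀ x, 0 < x →
      |iteratedDeriv 2 f x - (p.eval (Real.exp (-x)) - p.eval 0)| ≤ ε := by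
  obtain ⟨C, α, hC, hα, hdec⟩ := hf.exists_abs_deriv_two_le
  obtain ⟨l, hl⟩ := hf.limit_zero 2 le_rfl
  have hinf : Tendsto (iteratedDeriv 2 f) atTop (𝓝 0) := by
    have h1 := (tendsto_exp_neg_mul_atTop hα).const_mul C
    rw [mul_zero] at h1
    refine squeeze_zero_norm' ?_ h1
    filter_upwards [eventually_gt_atTop 0] with x hx using hdec x hx
  -- Substitute u = e^{-x}: exponential decay gives the limit 0 at u = 0, and the limit of f'' at 0
  -- gives the one at u = 1.
  set H : ℝ → ℝ := fun u => iteratedDeriv 2 f (-Real.log u) with hH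
  have hpos : ∀ u ∈ Ioo (0 : ℝ) 1, 0 < -Real.log u := fun u hu =>
    neg_pos.2 (Real.log_neg hu.1 hu.2)
  have hHc : ContinuousOn H (Ioo 0 1) :=
    hf.continuousOn_deriv_two.comp (Real.continuousOn_log.mono (fun u hu => hu.1.ne')).neg hpos
  have hH0 : Tendsto H (𝓝[>] 0) (𝓝 0) :=
    hinf.comp (tendsto_neg_atBot_atTop.comp Real.tendsto_log_nhdsGT_zero)
  have hH1 : Tendsto H (𝓝[<] 1) (𝓝 l) := by
    refine hl.comp (tendsto_nhdsWithin_iff.2 ⟨?_, ?_⟩)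
    · have := (Real.continuousAt_log one_ne_zero).neg.tendsto
      rw [Pi.neg_apply, Real.log_one, neg_zero] at this
      exact this.mono_left nhdsWithin_le_nhds
    · filter_upwards [Ioo_mem_nhdsLT one_pos] with u hu using hpos u hu
  obtain ⟨p, hp⟩ := exists_polynomial_near_of_tendsto hHc hH0 hH1 hε
  refine ⟨p, fun x hx => ?_⟩
  have a1 := hp (Real.exp (-x)) ⟨Real.exp_pos _, Real.exp_lt_one_iff.2 (by linarith)⟩
  simpa only [hH, Real.log_exp, neg_neg] using a1

end

/-! ### The rescaled measures solve the equation -/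

section
variable {P : Measure ℝ} [IsProbabilityMeasure P] {ρ : ℝ}

lemma satisfiesWeak_expTaylor (hP : P (Iic 0) = 0) (hρ : 0 < ρ)
    (hlap : ∀ y, 0 < y → lap P (y + y ^ (1 + ρ)) = (1 + (1 + ρ) * y ^ ρ)⁻¹) {s : ℝ} (hs : 0 < s) :
    SatisfiesWeak (scalingMeasure ρ P) (expTaylor s) := by
  refine ⟨⟨_, isQuadratic_expTaylor hs.le⟩, fun t ht =>
    ⟨?_, integral_expTaylor_scalingMeasure hP hρ hlap hs ht⟩⟩
  refine ContinuousOn.congr (f := fun r => 1 / 2 * bern (sm (scalingMeasure ρ P r)) s ^ 2) ?_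
    fun r hr => ?_
  · exact continuousOn_const.mul (((continuousOn_bern_sm_scalingMeasure hP hs).mono
      fun r hr => hr.2.trans_lt ht.2).pow 2)
  · have hr1 : r < 1 := hr.2.trans_lt ht.2
    exact coagulation_expTaylor (isRadonPos_scalingMeasure hP hr1).null_nonpos
      (by rw [secondMoment_scalingMeasure hP hr1]; exact ENNReal.ofReal_lt_top) hs.le

lemma scalingMeasure_regular (hP : P (Iic 0) = 0) (t : ℝ) (ht : t ∈ Ico (0 : ℝ) 1) :
    SFinite (scalingMeasure ρ P t) ∧ scalingMeasure ρ P t (Iic 0) = 0 ∧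
      secondMoment (scalingMeasure ρ P t) < ∞ :=
  ⟨inferInstance, (isRadonPos_scalingMeasure hP ht.2).null_nonpos,
    by rw [secondMoment_scalingMeasure hP ht.2]; exact ENNReal.ofReal_lt_top⟩

lemma satisfiesWeak_polyExp (hP : P (Iic 0) = 0) (hρ : 0 < ρ)
    (hlap : ∀ y, 0 < y → lap P (y + y ^ (1 + ρ)) = (1 + (1 + ρ) * y ^ ρ)⁻¹) (p : Polynomial ℝ) :
    SatisfiesWeak (scalingMeasure ρ P) (polyExp p) := by
  refine satisfiesWeak_sum (scalingMeasure_regular hP) _ fun k _ => ?_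
  rcases Nat.eq_zero_or_pos k with rfl | hk
  · simpa using satisfiesWeak_zero
  · exact (satisfiesWeak_expTaylor hP hρ hlap (Nat.cast_pos.2 hk)).const_mul _

lemma integral_sq_scalingMeasure (hP : P (Iic 0) = 0) {t : ℝ} (ht : t < 1) :
    ∫ x, x ^ 2 ∂(scalingMeasure ρ P t) = (1 - t)⁻¹ := by
  have h1 : 0 < 1 - t := by linarith
  rw [integral_eq_lintegral_of_nonneg_ae (Eventually.of_forall fun x => sq_nonneg x) (by fun_prop)]
  change (secondMoment _).toReal = _
  rw [secondMoment_scalingMeasure hP ht, ENNReal.toReal_ofReal (by positivity)]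

/-- Nothing is known about f off (0, ∞), not even measurability, so it is replaced by 0 there. A
polynomial ε-close to f'' gives an exponential sum whose difference from f has quadratic constant ε.
-/
lemma IsTestFunction.satisfiesWeak {f : ℝ → ℝ} (hf : IsTestFunction 2 f) (hP : P (Iic 0) = 0)
    (hρ : 0 < ρ) (hlap : ∀ y, 0 < y → lap P (y + y ^ (1 + ρ)) = (1 + (1 + ρ) * y ^ ρ)⁻¹) :
    ∃ g, (∀ x, 0 < x → g x = f x) ∧ SatisfiesWeak (scalingMeasure ρ P) g := by
  classical
  set g : ℝ → ℝ := (Ioi 0).piecewise f (fun _ => 0) with hg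
  have hgf : ∀ x, 0 < x → g x = f x := fun x hx => piecewise_eq_of_mem _ _ _ hx
  have hgm : Measurable g := hf.contDiffOn.continuousOn.measurable_piecewise
    continuousOn_const measurableSet_Ioi
  have hgd : ∀ x, 0 < x → HasDerivAt g (iteratedDeriv 1 f x) x := fun x hx =>
    (hf.hasDerivAt hx).congr_of_eventuallyEq (by
      filter_upwards [Ioi_mem_nhds hx] with y hy using hgf y hy)
  have hg0 : Tendsto g (𝓝[>] 0) (𝓝 0) := by
    have := hf.vanish_zero 0 two_pos
    rw [iteratedDeriv_zero] at this
    exact this.congr' (eventually_nhdsWithin_of_forall fun x hx => (hgf x hx).symm)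
  obtain ⟨C, α, hC, hα, hdec⟩ := hf.exists_abs_deriv_two_le
  refine ⟨g, hgf, SatisfiesWeak.of_approx (scalingMeasure_regular hP) (fun t ht => ?_)
    ⟨C, ?_⟩ fun ε hε => ?_⟩
  · refine ⟨(1 - t)⁻¹, fun r hr => ?_⟩
    rw [integral_sq_scalingMeasure hP (hr.2.trans_lt ht.2)]
    have : 0 < 1 - t := by linarith [ht.2]
    exact inv_anti₀ this (by linarith [hr.2])
  · refine isQuadratic_of_deriv hgm hgd (fun x hx => hf.hasDerivAt_deriv hx) (fun x hx => ?_) hg0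
      (hf.vanish_zero 1 one_lt_two)
    exact (hdec x hx).trans (mul_le_of_le_one_right hC
      (Real.exp_le_one_iff.2 (neg_nonpos.2 (mul_pos hα hx).le)))
  · obtain ⟨p, hp⟩ := hf.exists_polynomial hε
    refine ⟨polyExp p, satisfiesWeak_polyExp hP hρ hlap p, ?_⟩
    have t0 : Tendsto (polyExp p) (𝓝[>] 0) (𝓝 0) := by
      have := (continuous_polyExp p).tendsto 0
      rw [polyExp_zero] at this
      exact this.mono_left nhdsWithin_le_nhds
    have t1 : Tendsto (polyExpDeriv p) (𝓝[>] 0) (𝓝 0) := by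
      have := (continuous_polyExpDeriv p).tendsto 0
      rw [polyExpDeriv_zero] at this
      exact this.mono_left nhdsWithin_le_nhds
    refine isQuadratic_of_deriv (hgm.sub (continuous_polyExp p).measurable)
      (fun x hx => (hgd x hx).sub (hasDerivAt_polyExp p x))
      (fun x hx => (hf.hasDerivAt_deriv hx).sub (hasDerivAt_polyExpDeriv p x)) hp ?_ ?_
    · simpa using hg0.sub t0
    · simpa using (hf.vanish_zero 1 one_lt_two).sub t1

/-- The rescaled measures form a solution of Smoluchowski's equation. -/
theorem isSolution_scalingMeasure (hP : P (Iic 0) = 0) (hρ : 0 < ρ)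
    (hlap : ∀ y, 0 < y → lap P (y + y ^ (1 + ρ)) = (1 + (1 + ρ) * y ^ ρ)⁻¹) :
    IsSolution 1 (scalingMeasure ρ P) := by
  refine ⟨fun t ht => isRadonPos_scalingMeasure hP ht.2, ?_, fun B hB _ =>
    (measurable_scalingMeasure ρ P hB.measurableSet).comp measurable_subtype_coe, ?_, ?_⟩
  · rw [secondMoment_scalingMeasure hP one_pos]; exact ENNReal.ofReal_lt_top
  · intro t ht
    calc ∫⁻ τ in Ioc 0 t, secondMoment (scalingMeasure ρ P τ) ^ 2
        ≤ ∫⁻ _ in Ioc 0 t, ENNReal.ofReal ((1 - t)⁻¹) ^ 2 := by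
          refine setLIntegral_mono measurable_const fun τ hτ => ?_
          rw [secondMoment_scalingMeasure hP (hτ.2.trans_lt ht.2)]
          have : 0 < 1 - t := by linarith [ht.2]
          gcongr
          exact hτ.2
      _ = ENNReal.ofReal ((1 - t)⁻¹) ^ 2 * volume (Ioc 0 t) := setLIntegral_const _ _
      _ < ∞ := ENNReal.mul_lt_top (ENNReal.pow_lt_top ENNReal.ofReal_lt_top)
          (by rw [Real.volume_Ioc]; exact ENNReal.ofReal_lt_top)
  · intro f hf t ht
    obtain ⟨g, hgf, hg⟩ := hf.satisfiesWeak hP hρ hlap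
    obtain ⟨K, hK⟩ := hg.1
    have hae : ∀ r ∈ Ico (0 : ℝ) 1, g =ᵐ[scalingMeasure ρ P r] f := fun r hr =>
      (ae_pos_of_null (isRadonPos_scalingMeasure hP hr.2).null_nonpos).mono hgf
    have hco : ∀ r ∈ Ico (0 : ℝ) 1, coagulation g (scalingMeasure ρ P r) =
        coagulation f (scalingMeasure ρ P r) := fun r hr =>
      coagulation_congr (isRadonPos_scalingMeasure hP hr.2).null_nonpos hgf
    have hsub : uIcc 0 t ⊆ Ico (0 : ℝ) 1 := by
      rw [uIcc_of_le ht.1]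
      exact fun r hr => ⟨hr.1, hr.2.trans_lt ht.2⟩
    obtain ⟨-, h2, h3⟩ := scalingMeasure_regular (ρ := ρ) hP t ht
    refine ⟨(hK.integrable h2 h3).congr (hae t ht), ?_, ?_⟩
    · exact (hg.intervalIntegrable ht).congr fun r hr => hco r (hsub (uIoc_subset_uIcc hr))
    · rw [← integral_congr_ae (hae t ht), ← integral_congr_ae (hae 0 ⟨le_rfl, one_pos⟩),
        (hg.2 t ht).2]
      congr 1
      exact intervalIntegral.integral_congr fun r hr => hco r (hsub hr)

theorem isScalingProfile_scalingDistribution (hP : P (Iio 0) = 0) (hρ : 0 < ρ)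
    (hlap : ∀ y, 0 < y → lap P (y + y ^ (1 + ρ)) = (1 + (1 + ρ) * y ^ ρ)⁻¹) :
    IsScalingProfile (beta ρ) (scalingDistribution ρ) := by
  have hP0 : P (Iic 0) = 0 := by
    rw [← Iio_union_right]
    exact measure_union_null hP (measure_singleton_eq_zero hP hρ hlap le_rfl)
  refine ⟨scalingMeasure ρ P, isSolution_scalingMeasure hP0 hρ hlap, ?_, fun t ht x hx => ?_⟩
  · rw [secondMoment_scalingMeasure hP0 one_pos]; simp
  · have h1 : 0 < 1 - t := by linarith [ht.2]
    rw [secondMomentDistribution_scalingMeasure hP0 ht.2,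
      real_Iic_eq_scalingDistribution hP hρ hlap (by positivity)]

end
end Smoluchowski

/-! ### The main theorem -/

theorem mainTheorem3 (ν : ℝ → Measure ℝ) (hν : Smoluchowski.IsSolution 1 ν)
    (hnorm : Smoluchowski.secondMoment (ν 0) = 1) :
    (∀ (lam : ℝ → ℝ) (P : Measure ℝ) [IsProbabilityMeasure P],
      Tendsto lam (𝓝[<] 1) atTop →
      P (Iio 0) = 0 →
      (∃ x : ℝ, 0 < x ∧ cdf P x < 1) →
      (∀ x : ℝ, 0 ≤ x → ContinuousAt (cdf P) x →
        Tendsto (fun t => Smoluchowski.secondMomentDistribution (ν t) (lam t * x))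
          (𝓝[<] 1) (𝓝 (cdf P x))) →
      ∃ ρ ∈ Ioc (0 : ℝ) 1, ∃ L : ℝ → ℝ, Smoluchowski.IsSlowlyVarying L ∧
        (fun x : ℝ => ∫ y in Ioc 0 x, y ^ 3 ∂(ν 0)) ~[atTop]
          (fun x : ℝ => x ^ (1 - ρ) * L x)) ∧
    (∀ ρ ∈ Ioc (0 : ℝ) 1, ∀ L : ℝ → ℝ, Smoluchowski.IsSlowlyVarying L →
      (fun x : ℝ => ∫ y in Ioc 0 x, y ^ 3 ∂(ν 0)) ~[atTop]
        (fun x : ℝ => x ^ (1 - ρ) * L x) →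
      (∃ lam : ℝ → ℝ, StrictMonoOn lam (Ico 0 1) ∧ (∀ t ∈ Ioo (0 : ℝ) 1, 0 < lam t) ∧
        Tendsto lam (𝓝[<] 1) atTop ∧
        ∀ x : ℝ, 0 ≤ x →
          Tendsto (fun t => Smoluchowski.secondMomentDistribution (ν t) (lam t * x))
            (𝓝[<] 1) (𝓝 (Smoluchowski.scalingDistribution ρ x))) ∧
      Smoluchowski.IsScalingProfile (Smoluchowski.beta ρ)
        (Smoluchowski.scalingDistribution ρ)) := by
  refine ⟨fun lam P _ hlam hP hnontriv hlim =>
    hν.regularVariation_of_tendsto hnorm hlam hP hnontriv hlim, fun ρ hρ L hL hf => ?_⟩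
  -- The law P obtained here is both the limit of the rescaled distributions and the seed of the
  -- scaling solution; only its transform is used to identify it with M_ρ.
  obtain ⟨lam, h1, h2, h3, P, hP, hP0, hlap, hlim⟩ := hν.exists_limit hnorm hρ hL hf
  refine ⟨⟨lam, h1, h2, h3, fun x hx => ?_⟩,
    Smoluchowski.isScalingProfile_scalingDistribution hP0 hρ.1 hlap⟩
  rw [← Smoluchowski.real_Iic_eq_scalingDistribution hP0 hρ.1 hlap hx]
  exact hlim x hx (Smoluchowski.measure_singleton_eq_zero hP0 hρ.1 hlap hx)
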